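/- Input graphs are connected, simple and undirected, with vertex set $\{0,\dots,n-1\}$, $n\ge 1$, and real edge weights. They are given by read-only adjacency lists: in one step a program can query the number of vertices, the degree of a vertex or an entry of an adjacency list, and can compare the weights of the edges in two list entries (weights are accessible through comparisons only). Programs run on a word RAM with word size $\beta(n)\in\Omega(\log n)$, that is, every number that a program computes fits into a constant number of words of $\beta(n)$ bits; arithmetic, bitwise, memory and output instructions and tests cost one step each. Let $\deg(v)$ denote the degree of $v$ and $\overline\Delta=\frac1n\sum_v\deg(v)$ the average degree. The space of a run is the size of the initial segment of memory cells that it uses (registers, input and output are not counted); the space complexity of a program on a graph is the maximum over all edge weightings of this graph. A program solves the MST problem if on every input it halts and has emitted each edge of some minimum spanning tree (MST) exactly once, and nothing else. Such a program has, on an input, preprocessing time $p$ and delay at most $d$ if it emits nothing before time $p$ and if from then on at most $d$ steps pass until the first emission, between consecutive emissions, and from the last emission to the end. **Theorem.** Let $\mathcal A$ be a program that solves the MST problem, let $\mathcal T$ be an upper bound on its running time ($\mathcal T$ may depend on the graph and its adjacency lists, but not on the weights), and let $\mathcal S$ be its space complexity. Let $\mathcal T$ be computable by a program in $O(\overline\Delta\,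 n)$ steps ($O(1)$ if $n=1$), and let $\mathcal S_{\mathcal T}$ be the space complexity of that program. Then there is a program that solves the MST problem with preprocessing time in $\Theta(n)$, with delay in $O(\mathcal T/n)$, and with space complexity in $\Omega(n+\mathcal S)$ and in $O(n+\mathcal S+\mathcal S_{\mathcal T})$; so the space complexity is in $\Theta(n+\mathcal S)$ whenever $\mathcal T$ can be evaluated within the stated time in $O(n+\mathcal S)$ space. If neither $\mathcal A$ nor the program that computes $\mathcal T$ ever reads a memory cell before writing it, then neither does this program. The constants depend on $\mathcal A$, on the program that computes $\mathcal T$ and on $\beta$, but not on the input. -/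

import Mathlib

namespace EnumMST

/-! ### Graphs, adjacency lists, minimum spanning trees -/

/-- Adjacency lists of a finite simple undirected graph with vertex set `{0, …, n - 1}`. -/
structure AdjLists (n : ℕ) where
  nbrs : Fin n → List (Fin n)
  nodup : ∀ u, (nbrs u).Nodup
  symm : ∀ u v, v ∈ nbrs u → u ∈ nbrs v
  loopless : ∀ u, u ∉ nbrs u

/-- The graph represented by the adjacency lists. -/
def AdjLists.graph {n : ℕ} (A : AdjLists n) : SimpleGraph (Fin n) where
  Adj u v := v ∈ A.nbrs u
  symm := ⟨fun u v h => A.symm u v h⟩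
  loopless := ⟨fun u h => A.loopless u h⟩

/-- The degree of the vertex with number `u` (`0` if there is no such vertex). -/
def AdjLists.degree {n : ℕ} (A : AdjLists n) (u : ℕ) : ℕ :=
  if h : u < n then (A.nbrs ⟨u, h⟩).length else 0

/-- The vertex in position `i` (counted from `0`) of the adjacency list of `u`, if it exists. -/
def AdjLists.entry {n : ℕ} (A : AdjLists n) (u i : ℕ) : Option (Fin n) :=
  if h : u < n then (A.nbrs ⟨u, h⟩)[i]? else none

/-- The edge in position `i` of the adjacency list of `u`, if it exists. -/
def AdjLists.edge {n : ℕ} (A : AdjLists n) (u i : ℕ) : Option (Sym2 (Fin n)) :=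
  if h : u < n then ((A.nbrs ⟨u, h⟩)[i]?).map (fun v => s(⟨u, h⟩, v)) else none

/-- The average degree `(1 / n) * ∑ deg v`. -/
def AdjLists.avgDegree {n : ℕ} (A : AdjLists n) : ℚ :=
  (∑ u : Fin n, (A.degree u : ℚ)) / n

/-- An edge-weighted graph given by adjacency lists. Only the weights of edges matter. -/
structure Input (n : ℕ) where
  lists : AdjLists n
  weight : Sym2 (Fin n) → ℝ

/-- `E` is the edge set of a spanning tree of `G`. -/
def IsSpanningTree {n : ℕ} (G : SimpleGraph (Fin n)) (E : Finset (Sym2 (Fin n))) : Prop :=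
  (E : Set (Sym2 (Fin n))) ⊆ G.edgeSet ∧
    (SimpleGraph.fromEdgeSet (E : Set (Sym2 (Fin n)))).IsTree

/-- `E` is the edge set of a minimum spanning tree of the weighted graph. -/
def IsMST {n : ℕ} (I : Input n) (E : Finset (Sym2 (Fin n))) : Prop :=
  IsSpanningTree I.lists.graph E ∧
    ∀ E' : Finset (Sym2 (Fin n)), IsSpanningTree I.lists.graph E' →
      ∑ e ∈ E, I.weight e ≤ ∑ e ∈ E', I.weight e

/-! ### The random access machine

A program is a finite term, independent of the input. It works on finitely many registers and on an
addressable memory; both hold natural numbers, whose size is bounded separately (`FitsWords`). The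
input is read-only and accessible through degree queries, neighbor queries and comparisons of edge
weights. Every instruction and every test of a branch or a loop costs one step. -/

/-- Unit-cost operations on words. -/
inductive Op
  | add | sub | mul | div | mod | lt | eq | land | lor | xor | shl | shr

def Op.eval : Op → ℕ → ℕ → ℕ
  | .add, a, b => a + b
  | .sub, a, b => a - b
  | .mul, a, b => a * b
  | .div, a, b => a / b
  | .mod, a, b => a % b
  | .lt, a, b => if a < b then 1 else 0
  | .eq, a, b => if a = b then 1 else 0
  | .land, a, b => a &&& b
  | .lor, a, b => a ||| b
  | .xor, a, b => a ^^^ b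
  | .shl, a, b => a <<< b
  | .shr, a, b => a >>> b

/-- Instructions; all arguments are names of registers, except for the number `c` in `const`. -/
inductive Instr
  /-- `d := c` -/
  | const (d c : ℕ)
  /-- `d := a` -/
  | move (d a : ℕ)
  /-- `d := a o b` -/
  | op (o : Op) (d a b : ℕ)
  /-- `d := memory[a]` -/
  | load (d a : ℕ)
  /-- `memory[a] := b` -/
  | store (a b : ℕ)
  /-- `d :=` number of vertices -/
  | order (d : ℕ)
  /-- `d :=` degree of vertex `u` -/
  | degree (d u : ℕ)
  /-- `d :=` entry number `i` in the adjacency list of vertex `u` (`0` if there is none) -/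
  | neighbor (d u i : ℕ)
  /-- `d := 1` if the edge in position `i` of the list of `u` weighs at most as much as the edge in
  position `j` of the list of `v`, and `d := 0` otherwise (also if one of them does not exist) -/
  | compare (d u i v j : ℕ)
  /-- output the edge between `u` and `v` -/
  | emit (u v : ℕ)

/-- Programs. A branch or loop tests whether its register is nonzero. -/
inductive Prog
  | instr (i : Instr)
  | seq (P Q : Prog)
  | branch (r : ℕ) (P Q : Prog)
  | loop (r : ℕ) (P : Prog)

/-- An emitted edge, with the number of steps executed when it has been emitted. -/
structure Emission where
  fst : ℕ
  snd : ℕ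
  time : ℕ

structure Config where
  reg : ℕ → ℕ
  /-- memory; `none` marks a cell that has not been written yet and that reads as `0` -/
  mem : ℕ → Option ℕ
  /-- number of steps executed so far -/
  time : ℕ
  /-- number of memory cells in use: all addresses accessed so far are smaller -/
  space : ℕ
  /-- largest number computed so far -/
  peak : ℕ
  /-- whether a memory cell has been read before it was written -/
  lazyRead : Bool
  /-- the edges emitted so far, in chronological order -/
  out : List Emission

/-- The configuration at the start. -/
def Config.start : Config where
  reg := fun _ => 0
  mem := fun _ => none
  time := 0
  space := 0
  peak := 0
  lazyRead := false
  out := []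

/-- Account for one step. -/
def Config.tick (s : Config) : Config := { s with time := s.time + 1 }

/-- Write the value `x` into register `d`. -/
def Config.set (s : Config) (d x : ℕ) : Config :=
  { s with reg := Function.update s.reg d x, peak := max s.peak x }

/-- The outcome of comparing the weights of two adjacency list entries. -/
noncomputable def Input.compare {n : ℕ} (I : Input n) (u i v j : ℕ) : ℕ :=
  match I.lists.edge u i, I.lists.edge v j with
  | some e, some f => if I.weight e ≤ I.weight f then 1 else 0
  | _, _ => 0

/-- The effect of one instruction, apart from its cost. -/
noncomputable def Instr.apply {n : ℕ} (I : Input n) (s : Config) : Instr → Config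
  | .const d c => s.set d c
  | .move d a => s.set d (s.reg a)
  | .op o d a b => s.set d (o.eval (s.reg a) (s.reg b))
  | .load d a =>
      { s with
        space := max s.space (s.reg a + 1)
        lazyRead := s.lazyRead || (s.mem (s.reg a)).isNone }.set d ((s.mem (s.reg a)).getD 0)
  | .store a b =>
      { s with
        mem := Function.update s.mem (s.reg a) (some (s.reg b))
        space := max s.space (s.reg a + 1) }
  | .order d => s.set d n
  | .degree d u => s.set d (I.lists.degree (s.reg u))
  | .neighbor d u i =>
      s.set d (((I.lists.entry (s.reg u) (s.reg i)).map (fun v => (v : ℕ))).getD 0)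
  | .compare d u i v j => s.set d (I.compare (s.reg u) (s.reg i) (s.reg v) (s.reg j))
  | .emit u v => { s with out := s.out ++ [⟨s.reg u, s.reg v, s.time⟩] }

/-- `Exec I P s t`: on input `I`, the program `P` started in `s` halts in `t`. -/
inductive Exec {n : ℕ} (I : Input n) : Prog → Config → Config → Prop
  | instr (i : Instr) (s : Config) : Exec I (.instr i) s (i.apply I s.tick)
  | seq {P Q : Prog} {s t r : Config} : Exec I P s t → Exec I Q t r → Exec I (.seq P Q) s r
  | branchTrue {a : ℕ} {P Q : Prog} {s t : Config} :
      s.reg a ≠ 0 → Exec I P s.tick t → Exec I (.branch a P Q) s t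
  | branchFalse {a : ℕ} {P Q : Prog} {s t : Config} :
      s.reg a = 0 → Exec I Q s.tick t → Exec I (.branch a P Q) s t
  | loopTrue {a : ℕ} {P : Prog} {s t r : Config} :
      s.reg a ≠ 0 → Exec I P s.tick t → Exec I (.loop a P) t r → Exec I (.loop a P) s r
  | loopFalse {a : ℕ} {P : Prog} {s : Config} :
      s.reg a = 0 → Exec I (.loop a P) s s.tick

/-- The program `P` halts on input `I`, in the configuration `s`. -/
def Run {n : ℕ} (P : Prog) (I : Input n) (s : Config) : Prop :=
  Exec I P Config.start s

/-! ### Resources and problems (all inputs are connected graphs) -/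

/-- With word size `β n`, every number that `P` computes fits into a constant number of words. -/
def FitsWords (β : ℕ → ℕ) (P : Prog) : Prop :=
  ∃ K : ℕ, ∀ (n : ℕ) (I : Input n), I.lists.graph.Connected →
    ∀ s, Run P I s → s.peak < 2 ^ (K * β n)

/-- `P` never reads a memory cell that it has not written, i.e. it needs no initialized memory. -/
def NoLazyMemory (P : Prog) : Prop :=
  ∀ (n : ℕ) (I : Input n), I.lists.graph.Connected → ∀ s, Run P I s → s.lazyRead = false

/-- `T` bounds the running time of `P`; it may depend on the graph, but not on the weights. -/
def RunsInTime (P : Prog) (T : ∀ n : ℕ, AdjLists n → ℕ) : Prop :=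
  ∀ (n : ℕ) (I : Input n), I.lists.graph.Connected → ∀ s, Run P I s → s.time ≤ T n I.lists

/-- `S` is the space complexity of `P`: the maximal number of memory cells that `P` uses on a given
graph, over all edge weights. -/
def HasSpaceComplexity (P : Prog) (S : ∀ n : ℕ, AdjLists n → ℕ) : Prop :=
  ∀ (n : ℕ) (A : AdjLists n), A.graph.Connected →
    IsGreatest {k : ℕ | ∃ (w : Sym2 (Fin n) → ℝ) (s : Config), Run P ⟨A, w⟩ s ∧ s.space = k} (S n A)

/-- In the configuration `s`, each edge of some minimum spanning tree has been emitted exactly once,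
and nothing else. -/
def EmitsMST {n : ℕ} (I : Input n) (s : Config) : Prop :=
  ∃ L : List (Sym2 (Fin n)), L.Nodup ∧ IsMST I L.toFinset ∧
    s.out.map (fun e => s(e.fst, e.snd)) = L.map (Sym2.map (fun v : Fin n => (v : ℕ)))

/-- `P` is an algorithm for the minimum spanning tree problem on connected graphs. -/
def SolvesMST (P : Prog) : Prop :=
  ∀ (n : ℕ) (I : Input n), I.lists.graph.Connected → ∃ s, Run P I s ∧ EmitsMST I s

/-- `P` computes `T`, and leaves the result in register `0`. -/
def Computes (P : Prog) (T : ∀ n : ℕ, AdjLists n → ℕ) : Prop :=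
  ∀ (n : ℕ) (I : Input n), I.lists.graph.Connected → ∃ s, Run P I s ∧ s.reg 0 = T n I.lists

/-- `P` runs in `O(average degree * n)` steps. (The summand `1` matters for the one-vertex graph
only, which has average degree `0`.) -/
def RunsInDegreeTime (P : Prog) : Prop :=
  ∃ c : ℕ, ∀ (n : ℕ) (I : Input n), I.lists.graph.Connected →
    ∀ s, Run P I s → (s.time : ℚ) ≤ c * (I.lists.avgDegree * n + 1)

/-- The run that ended in `s` has preprocessing time `p` and delay at most `d`: nothing is emitted
before time `p`, and from then on at most `d` steps pass until the first emission, between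
consecutive emissions, and from the last emission to the end. -/
def HasDelay (s : Config) (p : ℕ) (d : ℚ) : Prop :=
  List.IsChain (fun a b : ℕ => a ≤ b ∧ (b : ℚ) - a ≤ d)
    (p :: (s.out.map (fun e => e.time) ++ [s.time]))

end EnumMST

/-!
The enumeration interleaves a computation in the background with emissions. Edges of the spanning
tree are put into a queue as soon as they are known, every step of the background computation is
followed by a *tick* (`tickCode`), and after a number of ticks, the *quota*, the next edge of the
queue is emitted. The delay is then proportional to the quota, as long as the queue does not run
empty; this is what the invariant `Core` keeps track of.

*Ties.* The minimum spanning tree has to be determined before it is computed. Ties between edges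
are broken by the endpoints (`tieBreaker`), which amounts to a perturbation of the weights that
makes them injective and preserves strict inequalities between total weights
(`exists_perturbation`). For the perturbed weights there is only one minimum spanning tree, it is
also one for the original weights, and it contains the lightest edge of every vertex
(`IsMST.mem_of_minimal`). The given algorithm accesses weights by comparisons only, so it can be run
with the perturbed weights (`tieCompare`, `compare_perturbed`).

*The first part.* Let `b` be the average degree, rounded down, plus one. More than half of the
vertices have degree at most `2 * b` (`Collecting.exists_choosing`). The preprocessing finds them in
time linear in `n`, since it only asks for degrees. Then each of these vertices chooses its lightest
edge, in `O(b)` ticks per vertex (`wp_chooseAll`). As an edge is chosen at most twice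
(`Chosen.length_le_two_mul`), a quota proportional to `b` keeps the queue from running empty. With a
sufficiently large constant, at most `n / 8` edges have been emitted when `O(n * b)` ticks have
passed, which includes the evaluation of the time bound `T`, while about `n / 4` edges or more have
been put into the queue.

*The second part.* Now the quota is raised by a multiple of `T / n`, so that the edges that remain
last for another `2 * T` ticks (`lt_mul_raised_quota`). This is enough to emulate the given algorithm
(`exec_emul`). The edges that it emits are put into the queue unless they have been chosen in the
first part, and in the end the queue has contained every edge of the tree once
(`Chosen.exists_list`). An additional run of the algorithm with the original weights makes the space
at least that of the given algorithm. Afterwards the rest of the queue is emitted.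

*The delay.* It is proportional to the final quota, which is in `O(b + T / n)`. Since an algorithm
for minimum spanning trees inspects or emits every edge, `n * b` is in `O(T)`
(`sum_degree_le_of_solvesMST`), and the delay is in `O(T / n)` (`delay_le`).
-/

namespace EnumMST

/-! ### Semantics of programs -/

/-- Execution is deterministic. -/
theorem Exec.unique {n : ℕ} {I : Input n} {P : Prog} {s t t' : Config}
    (h : Exec I P s t) (h' : Exec I P s t') : t = t' := by
  induction h generalizing t' with
  | instr i s => cases h'; rfl
  | seq _ _ ih₁ ih₂ =>
    cases h' with
    | seq h₁ h₂ => cases ih₁ h₁; exact ih₂ h₂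
  | branchTrue h _ ih =>
    cases h' with
    | branchTrue _ h₁ => exact ih h₁
    | branchFalse h₀ _ => exact absurd h₀ h
  | branchFalse h _ ih =>
    cases h' with
    | branchTrue h₀ _ => exact absurd h h₀
    | branchFalse _ h₁ => exact ih h₁
  | loopTrue h _ _ ih₁ ih₂ =>
    cases h' with
    | loopTrue _ h₁ h₂ => cases ih₁ h₁; exact ih₂ h₂
    | loopFalse h₀ => exact absurd h₀ h
  | loopFalse h =>
    cases h' with
    | loopTrue h₀ _ _ => exact absurd h h₀
    | loopFalse _ => rfl

/-- The quantities that can only grow during a run. -/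
structure Config.Le (s t : Config) : Prop where
  time : s.time ≤ t.time
  space : s.space ≤ t.space
  peak : s.peak ≤ t.peak
  lazyRead : s.lazyRead = true → t.lazyRead = true
  out : s.out <+: t.out

theorem Config.Le.trans {s t r : Config} (h : s.Le t) (h' : t.Le r) : s.Le r :=
  ⟨h.time.trans h'.time, h.space.trans h'.space, h.peak.trans h'.peak,
    fun x => h'.lazyRead (h.lazyRead x), h.out.trans h'.out⟩

theorem Config.le_tick (s : Config) : s.Le s.tick :=
  ⟨Nat.le_succ _, le_rfl, le_rfl, id, List.prefix_rfl⟩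

theorem Instr.le_apply {n : ℕ} (I : Input n) (i : Instr) (s : Config) : s.Le (i.apply I s) := by
  cases i <;> constructor <;> simp +contextual [Instr.apply, Config.set]

theorem Exec.le {n : ℕ} {I : Input n} {P : Prog} {s t : Config} (h : Exec I P s t) : s.Le t := by
  induction h with
  | instr i s => exact s.le_tick.trans (i.le_apply I _)
  | seq _ _ ih₁ ih₂ => exact ih₁.trans ih₂
  | branchTrue _ _ ih => exact (Config.le_tick _).trans ih
  | branchFalse _ _ ih => exact (Config.le_tick _).trans ih
  | loopTrue _ _ _ ih₁ ih₂ => exact ((Config.le_tick _).trans ih₁).trans ih₂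
  | loopFalse _ => exact Config.le_tick _

theorem Exec.time_lt {n : ℕ} {I : Input n} {P : Prog} {s t : Config} (h : Exec I P s t) :
    s.time < t.time := by
  induction h with
  | instr i s => exact lt_of_lt_of_le (Nat.lt_succ_self s.time) (i.le_apply I s.tick).time
  | seq _ _ ih₁ ih₂ => exact ih₁.trans ih₂
  | branchTrue _ _ ih => exact (Nat.lt_succ_self _).trans ih
  | branchFalse _ _ ih => exact (Nat.lt_succ_self _).trans ih
  | loopTrue _ _ _ ih₁ ih₂ => exact ((Nat.lt_succ_self _).trans ih₁).trans ih₂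
  | loopFalse _ => exact Nat.lt_succ_self _

/-- All numbers in registers and memory cells have been recorded in `peak`. -/
def Config.Bounded (s : Config) : Prop :=
  (∀ r, s.reg r ≤ s.peak) ∧ ∀ a x, s.mem a = some x → x ≤ s.peak

theorem Config.Bounded.set {s : Config} (h : s.Bounded) (d x : ℕ) : (s.set d x).Bounded := by
  refine ⟨fun r => ?_, fun a y hy => le_max_of_le_left (h.2 a y hy)⟩
  by_cases hr : r = d
  · subst hr; simp [Config.set]
  · simpa [Config.set, hr] using Or.inl (h.1 r)

theorem Instr.bounded_apply {n : ℕ} (I : Input n) (i : Instr) {s : Config} (h : s.Bounded) :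
    (i.apply I s).Bounded := by
  cases i with
  | load d a => exact Config.Bounded.set (s := { s with space := _, lazyRead := _ }) h _ _
  | store a b =>
    refine ⟨h.1, fun c x hx => ?_⟩
    by_cases hc : c = s.reg a
    · subst hc
      simp only [Instr.apply, Function.update_self, Option.some.injEq] at hx
      exact hx ▸ h.1 b
    · simp only [Instr.apply, Function.update_of_ne hc] at hx
      exact h.2 c x hx
  | emit u v => exact h
  | _ => exact h.set _ _

theorem Exec.bounded {n : ℕ} {I : Input n} {P : Prog} {s t : Config} (h : Exec I P s t)
    (hs : s.Bounded) : t.Bounded := by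
  induction h with
  | instr i s => exact i.bounded_apply I (s := s.tick) hs
  | seq _ _ ih₁ ih₂ => exact ih₂ (ih₁ hs)
  | branchTrue _ _ ih => exact ih hs
  | branchFalse _ _ ih => exact ih hs
  | loopTrue _ _ _ ih₁ ih₂ => exact ih₂ (ih₁ hs)
  | loopFalse _ => exact hs

theorem Config.bounded_start : Config.start.Bounded :=
  ⟨fun _ => le_rfl, fun _ _ h => by simp [Config.start] at h⟩

/-- A run depends on the weights only through at most `2 * c` edges, where `c` is the number of its
steps that do not emit: it is also a run for all weights that agree with the given ones there. -/
theorem Exec.exists_compared {n : ℕ} {A : AdjLists n} {w : Sym2 (Fin n) → ℝ} {P : Prog}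
    {s t : Config} (h : Exec ⟨A, w⟩ P s t) :
    ∃ D : Finset (Sym2 (Fin n)),
      D.card + 2 * s.time + 2 * t.out.length ≤ 2 * t.time + 2 * s.out.length ∧
      ∀ w' : Sym2 (Fin n) → ℝ, (∀ e ∈ D, w' e = w e) → Exec ⟨A, w'⟩ P s t := by
  classical
  induction h with
  | instr i s =>
    cases i with
    | compare d u i v j =>
      refine ⟨(A.edge (s.reg u) (s.reg i)).toFinset ∪ (A.edge (s.reg v) (s.reg j)).toFinset,
        ?_, fun w' hw => ?_⟩
      · have h₁ := Finset.card_union_le (A.edge (s.reg u) (s.reg i)).toFinset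
          (A.edge (s.reg v) (s.reg j)).toFinset
        have h₂ : ∀ o : Option (Sym2 (Fin n)), o.toFinset.card ≤ 1 := by
          rintro (_ | _) <;> simp
        have h₃ := h₂ (A.edge (s.reg u) (s.reg i))
        have h₄ := h₂ (A.edge (s.reg v) (s.reg j))
        simp only [Instr.apply, Config.set, Config.tick]
        omega
      · have : Instr.apply ⟨A, w⟩ s.tick (.compare d u i v j)
            = Instr.apply ⟨A, w'⟩ s.tick (.compare d u i v j) := by
          have hc : Input.compare ⟨A, w⟩ (s.reg u) (s.reg i) (s.reg v) (s.reg j)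
              = Input.compare ⟨A, w'⟩ (s.reg u) (s.reg i) (s.reg v) (s.reg j) := by
            simp only [Input.compare]
            cases h₁ : A.edge (s.reg u) (s.reg i) with
            | none => rfl
            | some e =>
              cases h₂ : A.edge (s.reg v) (s.reg j) with
              | none => rfl
              | some f =>
                simp only
                simp only [hw e (by simp [h₁]), hw f (by simp [h₂])]
          simp only [Instr.apply, Config.tick, hc]
        rw [this]
        exact Exec.instr _ _
    | emit u v =>
      exact ⟨∅, by simp [Instr.apply, Config.tick]; omega,
        fun w' _ => Exec.instr (I := ⟨A, w'⟩) _ s⟩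
    | _ =>
      exact ⟨∅, by simp [Instr.apply, Config.tick, Config.set],
        fun w' _ => Exec.instr (I := ⟨A, w'⟩) _ s⟩
  | seq _ _ ih₁ ih₂ =>
    obtain ⟨D, hD, h₁⟩ := ih₁
    obtain ⟨D', hD', h₂⟩ := ih₂
    refine ⟨D ∪ D', ?_, fun w' hw => .seq (h₁ w' fun e he => hw e (by simp [he]))
      (h₂ w' fun e he => hw e (by simp [he]))⟩
    have := Finset.card_union_le D D'
    omega
  | branchTrue h _ ih =>
    obtain ⟨D, hD, h₁⟩ := ih
    refine ⟨D, ?_, fun w' hw => .branchTrue h (h₁ w' hw)⟩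
    simp only [Config.tick] at hD
    omega
  | branchFalse h _ ih =>
    obtain ⟨D, hD, h₁⟩ := ih
    refine ⟨D, ?_, fun w' hw => .branchFalse h (h₁ w' hw)⟩
    simp only [Config.tick] at hD
    omega
  | loopTrue h _ _ ih₁ ih₂ =>
    obtain ⟨D, hD, h₁⟩ := ih₁
    obtain ⟨D', hD', h₂⟩ := ih₂
    refine ⟨D ∪ D', ?_, fun w' hw => .loopTrue h (h₁ w' fun e he => hw e (by simp [he]))
      (h₂ w' fun e he => hw e (by simp [he]))⟩
    have := Finset.card_union_le D D'
    simp only [Config.tick] at hD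
    omega
  | loopFalse h =>
    exact ⟨∅, by simp [Config.tick], fun w' _ => .loopFalse h⟩

/-- Total correctness: `P`, started in `s`, halts in a configuration that satisfies `Q`. -/
def Wp {n : ℕ} (I : Input n) (P : Prog) (Q : Config → Prop) (s : Config) : Prop :=
  ∃ t, Exec I P s t ∧ Q t

section Wp

variable {n : ℕ} {I : Input n} {P P' : Prog} {Q Q' : Config → Prop} {s : Config}

/-- The postconditions need to be compared only in configurations that can follow `s`. -/
theorem Wp.mono (h : Wp I P Q s) (hQ : ∀ t, s.Le t → Q t → Q' t) : Wp I P Q' s :=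
  let ⟨t, ht, hq⟩ := h
  ⟨t, ht, hQ t ht.le hq⟩

theorem Wp.seq (h : Wp I P (Wp I P' Q) s) : Wp I (.seq P P') Q s :=
  let ⟨_, ht, r, hr, hq⟩ := h
  ⟨r, .seq ht hr, hq⟩

theorem Wp.branch {a : ℕ} (h₁ : s.reg a ≠ 0 → Wp I P Q s.tick)
    (h₂ : s.reg a = 0 → Wp I P' Q s.tick) : Wp I (.branch a P P') Q s := by
  by_cases h : s.reg a = 0
  · obtain ⟨t, ht, hq⟩ := h₂ h
    exact ⟨t, .branchFalse h ht, hq⟩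
  · obtain ⟨t, ht, hq⟩ := h₁ h
    exact ⟨t, .branchTrue h ht, hq⟩

/-- A loop that counts its register down to zero. -/
theorem Wp.loop_down {a : ℕ} {J : ℕ → Config → Prop} (hJ : ∀ j s, J j s → s.reg a = j)
    (step : ∀ j s, J (j + 1) s → Wp I P (J j) s.tick) (Q : Config → Prop)
    (hQ : ∀ s, J 0 s → Q s.tick) (j : ℕ) (hs : J j s) : Wp I (.loop a P) Q s := by
  induction j generalizing s with
  | zero => exact ⟨s.tick, .loopFalse (hJ 0 s hs), hQ s hs⟩
  | succ j ih =>
    obtain ⟨t, ht, hj⟩ := step j s hs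
    obtain ⟨r, hr, hq⟩ := ih hj
    exact ⟨r, .loopTrue (by rw [hJ _ s hs]; omega) ht hr, hq⟩

end Wp

/-! ### Spanning trees, exchange, and perturbed weights -/

section Trees

variable {n : ℕ} {G : SimpleGraph (Fin n)} {E : Finset (Sym2 (Fin n))}

theorem edgeSet_fromEdgeSet_of_subset (h : (E : Set (Sym2 (Fin n))) ⊆ G.edgeSet) :
    (SimpleGraph.fromEdgeSet (E : Set (Sym2 (Fin n)))).edgeSet = E := by
  rw [SimpleGraph.edgeSet_fromEdgeSet, sdiff_eq_left, Set.disjoint_left]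
  intro e he hd
  exact G.not_isDiag_of_mem_edgeSet (h he) hd

theorem isSpanningTree_iff : IsSpanningTree G E ↔ (E : Set (Sym2 (Fin n))) ⊆ G.edgeSet ∧
    (SimpleGraph.fromEdgeSet (E : Set (Sym2 (Fin n)))).Connected ∧ E.card + 1 = n := by
  refine and_congr_right fun h => ?_
  rw [SimpleGraph.isTree_iff_connected_and_card, edgeSet_fromEdgeSet_of_subset h]
  simp

theorem IsSpanningTree.card_add_one (h : IsSpanningTree G E) : E.card + 1 = n :=
  (isSpanningTree_iff.1 h).2.2

/-- An edge at `v` outside of a spanning tree can be exchanged for a tree edge at `v`. -/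
theorem IsSpanningTree.exists_exchange (hE : IsSpanningTree G E) {v x : Fin n} (hvx : G.Adj v x)
    (hx : s(v, x) ∉ E) :
    ∃ y, G.Adj v y ∧ s(v, y) ∈ E ∧ IsSpanningTree G (insert s(v, x) (E.erase s(v, y))) := by
  classical
  obtain ⟨hsub, hconn, hcard⟩ := isSpanningTree_iff.1 hE
  obtain ⟨p, hp⟩ := hconn.exists_isPath v x
  cases p with
  | nil => exact absurd rfl hvx.ne
  | @cons _ y _ hvy p =>
    rw [SimpleGraph.Walk.cons_isPath_iff] at hp
    have hyE : s(v, y) ∈ E := by simpa using (SimpleGraph.fromEdgeSet_adj _ |>.1 hvy).1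
    have hne : s(v, x) ≠ s(v, y) := fun h => hx (h ▸ hyE)
    refine ⟨y, hsub hyE, hyE, isSpanningTree_iff.2 ⟨?_, ?_, ?_⟩⟩
    · intro e he
      simp only [Finset.coe_insert, Finset.coe_erase, Set.mem_insert_iff, Set.mem_sdiff] at he
      rcases he with rfl | he
      · exact hvx
      · exact hsub he.1
    · set H := SimpleGraph.fromEdgeSet (insert s(v, x) (E : Set (Sym2 (Fin n)))) with hH
      have hle : SimpleGraph.fromEdgeSet (E : Set (Sym2 (Fin n))) ≤ H :=
        SimpleGraph.fromEdgeSet_mono (Set.subset_insert _ _)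
      have hHvx : H.Adj v x := by simp [hH, hvx.ne]
      -- the walk `v x … y` closes a cycle through the edge `v y`
      have hbr : ¬ H.IsBridge s(v, y) := by
        rw [SimpleGraph.isBridge_iff_forall_walk_mem_edges]
        push Not
        refine ⟨.cons hHvx (p.mapLe hle).reverse, ?_⟩
        rw [SimpleGraph.Walk.edges_cons, List.mem_cons, not_or]
        refine ⟨hne.symm, fun h => hp.2 ?_⟩
        have := SimpleGraph.Walk.fst_mem_support_of_mem_edges _ h
        simpa using this
      have hc := (hconn.mono hle).connected_delete_edge_of_not_isBridge hbr
      convert hc using 1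
      ext a b
      simp only [hH, SimpleGraph.fromEdgeSet_adj, SimpleGraph.deleteEdges_adj, Finset.coe_insert,
        Finset.coe_erase, Set.mem_insert_iff, Set.mem_sdiff, Set.mem_singleton_iff]
      constructor
      · rintro ⟨h | h, hab⟩
        · exact ⟨⟨Or.inl h, hab⟩, fun h' => hne (h.symm.trans h')⟩
        · exact ⟨⟨Or.inr h.1, hab⟩, h.2⟩
      · rintro ⟨⟨h | h, hab⟩, h'⟩
        · exact ⟨Or.inl h, hab⟩
        · exact ⟨Or.inr ⟨h, h'⟩, hab⟩
    · rw [Finset.card_insert_of_notMem (fun h => hx (Finset.mem_of_mem_erase h)),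
        Finset.card_erase_add_one hyE, hcard]

theorem sum_exchange (w : Sym2 (Fin n) → ℝ) {e f : Sym2 (Fin n)} (he : e ∉ E) (hf : f ∈ E) :
    ∑ g ∈ insert e (E.erase f), w g = ∑ g ∈ E, w g + w e - w f := by
  classical
  rw [Finset.sum_insert (fun h => he (Finset.mem_of_mem_erase h)), ← Finset.add_sum_erase E w hf]
  ring

/-- If no other edge at `v` is as light as `v x`, then every minimum spanning tree contains it. -/
theorem IsMST.mem_of_minimal {I : Input n} (hE : IsMST I E) {v x : Fin n}
    (hvx : I.lists.graph.Adj v x)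
    (hmin : ∀ y, I.lists.graph.Adj v y → I.weight s(v, y) ≤ I.weight s(v, x) → y = x) :
    s(v, x) ∈ E := by
  by_contra hx
  obtain ⟨y, hvy, hy, hE'⟩ := hE.1.exists_exchange hvx hx
  have h := hE.2 _ hE'
  rw [sum_exchange _ hx hy] at h
  exact hx (hmin y hvy (by linarith) ▸ hy)

end Trees

/-- The number by which ties are broken between edges of equal weight. -/
def tieBreaker (n : ℕ) : Sym2 (Fin n) → ℕ :=
  Sym2.lift ⟨fun u v => max (u : ℕ) v * n + min (u : ℕ) v, fun u v => by
    simp only [max_comm, min_comm]⟩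

theorem tieBreaker_injective (n : ℕ) : Function.Injective (tieBreaker n) := by
  intro e f
  induction e using Sym2.ind with | _ a b => ?_
  induction f using Sym2.ind with | _ c d => ?_
  simp only [tieBreaker, Sym2.lift_mk]
  intro h
  have hn : 0 < n := a.pos
  have h₁ : min (a : ℕ) b < n := min_lt_of_left_lt a.2
  have h₂ : min (c : ℕ) d < n := min_lt_of_left_lt c.2
  have hmin : min (a : ℕ) b = min (c : ℕ) d := by
    have := congrArg (· % n) h
    simpa [Nat.mul_add_mod_of_lt, Nat.mod_eq_of_lt, h₁, h₂, Nat.add_mod] using this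
  have hmax : max (a : ℕ) b = max (c : ℕ) d := by
    rw [hmin] at h
    exact Nat.eq_of_mul_eq_mul_right hn (Nat.add_right_cancel h)
  rw [Sym2.eq_iff]
  simp only [Fin.ext_iff]
  omega

/-- The order of the edges by weight, with ties broken by `tieBreaker`. -/
def TieLe {n : ℕ} (w : Sym2 (Fin n) → ℝ) (e f : Sym2 (Fin n)) : Prop :=
  w e < w f ∨ w e = w f ∧ tieBreaker n e ≤ tieBreaker n f

/-- A small perturbation breaks the ties between edges and keeps every strict inequality between
the total weights of two sets of edges. -/
theorem exists_perturbation {n : ℕ} (w : Sym2 (Fin n) → ℝ) :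
    ∃ w' : Sym2 (Fin n) → ℝ, (∀ e f, w' e ≤ w' f ↔ TieLe w e f) ∧
      ∀ E F : Finset (Sym2 (Fin n)), ∑ e ∈ E, w e < ∑ e ∈ F, w e →
        ∑ e ∈ E, w' e < ∑ e ∈ F, w' e := by
  have key : ∀ᶠ ε : ℝ in nhdsWithin 0 (Set.Ioi 0), ∀ p : Finset (Sym2 (Fin n)) ×
      Finset (Sym2 (Fin n)), ∑ e ∈ p.1, w e < ∑ e ∈ p.2, w e →
        ∑ e ∈ p.1, (w e + ε * tieBreaker n e) < ∑ e ∈ p.2, (w e + ε * tieBreaker n e) := by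
    rw [Filter.eventually_all]
    rintro ⟨E, F⟩
    by_cases h : ∑ e ∈ E, w e < ∑ e ∈ F, w e
    · have hc : ∀ D : Finset (Sym2 (Fin n)), Continuous fun ε : ℝ =>
          ∑ e ∈ D, (w e + ε * tieBreaker n e) := fun D => by fun_prop
      have := (hc E).continuousAt.eventually_lt (hc F).continuousAt (x₀ := 0) (by simpa using h)
      exact (this.filter_mono nhdsWithin_le_nhds).mono fun ε hε _ => hε
    · exact Filter.Eventually.of_forall fun ε hh => absurd hh h
  obtain ⟨ε, hε, hpos⟩ := (key.and self_mem_nhdsWithin).exists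
  have hpos : 0 < ε := hpos
  have hlt : ∀ e f, w e < w f → w e + ε * tieBreaker n e < w f + ε * tieBreaker n f :=
    fun e f h => by simpa using hε ({e}, {f}) (by simpa using h)
  refine ⟨fun e => w e + ε * tieBreaker n e, fun e f => ?_, fun E F h => hε (E, F) h⟩
  rcases lt_trichotomy (w e) (w f) with h | h | h
  · exact iff_of_true (hlt e f h).le (Or.inl h)
  · simp [TieLe, h, hpos]
  · refine iff_of_false (hlt f e h).not_ge ?_
    rintro (h' | h')
    · exact lt_asymm h h'
    · exact h.ne' h'.1

/-- The perturbed weights are injective. -/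
theorem tieLe_antisymm {n : ℕ} {w : Sym2 (Fin n) → ℝ} {e f : Sym2 (Fin n)} (h : TieLe w e f)
    (h' : TieLe w f e) : e = f := by
  apply tieBreaker_injective n
  rcases h with h | h <;> rcases h' with h' | h'
  · exact absurd h' h.not_gt
  · exact absurd h h'.1.not_gt
  · exact absurd h' h.1.not_gt
  · exact h.2.antisymm h'.2

/-! ### Degrees, and a lower bound for the running time -/

section Lower

variable {n : ℕ}

theorem AdjLists.degree_fin (A : AdjLists n) (u : Fin n) : A.degree u = (A.nbrs u).length := by
  simp [AdjLists.degree]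

/-- The handshaking lemma. -/
theorem AdjLists.sum_degree (A : AdjLists n) [Fintype A.graph.edgeSet] :
    ∑ u : Fin n, A.degree u = 2 * A.graph.edgeFinset.card := by
  classical
  have : DecidableRel A.graph.Adj := Classical.decRel _
  have h := A.graph.sum_degrees_eq_twice_card_edges
  have hE : ∀ i j : Fintype A.graph.edgeSet, (@SimpleGraph.edgeFinset _ A.graph i).card
      = (@SimpleGraph.edgeFinset _ A.graph j).card := fun i j => by congr!
  rw [hE _ _, ← h]
  refine Finset.sum_congr rfl fun u _ => ?_
  rw [A.degree_fin, ← List.toFinset_card_of_nodup (A.nodup u), SimpleGraph.degree]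
  congr 1
  ext v
  rw [List.mem_toFinset, SimpleGraph.mem_neighborFinset]
  rfl

/-- An algorithm for minimum spanning trees looks at the weight of every edge that it does not
emit, since otherwise it would miss that this edge became very light. -/
theorem sum_degree_le_of_solvesMST {P : Prog} {T : ∀ n : ℕ, AdjLists n → ℕ} (hP : SolvesMST P)
    (hT : RunsInTime P T) {A : AdjLists n} (hA : A.graph.Connected) :
    ∑ u : Fin n, A.degree u ≤ 4 * T n A ∧ n ≤ T n A + 1 ∧ 1 ≤ T n A := by
  classical
  obtain ⟨s, hs, L, hL, hmst, hout⟩ := hP n ⟨A, fun _ => 0⟩ hA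
  obtain ⟨D, hD, hw⟩ := Exec.exists_compared hs
  have htime : s.time ≤ T n A := hT n _ hA s hs
  have hlen : s.out.length = L.toFinset.card := by
    rw [List.toFinset_card_of_nodup hL]
    simpa using congrArg List.length hout
  have hcard := hmst.1.card_add_one
  have hpos := hs.time_lt
  simp only [Config.start, List.length_nil] at hD hpos
  refine ⟨?_, by omega, by omega⟩
  rw [A.sum_degree]
  have hsub : A.graph.edgeFinset ⊆ D ∪ L.toFinset := by
    intro e he
    by_contra hn
    simp only [Finset.mem_union, not_or] at hn
    obtain ⟨heD, heL⟩ := hn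
    rw [SimpleGraph.mem_edgeFinset] at he
    -- make `e` lighter than all other edges
    set w : Sym2 (Fin n) → ℝ := fun f => if f = e then -1 else 0 with hwdef
    have hrun : Run P ⟨A, w⟩ s := hw w fun f hf => if_neg fun h : f = e => heD (h ▸ hf)
    obtain ⟨s', hs', L', hL', hmst', hout'⟩ := hP n ⟨A, w⟩ hA
    obtain rfl := hs'.unique hrun
    have hLL : L' = L := by
      have := hout'.symm.trans hout
      exact (List.map_injective_iff.2 (Sym2.map.injective Fin.val_injective)) this
    subst hLL
    induction e using Sym2.ind with | _ v x => ?_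
    exact heL (hmst'.mem_of_minimal he fun y hy hle => by
      by_contra hyx
      have : s(v, y) ≠ s(v, x) := fun h => hyx (by
        rcases Sym2.eq_iff.1 h with h | h
        · exact h.2
        · exact absurd h.2.symm hy.ne)
      simp only [hwdef, if_neg this, if_true] at hle
      norm_num at hle)
  have := (Finset.card_le_card hsub).trans (Finset.card_union_le _ _)
  omega

end Lower

/-! ### Building blocks of the program -/

/-- Registers and memory cells are divided into eight classes; this is number `a` of class `k`.
Class `0` of the registers belongs to the enumeration itself, the classes `1`, `2`, `3` belong to
the emulated programs, which also have the memory cells of their class. The enumeration uses the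
memory cells of class `0` for the neighbors that the vertices choose, class `4` for the list of the
vertices of small degree, and the classes `5` and `6` for the endpoints of the edges in the
queue. -/
def cell (k a : ℕ) : ℕ := 8 * a + k

@[simp]
theorem cell_inj {k k' a a' : ℕ} (hk : k < 8) (hk' : k' < 8) :
    cell k a = cell k' a' ↔ k = k' ∧ a = a' := by
  unfold cell
  omega

namespace Reg

/-! Registers of the enumeration. Those with numbers below `22`, except for `head`, `cnt`, `tail`
and `quota`, are volatile. -/

/-- written to, but never read -/
abbrev junk : ℕ := cell 0 0
abbrev t0 : ℕ := cell 0 1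
abbrev t1 : ℕ := cell 0 2
abbrev flag : ℕ := cell 0 3
abbrev outU : ℕ := cell 0 4
abbrev outV : ℕ := cell 0 5
/-- number of emitted edges -/
abbrev head : ℕ := cell 0 6
/-- number of ticks since the last emission -/
abbrev cnt : ℕ := cell 0 7
/-- number of edges that have been put into the queue -/
abbrev tail : ℕ := cell 0 8
/-- number of ticks between two emissions -/
abbrev quota : ℕ := cell 0 9
-- arguments and the result of a comparison, and intermediate results for breaking ties

abbrev a0 : ℕ := cell 0 10
abbrev a1 : ℕ := cell 0 11
abbrev a2 : ℕ := cell 0 12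
abbrev a3 : ℕ := cell 0 13
abbrev res : ℕ := cell 0 14
abbrev c1 : ℕ := cell 0 15
abbrev c2 : ℕ := cell 0 16
abbrev id1 : ℕ := cell 0 17
abbrev id2 : ℕ := cell 0 18
abbrev num : ℕ := cell 0 19
abbrev x1 : ℕ := cell 0 20
abbrev x2 : ℕ := cell 0 21
/-- the current vertex, or the number of vertices that remain in a loop over all vertices -/
abbrev v : ℕ := cell 0 22
/-- the position of the lightest edge of `v` so far, or a threshold for degrees -/
abbrev best : ℕ := cell 0 23
/-- number of vertices or edges that remain in a loop -/
abbrev i : ℕ := cell 0 24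
/-- number of list entries that remain in a loop -/
abbrev j : ℕ := cell 0 25
abbrev sum : ℕ := cell 0 26
abbrev avg : ℕ := cell 0 27
/-- number of vertices of small degree -/
abbrev len : ℕ := cell 0 28

end Reg

open Reg

/-- Straight-line code, followed by an instruction without effect. -/
def code : List Instr → Prog
  | [] => .instr (.const junk 0)
  | i :: l => .seq (.instr i) (code l)

/-- The effect of straight-line code. -/
noncomputable def runList {n : ℕ} (I : Input n) : List Instr → Config → Config
  | [], s => s
  | i :: l, s => runList I l (i.apply I s.tick)

section

variable {n : ℕ} {I : Input n} {s t : Config}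

@[simp] theorem runList_nil : runList I [] s = s := rfl

@[simp] theorem runList_cons (i : Instr) (l : List Instr) :
    runList I (i :: l) s = runList I l (i.apply I s.tick) := rfl

@[simp] theorem runList_append (l l' : List Instr) :
    runList I (l ++ l') s = runList I l' (runList I l s) := by
  induction l generalizing s with
  | nil => rfl
  | cons i l ih => exact ih

theorem exec_code (l : List Instr) :
    Exec I (code l) s (((runList I l s).tick).set junk 0) := by
  induction l generalizing s with
  | nil => exact .instr _ _
  | cons i l ih => exact .seq (.instr _ _) ih

theorem wp_code {l : List Instr} {Q : Config → Prop} (h : Q (((runList I l s).tick).set junk 0)) :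
    Wp I (code l) Q s := ⟨_, exec_code l, h⟩

end

/-- Load into `d` the cell of class `k` whose number is in `a`. -/
def ld (k d a : ℕ) : List Instr :=
  [.const t0 8, .op .mul t0 a t0, .const t1 k, .op .add t0 t0 t1, .load d t0]

/-- Store `b` into the cell of class `k` whose number is in `a`. -/
def st (k a b : ℕ) : List Instr :=
  [.const t0 8, .op .mul t0 a t0, .const t1 k, .op .add t0 t0 t1, .store t0 b]

-- straight-line code is executed symbolically by `simp`
attribute [simp] Instr.apply Config.set Config.tick Op.eval

section

variable {n : ℕ} {I : Input n} {s : Config} {k d a b : ℕ}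

theorem runList_ld (ha : a ≠ t0) :
    runList I (ld k d a) s =
      { reg := Function.update
          (Function.update (Function.update s.reg t0 (cell k (s.reg a))) t1 k) d
          ((s.mem (cell k (s.reg a))).getD 0)
        mem := s.mem
        time := s.time + 5
        space := max s.space (cell k (s.reg a) + 1)
        peak := max s.peak (max 8 (max (cell k (s.reg a)) ((s.mem (cell k (s.reg a))).getD 0)))
        lazyRead := s.lazyRead || (s.mem (cell k (s.reg a))).isNone
        out := s.out } := by
  have h : s.reg a * 8 + k = cell k (s.reg a) := by rw [cell, mul_comm]
  have h01 : t0 ≠ t1 := by simp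
  simp only [ld, runList_cons, runList_nil, Instr.apply, Config.set, Config.tick, Op.eval,
    Function.update_apply, if_neg ha, if_true, Config.mk.injEq, true_and, and_true]
  simp only [cell_inj, Nat.ofNat_pos, Nat.reduceEqDiff, and_false, if_false, h, and_true]
  refine ⟨?_, by trivial, ?_⟩
  · funext r
    simp only [Function.update_apply]
    split_ifs <;> first | rfl | omega
  · have : s.reg a * 8 ≤ cell k (s.reg a) := h ▸ Nat.le_add_right _ _
    have : k ≤ cell k (s.reg a) := h ▸ Nat.le_add_left _ _
    omega

theorem runList_st (ha : a ≠ t0) (hb : b ≠ t0) (hb' : b ≠ t1) :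
    runList I (st k a b) s =
      { reg := Function.update (Function.update s.reg t0 (cell k (s.reg a))) t1 k
        mem := Function.update s.mem (cell k (s.reg a)) (some (s.reg b))
        time := s.time + 5
        space := max s.space (cell k (s.reg a) + 1)
        peak := max s.peak (max 8 (cell k (s.reg a)))
        lazyRead := s.lazyRead
        out := s.out } := by
  have h : s.reg a * 8 + k = cell k (s.reg a) := by rw [cell, mul_comm]
  have h01 : t0 ≠ t1 := by simp
  simp only [st, runList_cons, runList_nil, Instr.apply, Config.set, Config.tick, Op.eval,
    Function.update_apply, if_neg ha, if_neg hb, if_neg hb', if_true, Config.mk.injEq, true_and,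
    and_true]
  simp only [cell_inj, Nat.ofNat_pos, Nat.reduceEqDiff, and_false, if_false, h]
  refine ⟨?_, trivial, trivial, ?_⟩
  · funext r
    simp only [Function.update_apply]
    split_ifs <;> first | rfl | omega
  · have : s.reg a * 8 ≤ cell k (s.reg a) := h ▸ Nat.le_add_right _ _
    have : k ≤ cell k (s.reg a) := h ▸ Nat.le_add_left _ _
    omega

end

/-! ### Emissions at regular intervals -/

/-- Data that stay fixed during a run of the enumeration. -/
structure Params where
  /-- number of vertices -/
  n : ℕ
  /-- preprocessing time -/
  p : ℕ
  /-- bound for the delay -/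
  D : ℕ
  /-- bound for the numbers that the emulated programs compute -/
  X : ℕ
  /-- bound for all numbers -/
  B : ℕ
  /-- bound for the space -/
  Sp : ℕ
  /-- whether the memory may be read before it is written -/
  Z : Prop
  n_pos : 1 ≤ n
  le_X : n ≤ X
  le_B : 64 * (X * X + X + 1) ≤ B
  le_Sp : 16 * n + 8 ≤ Sp

theorem isChain_concat {α : Type*} {R : α → α → Prop} {a x : α} {l : List α}
    (h : List.IsChain R (a :: l)) (hx : R (l.getLastD a) x) : List.IsChain R (a :: (l ++ [x])) := by
  induction l generalizing a with
  | nil => simpa using hx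
  | cons b l ih =>
    rw [List.isChain_cons_cons] at h
    rw [List.getLastD_cons] at hx
    exact List.isChain_cons_cons.2 ⟨h.1, ih h.2 hx⟩

/-- The time of the last emission, or the end of the preprocessing. -/
def lastTime (p : ℕ) (s : Config) : ℕ := (s.out.map Emission.time).getLastD p

/-- The resources used so far are within the bounds. -/
structure Within (π : Params) (s : Config) : Prop where
  peak : s.peak ≤ π.B
  space : s.space ≤ π.Sp
  lazyRead : s.lazyRead = true → π.Z

/-- The invariant of the enumeration: `Q` are the edges that have been put into the queue, of which
the first `head` ones have been emitted; `q` is the quota; `φ` counts the ticks, as if `q` of them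
had passed before each emission; and the delay has been respected so far. There are at most `200`
steps between two ticks, and `δ` bounds the number of steps since the last tick. -/
structure Core (π : Params) (q : ℕ) (Q : List (ℕ × ℕ)) (φ δ : ℕ) (s : Config) : Prop
    extends Within π s where
  tail : s.reg Reg.tail = Q.length
  quota : s.reg Reg.quota = q
  quota_le : q ≤ π.B
  clock : s.reg Reg.head * q + s.reg Reg.cnt = φ
  cnt_lt : s.reg Reg.cnt < q
  head_le : s.reg Reg.head ≤ Q.length
  length_le : Q.length ≤ 2 * π.n
  entries : ∀ e ∈ Q, e.1 < π.n ∧ e.2 < π.n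
  queue : ∀ i e, Q[i]? = some e → s.mem (cell 5 i) = some e.1 ∧ s.mem (cell 6 i) = some e.2
  out : s.out.map (fun e => (e.fst, e.snd)) = Q.take (s.reg Reg.head)
  chain : List.IsChain (fun a b => a ≤ b ∧ b ≤ a + π.D) (π.p :: s.out.map Emission.time)
  last_le : lastTime π.p s ≤ s.time
  recent : s.time ≤ lastTime π.p s + 200 * s.reg Reg.cnt + δ

/-- Up to `c` steps that change only volatile registers. -/
structure Quiet (c : ℕ) (s t : Config) : Prop where
  mem : t.mem = s.mem
  out : t.out = s.out
  reg : ∀ r, (∀ j < 22, j ∉ [6, 7, 8, 9] → r ≠ cell 0 j) → t.reg r = s.reg r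
  le_time : s.time ≤ t.time
  time_le : t.time ≤ s.time + c

section

variable {π : Params} {q φ δ c : ℕ} {Q : List (ℕ × ℕ)} {s t : Config}

/-- The invariant persists as long as the queue and the four registers that govern it are not
touched. -/
theorem Core.congr (h : Core π q Q φ δ s) (ht : Within π t)
    (hreg : ∀ j ∈ [6, 7, 8, 9], t.reg (cell 0 j) = s.reg (cell 0 j))
    (hmem : ∀ i < Q.length,
      t.mem (cell 5 i) = s.mem (cell 5 i) ∧ t.mem (cell 6 i) = s.mem (cell 6 i))
    (hout : t.out = s.out) (h₁ : s.time ≤ t.time) (h₂ : t.time ≤ s.time + c) :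
    Core π q Q φ (δ + c) t := by
  have h6 := hreg 6 (by simp)
  have h7 := hreg 7 (by simp)
  have h8 := hreg 8 (by simp)
  have h9 := hreg 9 (by simp)
  have hl : lastTime π.p t = lastTime π.p s := by rw [lastTime, lastTime, hout]
  exact
    { toWithin := ht
      tail := h8.trans h.tail
      quota := h9.trans h.quota
      quota_le := h.quota_le
      clock := by rw [h6, h7]; exact h.clock
      cnt_lt := by rw [h7]; exact h.cnt_lt
      head_le := by rw [h6]; exact h.head_le
      length_le := h.length_le
      entries := h.entries
      queue := fun i e hi => by
        obtain ⟨hl, -⟩ := List.getElem?_eq_some_iff.1 hi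
        rw [(hmem i hl).1, (hmem i hl).2]
        exact h.queue i e hi
      out := by rw [h6, hout]; exact h.out
      chain := by rw [hout]; exact h.chain
      last_le := hl ▸ h.last_le.trans h₁
      recent := by
        have h' : s.time ≤ lastTime π.p s + 200 * s.reg (cell 0 7) + δ := h.recent
        rw [hl, h7]
        omega }

theorem Core.mono (h : Core π q Q φ δ s) {δ' : ℕ} (hδ : δ ≤ δ') : Core π q Q φ δ' s :=
  { h with recent := h.recent.trans (by omega) }

theorem Core.quiet (h : Core π q Q φ δ s) (hq : Quiet c s t) (ht : Within π t) :
    Core π q Q φ (δ + c) t :=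
  h.congr ht (fun j hj => hq.reg _ fun j' hj' hn he => by
      rw [cell_inj (by norm_num) (by norm_num)] at he
      exact hn (he.2 ▸ hj))
    (fun i _ => by rw [hq.mem]; exact ⟨rfl, rfl⟩) hq.out hq.le_time hq.time_le

theorem Within.tick (h : Within π s) : Within π s.tick := ⟨h.peak, h.space, h.lazyRead⟩

theorem Quiet.of_tick (s : Config) : Quiet 1 s s.tick :=
  ⟨rfl, rfl, fun _ _ => rfl, Nat.le_succ _, le_rfl⟩

theorem Core.tick (h : Core π q Q φ δ s) : Core π q Q φ (δ + 1) s.tick :=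
  h.quiet (.of_tick s) h.toWithin.tick

theorem Core.head_le_n (h : Core π q Q φ δ s) : s.reg Reg.head ≤ 2 * π.n :=
  h.head_le.trans h.length_le

theorem Params.cell_le (π : Params) {k i : ℕ} (hk : k < 8) (hi : i ≤ 2 * π.X) :
    cell k i ≤ π.B := by
  have := π.le_B
  unfold cell
  nlinarith [Nat.zero_le (π.X * π.X)]

theorem Params.cell_lt (π : Params) {k i : ℕ} (hk : k < 8) (hi : i < 2 * π.n + 1) :
    cell k i + 1 ≤ π.Sp := by
  have := π.le_Sp
  unfold cell
  omega

/-- Emit the next edge of the queue. -/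
def emitNext : Prog :=
  code (ld 5 outU head ++ ld 6 outV head ++
    [.emit outU outV, .const t0 1, .op .add head head t0, .const cnt 0])

/-- The code that is run once for each step of the computation in the background: count the step,
and emit the next edge of the queue if enough steps have been counted. -/
def tickCode : Prog :=
  .seq (code [.const t0 1, .op .add t1 cnt t0, .op .eq flag t1 quota])
    (.branch flag emitNext (code [.const t0 1, .op .add cnt cnt t0]))

variable {n : ℕ} {I : Input n}

theorem Core.emitNext (h : Core π q Q φ δ s) (hlt : s.reg Reg.head < Q.length) (hq : 0 < q)
    (hD : 200 * s.reg Reg.cnt + δ + 11 ≤ π.D) :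
    Wp I emitNext (fun t => Core π q Q ((s.reg Reg.head + 1) * q) 10 t ∧ t.mem = s.mem ∧
      t.reg Reg.head = s.reg Reg.head + 1 ∧
      ∀ r, (∀ j < 8, r ≠ cell 0 j) → t.reg r = s.reg r) s := by
  refine wp_code ?_
  obtain ⟨⟨u, v⟩, he⟩ : ∃ e, Q[s.reg Reg.head]? = some e := ⟨_, List.getElem?_eq_getElem hlt⟩
  obtain ⟨hu, hv⟩ := h.queue _ _ he
  have huv := h.entries _ (List.mem_of_getElem? he)
  have hX := π.le_X
  have hB := π.le_B
  have hXX := Nat.zero_le (π.X * π.X)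
  have hn := h.head_le_n
  have hl := h.length_le
  have hb₁ := π.cell_le (k := 5) (by norm_num) (i := s.reg Reg.head) (by omega)
  have hb₂ := π.cell_le (k := 6) (by norm_num) (i := s.reg Reg.head) (by omega)
  have hb₃ := π.cell_lt (k := 5) (by norm_num) (i := s.reg Reg.head) (by omega)
  have hb₄ := π.cell_lt (k := 6) (by norm_num) (i := s.reg Reg.head) (by omega)
  have hrec := h.recent
  have hlast := h.last_le
  simp [runList_ld, Function.update_apply, hu, hv]
  refine ⟨?_, ?_⟩
  · exact
      { peak := by have := h.peak; simp; omega
        space := by have := h.space; simp; omega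
        lazyRead := h.lazyRead
        tail := by simpa [Function.update_apply] using h.tail
        quota := by simpa [Function.update_apply] using h.quota
        quota_le := h.quota_le
        clock := by simp
        cnt_lt := by simpa [Function.update_apply] using hq
        head_le := by simpa [Function.update_apply] using hlt
        length_le := h.length_le
        entries := h.entries
        queue := h.queue
        out := by
          have := h.out
          simp [List.take_add_one, he, this]
        chain := by
          have h₁ : s.time ≤ lastTime π.p s + 200 * s.reg Reg.cnt + δ := h.recent
          have h₂ : lastTime π.p s ≤ s.time := h.last_le
          rw [List.map_append]
          refine isChain_concat h.chain ?_
          rw [lastTime] at h₁ h₂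
          constructor <;> simp only [] <;> omega
        last_le := by simp [lastTime]
        recent := by simp [lastTime] }
  · intro r hr
    simp [hr]

/-- One tick. The queue cannot run empty as long as it contains, in the long run, one edge for every
`q` ticks. -/
theorem Core.tickCode (h : Core π q Q φ δ s) (hφ : φ + 1 < (Q.length + 1) * q) (hδ : δ ≤ 200)
    (hD : 200 * q + 300 ≤ π.D) :
    Wp I tickCode (fun t => Core π q Q (φ + 1) 100 t ∧ t.mem = s.mem ∧
      ∀ r, (∀ j < 8, r ≠ cell 0 j) → t.reg r = s.reg r) s := by
  have hclock := h.clock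
  have hcnt := h.cnt_lt
  have hquota := h.quota
  have hqB := h.quota_le
  have hB := π.le_B
  have hXX := Nat.zero_le (π.X * π.X)
  have hpeak := h.peak
  refine Wp.seq (wp_code ?_)
  set s' := ((runList I [Instr.const t0 1, .op .add t1 cnt t0, .op .eq flag t1 Reg.quota]
    s).tick).set junk 0 with hs'
  have hreg : s'.reg = Function.update (Function.update (Function.update
      (Function.update s.reg t0 1) t1 (s.reg cnt + 1)) flag
      (if s.reg cnt + 1 = q then 1 else 0)) junk 0 := by
    simp [hs', hquota]
  have hflag : s'.reg flag = if s.reg cnt + 1 = q then 1 else 0 := by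
    simp [hreg]
  have hcore : Core π q Q φ (δ + 4 + 1) s'.tick := by
    refine (h.quiet (t := s') (c := 4) ⟨rfl, rfl, fun r hr => ?_, ?_, ?_⟩
      ⟨?_, h.space, h.lazyRead⟩).tick
    · simp [hreg, hr]
    · simp [hs']; omega
    · simp [hs']
    · simp [hs']
      split_ifs <;> omega
  have hkeep : ∀ r, (∀ j < 8, r ≠ cell 0 j) → s'.reg r = s.reg r := fun r hr => by simp [hreg, hr]
  have hcnt' : s'.tick.reg cnt = s.reg cnt := by simp [hreg]
  have hhead' : s'.tick.reg head = s.reg head := by simp [hreg]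
  refine Wp.branch (fun hf => ?_) (fun hf => ?_)
  · -- the quota is used up
    have hfire : s.reg cnt + 1 = q := by
      by_contra hne
      simp [hflag, hne] at hf
    have hnext : φ + 1 = (s.reg head + 1) * q := by rw [add_mul]; omega
    refine (hcore.emitNext (I := I) ?_ (by omega) (by rw [hcnt']; omega)).mono fun t _ ht => ?_
    · rw [hhead']
      rw [hnext] at hφ
      have := lt_of_mul_lt_mul_right hφ (Nat.zero_le q)
      omega
    · refine ⟨?_, ht.2.1, fun r hr => (ht.2.2.2 r hr).trans (hkeep r hr)⟩
      rw [hnext, ← hhead']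
      exact ht.1.mono (by norm_num)
  · have hfire : s.reg cnt + 1 ≠ q := fun he => by simp [hflag, he] at hf
    refine wp_code ?_
    have hrec := hcore.recent
    have hlast := hcore.last_le
    have hp := hcore.peak
    rw [hcnt'] at hrec
    have hq : s.reg Reg.tail = Q.length := h.tail
    refine ⟨?_, by simp; rfl, fun r hr => ?_⟩
    · exact
        { peak := by simp at hp; simp [hreg]; omega
          space := hcore.space
          lazyRead := hcore.lazyRead
          tail := by simpa [hreg] using hq
          quota := by simpa [hreg] using hquota
          quota_le := hqB
          clock := by simp [hreg]; omega
          cnt_lt := by simp [hreg]; omega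
          head_le := by simpa [hreg] using h.head_le
          length_le := h.length_le
          entries := h.entries
          queue := hcore.queue
          out := by simpa [hreg] using hcore.out
          chain := hcore.chain
          last_le := by
            simp only [lastTime] at hlast ⊢
            simp at hlast ⊢
            omega
          recent := by
            simp only [lastTime] at hrec ⊢
            simp [hreg] at hrec ⊢
            omega }
    · have := hkeep r hr
      simp [hr, this]

/-- Put the edge between `a0` and `a1` into the queue. -/
def enqueue : Prog :=
  code (st 5 tail a0 ++ st 6 tail a1 ++ [.const t0 1, .op .add tail tail t0])

theorem Core.enqueue (h : Core π q Q φ δ s) (h₀ : s.reg a0 < π.n) (h₁ : s.reg a1 < π.n)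
    (hlen : Q.length < 2 * π.n) :
    Wp I enqueue (fun t => Core π q (Q ++ [(s.reg a0, s.reg a1)]) φ (δ + 13) t ∧
      (∀ a, (∀ i, a ≠ cell 5 i ∧ a ≠ cell 6 i) → t.mem a = s.mem a) ∧
      ∀ r, (∀ j < 22, r ≠ cell 0 j) → t.reg r = s.reg r) s := by
  refine wp_code ?_
  have htail := h.tail
  have hX := π.le_X
  have hB := π.le_B
  have hXX := Nat.zero_le (π.X * π.X)
  have hb₁ := π.cell_le (k := 5) (by norm_num) (i := Q.length) (by omega)
  have hb₂ := π.cell_le (k := 6) (by norm_num) (i := Q.length) (by omega)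
  have hb₃ := π.cell_lt (k := 5) (by norm_num) (i := Q.length) (by omega)
  have hb₄ := π.cell_lt (k := 6) (by norm_num) (i := Q.length) (by omega)
  have hrec := h.recent
  have hlast := h.last_le
  have hpeak := h.peak
  have hspace := h.space
  simp [runList_st, Function.update_apply, htail]
  refine ⟨?_, fun a ha => ?_, fun r hr => ?_⟩
  · exact
      { peak := by simp; omega
        space := by simp; omega
        lazyRead := h.lazyRead
        tail := by simp
        quota := by simpa [Function.update_apply] using h.quota
        quota_le := h.quota_le
        clock := by simpa [Function.update_apply] using h.clock
        cnt_lt := by simpa [Function.update_apply] using h.cnt_lt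
        head_le := by
          have := h.head_le
          simp; omega
        length_le := by simp; omega
        entries := by
          intro e he
          rcases List.mem_append.1 he with he | he
          · exact h.entries e he
          · rw [List.mem_singleton.1 he]; exact ⟨h₀, h₁⟩
        queue := by
          intro i e hi
          rcases lt_trichotomy i Q.length with hlt | rfl | hgt
          · rw [List.getElem?_append_left hlt] at hi
            simpa [Function.update_apply, hlt.ne] using h.queue i e hi
          · simp at hi
            simp [← hi]
          · rw [List.getElem?_eq_none (by simp; omega)] at hi
            cases hi
        out := by
          simp [h.out, List.take_append_of_le_length h.head_le]
        chain := h.chain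
        last_le := by simp only [lastTime] at hlast ⊢; omega
        recent := by simp [lastTime] at hrec ⊢; omega }
  · simp [ha]
  · simp [hr]

/-! ### Comparisons with ties broken -/

/-- The vertex in position `i` of the list of `u`, or `0`, as returned by a neighbor query. -/
def AdjLists.nbr (A : AdjLists n) (u i : ℕ) : ℕ :=
  match A.entry u i with
  | some v => v
  | none => 0

@[simp]
theorem AdjLists.getD_entry (A : AdjLists n) (u i : ℕ) :
    ((A.entry u i).bind fun v : Fin n => some (v : ℕ)).getD 0 = A.nbr u i := by
  unfold AdjLists.nbr
  cases A.entry u i <;> rfl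

theorem AdjLists.nbr_lt (A : AdjLists n) (hn : 0 < n) (u i : ℕ) : A.nbr u i < n := by
  unfold AdjLists.nbr
  cases A.entry u i with
  | none => exact hn
  | some v => exact v.2

/-- Query the edges in position `a1` of the list of `a0` and in position `a3` of the list of
`a2`. -/
def queryCode : Prog :=
  code [.neighbor x1 a0 a1, .neighbor x2 a2 a3, .compare c1 a0 a1 a2 a3, .compare c2 a2 a3 a0 a1,
    .order num]

/-- Compute `tieBreaker` for the edges that have been queried. Subtraction is truncated, so that
`u + (x - u)` is the maximum of `u` and `x`. -/
def tieBreakerCode : Prog :=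
  code [.op .sub t0 x1 a0, .op .add t0 a0 t0, .op .add t1 a0 x1, .op .sub t1 t1 t0,
    .op .mul t0 t0 num, .op .add id1 t0 t1,
    .op .sub t0 x2 a2, .op .add t0 a2 t0, .op .add t1 a2 x2, .op .sub t1 t1 t0,
    .op .mul t0 t0 num, .op .add id2 t0 t1]

/-- Compare the edges in position `a1` of the list of `a0` and in position `a3` of the list of
`a2`, with ties broken; the result is left in `res`. -/
def tieCompare : Prog :=
  .seq queryCode (.seq tieBreakerCode (code [.op .lt flag id2 id1, .op .mul flag flag c2,
    .const t0 1, .op .sub flag t0 flag, .op .mul res c1 flag]))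

/-- The tie breaker in terms of the operations of the machine, with truncated subtraction. -/
theorem tieBreaker_mk (u v : Fin n) :
    tieBreaker n s(u, v) = ((u : ℕ) + (v - u)) * n + ((u : ℕ) + v - (u + (v - u))) := by
  have h₁ : max (u : ℕ) v = u + (v - u) := by omega
  have h₂ : min (u : ℕ) v = (u : ℕ) + v - (u + (v - u)) := by omega
  simp only [tieBreaker, Sym2.lift_mk]
  rw [h₁, h₂]

theorem AdjLists.edge_eq_some {A : AdjLists n} {u i : ℕ} {e : Sym2 (Fin n)}
    (h : A.edge u i = some e) :
    ∃ (hu : u < n) (v : Fin n), A.entry u i = some v ∧ e = s(⟨u, hu⟩, v) := by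
  unfold AdjLists.edge at h
  split_ifs at h with hu
  obtain ⟨v, hv, he⟩ := Option.map_eq_some_iff.1 h
  exact ⟨hu, v, by simp [AdjLists.entry, hu, hv], he.symm⟩

/-- Two comparisons of the original weights, together with the tie breakers, decide a comparison
of the perturbed weights. -/
theorem compare_perturbed {w : Sym2 (Fin n) → ℝ} (hw : ∀ e f, w e ≤ w f ↔ TieLe I.weight e f)
    {u i v j x y b₁ b₂ : ℕ} (hx : I.lists.nbr u i = x) (hy : I.lists.nbr v j = y)
    (hb₁ : b₁ = (u + (x - u)) * n + (u + x - (u + (x - u))))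
    (hb₂ : b₂ = (v + (y - v)) * n + (v + y - (v + (y - v)))) :
    I.compare u i v j * (1 - (if b₂ < b₁ then 1 else 0) * I.compare v j u i)
      = Input.compare ⟨I.lists, w⟩ u i v j := by
  simp only [Input.compare]
  cases he : I.lists.edge u i with
  | none => simp
  | some e =>
    cases hf : I.lists.edge v j with
    | none => simp
    | some f =>
      obtain ⟨hu, x', hx', rfl⟩ := AdjLists.edge_eq_some he
      obtain ⟨hv, y', hy', rfl⟩ := AdjLists.edge_eq_some hf
      have h₁ := tieBreaker_mk ⟨u, hu⟩ x'
      have h₂ := tieBreaker_mk ⟨v, hv⟩ y'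
      simp only [AdjLists.nbr, hx'] at hx
      simp only [AdjLists.nbr, hy'] at hy
      rw [hx, ← hb₁] at h₁
      rw [hy, ← hb₂] at h₂
      simp only [hw, TieLe, ← h₁, ← h₂]
      rcases lt_trichotomy (I.weight s(⟨u, hu⟩, x')) (I.weight s(⟨v, hv⟩, y')) with h | h | h
      · simp [h, h.le, h.not_ge]
      · by_cases hlt : tieBreaker n s(⟨v, hv⟩, y') < tieBreaker n s(⟨u, hu⟩, x')
        · simp [h, hlt]
        · simp [h, hlt, not_lt.1 hlt]
      · simp [h.not_ge, h.not_gt, h.ne', h.le]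

theorem Input.compare_le_one (I : Input n) (u i v j : ℕ) : I.compare u i v j ≤ 1 := by
  unfold Input.compare
  split
  · split_ifs <;> simp
  · simp

theorem Quiet.trans {c c' : ℕ} {r : Config} (h : Quiet c s t) (h' : Quiet c' t r) :
    Quiet (c + c') s r :=
  ⟨h'.mem.trans h.mem, h'.out.trans h.out, fun x hx => (h'.reg x hx).trans (h.reg x hx),
    h.le_time.trans h'.le_time, by have := h.time_le; have := h'.time_le; omega⟩

theorem wp_queryCode (hn : π.n = n) (hs : Within π s) :
    Wp I queryCode (fun t => Quiet 6 s t ∧ Within π t ∧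
      (∀ j ∈ [10, 11, 12, 13], t.reg (cell 0 j) = s.reg (cell 0 j)) ∧ t.reg num = n ∧
      t.reg x1 = I.lists.nbr (s.reg a0) (s.reg a1) ∧ t.reg x2 = I.lists.nbr (s.reg a2) (s.reg a3) ∧
      t.reg c1 = I.compare (s.reg a0) (s.reg a1) (s.reg a2) (s.reg a3) ∧
      t.reg c2 = I.compare (s.reg a2) (s.reg a3) (s.reg a0) (s.reg a1)) s := by
  refine wp_code ?_
  have hn0 : 0 < n := hn ▸ π.n_pos
  have h₁ := I.lists.nbr_lt hn0 (s.reg a0) (s.reg a1)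
  have h₂ := I.lists.nbr_lt hn0 (s.reg a2) (s.reg a3)
  have hc₁ := I.compare_le_one (s.reg a0) (s.reg a1) (s.reg a2) (s.reg a3)
  have hc₂ := I.compare_le_one (s.reg a2) (s.reg a3) (s.reg a0) (s.reg a1)
  have hX := π.le_X
  have hB := π.le_B
  have hp := hs.peak
  simp
  refine ⟨⟨rfl, rfl, fun r hr => ?_, by simp; omega, by simp⟩, ⟨?_, hs.space, hs.lazyRead⟩⟩
  · simp [hr]
  · have := Nat.zero_le (π.X * π.X)
    simp
    omega

theorem wp_tieBreakerCode (hn : π.n = n) (hs : Within π s)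
    (h₀ : s.reg a0 ≤ π.X) (h₂ : s.reg a2 ≤ π.X) (h₁ : s.reg x1 ≤ π.X) (h₃ : s.reg x2 ≤ π.X)
    (hnum : s.reg num = n) :
    Wp I tieBreakerCode (fun t => Quiet 13 s t ∧ Within π t ∧
      t.reg c1 = s.reg c1 ∧ t.reg c2 = s.reg c2 ∧
      t.reg id1 = (s.reg a0 + (s.reg x1 - s.reg a0)) * n +
        (s.reg a0 + s.reg x1 - (s.reg a0 + (s.reg x1 - s.reg a0))) ∧
      t.reg id2 = (s.reg a2 + (s.reg x2 - s.reg a2)) * n +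
        (s.reg a2 + s.reg x2 - (s.reg a2 + (s.reg x2 - s.reg a2)))) s := by
  refine wp_code ?_
  have hX := π.le_X
  have hB := π.le_B
  have hp := hs.peak
  have key : ∀ a ≤ π.X, ∀ x ≤ π.X, (a + (x - a)) * n ≤ π.X * π.X := fun a ha x hx =>
    Nat.mul_le_mul (by omega) (by omega)
  have hk₁ := key _ h₀ _ h₁
  have hk₂ := key _ h₂ _ h₃
  simp [hnum]
  refine ⟨⟨rfl, rfl, fun r hr => ?_, by simp; omega, by simp⟩, ⟨?_, hs.space, hs.lazyRead⟩⟩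
  · simp [hr]
  · simp
    omega

theorem wp_tieCompare {w : Sym2 (Fin n) → ℝ} (hw : ∀ e f, w e ≤ w f ↔ TieLe I.weight e f)
    (hn : π.n = n) (hs : Within π s) (hreg : ∀ j ∈ [10, 11, 12, 13], s.reg (cell 0 j) ≤ π.X) :
    Wp I tieCompare (fun t => Quiet 25 s t ∧ Within π t ∧
      t.reg res = Input.compare ⟨I.lists, w⟩ (s.reg a0) (s.reg a1) (s.reg a2) (s.reg a3)) s := by
  have hn0 : 0 < n := hn ▸ π.n_pos
  have hX := π.le_X
  have hB := π.le_B
  refine Wp.seq ((wp_queryCode hn hs).mono ?_)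
  rintro s₁ - ⟨hq₁, hw₁, ha, hnum, hx, hy, hc₁, hc₂⟩
  have ha0 := ha 10 (by simp)
  have ha2 := ha 12 (by simp)
  have hx' := I.lists.nbr_lt hn0 (s.reg a0) (s.reg a1)
  have hy' := I.lists.nbr_lt hn0 (s.reg a2) (s.reg a3)
  refine Wp.seq ((wp_tieBreakerCode hn hw₁ ?_ ?_ (by omega) (by omega) hnum).mono ?_)
  · exact ha0 ▸ hreg 10 (by simp)
  · exact ha2 ▸ hreg 12 (by simp)
  rintro s₂ - ⟨hq₂, hw₂, hc₁', hc₂', hi, hj⟩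
  rw [ha0, hx] at hi
  rw [ha2, hy] at hj
  have hc := compare_perturbed hw rfl rfl hi hj
  refine wp_code ?_
  have hle₁ := I.compare_le_one (s.reg a0) (s.reg a1) (s.reg a2) (s.reg a3)
  have hle₂ := I.compare_le_one (s.reg a2) (s.reg a3) (s.reg a0) (s.reg a1)
  have hp := hw₂.peak
  simp only [runList_cons, runList_nil, Instr.apply, Config.set, Config.tick, Op.eval,
    Function.update_apply, cell_inj, Nat.ofNat_pos, Nat.reduceEqDiff, and_false, if_false,
    if_true, hc₁', hc₂', hc₁, hc₂]
  refine ⟨(hq₁.trans hq₂).trans (c' := 6) ⟨rfl, rfl, fun r hr => ?_, ?_, ?_⟩,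
    ⟨?_, hw₂.space, hw₂.lazyRead⟩, ?_⟩
  · simp [hr]
  · simp only
    omega
  · simp only
    omega
  · have h1 : ∀ x ≤ 1, x ≤ π.B := fun x hx => by omega
    have hif : ∀ (P : Prop) [Decidable P], (if P then 1 else 0) ≤ 1 := fun P _ => by
      split_ifs <;> simp
    exact max_le (max_le (max_le (max_le (max_le (max_le hp (h1 _ (hif _)))
      (h1 _ (Nat.mul_le_mul (hif _) hle₂))) (h1 _ le_rfl))
      (h1 _ (Nat.sub_le _ _))) (h1 _ (Nat.mul_le_mul hle₁ (Nat.sub_le _ _)))) (Nat.zero_le _)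
  · exact hc

end

/-! ### Emulation in the background -/

/-- Test whether the vertex in `a` has chosen the vertex in `b`. -/
def checkChosen (a b : ℕ) : Prog := code (ld 0 x1 a ++ [.op .eq flag x1 b])

/-- Put the edge between `a0` and `a1` into the queue, unless one of its endpoints has chosen it. -/
def enqueueNew : Prog :=
  .seq (checkChosen a0 a1) (.branch flag (code [])
    (.seq (checkChosen a1 a0) (.branch flag (code []) enqueue)))

theorem Params.le_B' (π : Params) {x : ℕ} (hx : x ≤ π.X) : x ≤ π.B := by
  have := π.le_B
  have := Nat.zero_le (π.X * π.X)
  omega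

theorem Params.cell_le' (π : Params) {k a : ℕ} (hk : k < 8) (ha : a ≤ π.X) : cell k a ≤ π.B :=
  π.cell_le hk (by omega)

theorem wp_checkChosen {n : ℕ} {I : Input n} {π : Params} {s : Config} {a b x : ℕ}
    (hab : a = a0 ∧ b = a1 ∨ a = a1 ∧ b = a0) (ha : s.reg a < π.n)
    (hx : s.mem (cell 0 (s.reg a)) = some x) (hxn : x ≤ π.n) (hs : Within π s) :
    Wp I (checkChosen a b) (fun t => Quiet 7 s t ∧ Within π t ∧
      t.reg flag = (if x = s.reg b then 1 else 0) ∧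
      t.reg a0 = s.reg a0 ∧ t.reg a1 = s.reg a1) s := by
  have hB := π.le_B
  have hX := π.le_X
  have hXX := Nat.zero_le (π.X * π.X)
  have hp := hs.peak
  have hsp := hs.space
  have hc := π.cell_le' (k := 0) (by norm_num) (ha.le.trans hX)
  have hc' := π.cell_lt (k := 0) (i := s.reg a) (by norm_num) (by omega)
  have hat : a ≠ t0 := by rcases hab with ⟨rfl, rfl⟩ | ⟨rfl, rfl⟩ <;> simp
  have hbt : b ≠ t0 ∧ b ≠ t1 ∧ b ≠ x1 := by rcases hab with ⟨rfl, rfl⟩ | ⟨rfl, rfl⟩ <;> simp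
  have hif : (if x = s.reg b then 1 else 0) ≤ π.B := by split_ifs <;> omega
  refine wp_code ?_
  rw [runList_append, runList_ld hat, hx]
  simp only [runList_cons, runList_nil, Instr.apply, Config.set, Config.tick, Op.eval,
    Option.getD_some, Option.isNone_some, Bool.or_false, Function.update_self,
    Function.update_of_ne hbt.2.2, Function.update_of_ne hbt.2.1, Function.update_of_ne hbt.1]
  refine ⟨⟨rfl, rfl, fun r hr => ?_, ?_, ?_⟩, ⟨?_, ?_, hs.lazyRead⟩, ?_, ?_, ?_⟩
  · simp [hr]
  · simp only
    omega
  · simp only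
    omega
  · exact max_le (max_le (max_le hp (by omega)) hif) (Nat.zero_le _)
  · simp only [max_le_iff]
    omega
  · simp
  · simp
  · simp

/-- The emulation of an instruction on the registers and memory cells of class `k`. If `tie` is
set, then ties are broken in comparisons of weights and emitted edges go to the queue; otherwise
emissions are ignored. -/
def emulInstr (k : ℕ) (tie : Bool) : Instr → Prog
  | .const d c => code [.const (cell k d) c]
  | .move d a => code [.move (cell k d) (cell k a)]
  | .op o d a b => code [.op o (cell k d) (cell k a) (cell k b)]
  | .load d a => .seq (code (.move a0 (cell k a) :: ld k x1 a0)) (code [.move (cell k d) x1])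
  | .store a b => code (.move a0 (cell k a) :: .move a1 (cell k b) :: st k a0 a1)
  | .order d => code [.order (cell k d)]
  | .degree d u => code [.degree (cell k d) (cell k u)]
  | .neighbor d u i => code [.neighbor (cell k d) (cell k u) (cell k i)]
  | .compare d u i v j =>
    if tie then
      .seq (code [.move a0 (cell k u), .move a1 (cell k i), .move a2 (cell k v),
        .move a3 (cell k j)]) (.seq tieCompare (code [.move (cell k d) res]))
    else code [.compare (cell k d) (cell k u) (cell k i) (cell k v) (cell k j)]
  | .emit u v =>
    if tie then .seq (code [.move a0 (cell k u), .move a1 (cell k v)]) enqueueNew else code []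

/-- The emulation of a program, with a tick for every step. -/
def emul (k : ℕ) (tie : Bool) : Prog → Prog
  | .instr i => .seq (emulInstr k tie i) tickCode
  | .seq P Q => .seq (emul k tie P) (emul k tie Q)
  | .branch r P Q =>
    .branch (cell k r) (.seq tickCode (emul k tie P)) (.seq tickCode (emul k tie Q))
  | .loop r P => .seq (.loop (cell k r) (.seq tickCode (emul k tie P))) tickCode

/-- The edges that an emulated program has put into the queue, where `m u` is the neighbor that
the vertex `u` has chosen. -/
def pending (tie : Bool) (m : ℕ → ℕ) (out : List Emission) : List (ℕ × ℕ) :=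
  if tie then (out.map fun e => (e.fst, e.snd)).filter fun e => m e.1 ≠ e.2 ∧ m e.2 ≠ e.1 else []

/-- Data that stay fixed during an emulation. -/
structure Emu (π : Params) where
  k : ℕ
  tie : Bool
  /-- the neighbors chosen by the vertices -/
  m : ℕ → ℕ
  /-- the queue at the start -/
  Q : List (ℕ × ℕ)
  /-- the quota -/
  q : ℕ
  /-- the number of ticks at the start -/
  φ : ℕ
  /-- the configuration at the start -/
  start : Config
  k_pos : 0 < k
  k_lt : k < 4
  chosen : ∀ u < π.n, start.mem (cell 0 u) = some (m u)
  m_le : ∀ u < π.n, m u ≤ π.n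
  length_le : Q.length ≤ π.n
  q_le : 200 * q + 300 ≤ π.D

/-- The configuration `s` of the enumeration represents the configuration `e` of the emulated
program. -/
structure Rel {π : Params} (ε : Emu π) (φ δ : ℕ) (e s : Config) : Prop
    extends Core π ε.q (ε.Q ++ pending ε.tie ε.m e.out) φ δ s where
  reg : ∀ r, s.reg (cell ε.k r) = e.reg r
  mem : ∀ a, s.mem (cell ε.k a) = e.mem a
  le_space : e.space ≤ s.space
  frame_reg : ∀ k < 8, k ∉ [0, ε.k] → ∀ r, s.reg (cell k r) = ε.start.reg (cell k r)
  frame_mem : ∀ k < 8, k ∉ [ε.k, 5, 6] → ∀ a, s.mem (cell k a) = ε.start.mem (cell k a)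

/-- Configurations of the emulated program that the enumeration can afford to reach. -/
structure Good {π : Params} (ε : Emu π) (e : Config) : Prop where
  peak : e.peak ≤ π.X
  space : 8 * e.space ≤ π.Sp
  lazyRead : e.lazyRead = true → π.Z
  out : ε.tie = true → ∀ x ∈ e.out, x.fst < π.n ∧ x.snd < π.n
  length_le : ε.tie = true → e.out.length ≤ π.n
  time : ε.φ + e.time < (ε.Q.length + 1) * ε.q

section

variable {π : Params} {ε : Emu π} {φ δ c : ℕ} {e e' s t : Config}

theorem Good.of_le (h : Good ε e') (hle : e.Le e') : Good ε e where
  peak := hle.peak.trans h.peak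
  space := by have := hle.space; have := h.space; omega
  lazyRead := fun x => h.lazyRead (hle.lazyRead x)
  out := fun ht x hx => h.out ht x (hle.out.subset hx)
  length_le := fun ht => hle.out.length_le.trans (h.length_le ht)
  time := by have := hle.time; have := h.time; omega

theorem cell_ne_volatile {k r : ℕ} (hk : 0 < k) (hk' : k < 8) (j : ℕ) : cell k r ≠ cell 0 j := by
  unfold cell
  omega

theorem Emu.k_lt_eight (ε : Emu π) : ε.k < 8 := ε.k_lt.trans (by norm_num)

theorem Rel.congr (h : Rel ε φ δ e s) (he : e'.reg = e.reg) (hm : e'.mem = e.mem)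
    (ho : e'.out = e.out) (hs : e'.space ≤ s.space) : Rel ε φ δ e' s where
  toCore := ho ▸ h.toCore
  reg := he ▸ h.reg
  mem := hm ▸ h.mem
  le_space := hs
  frame_reg := h.frame_reg
  frame_mem := h.frame_mem

/-- The clock of the emulated program is irrelevant. -/
theorem Rel.tick_left (h : Rel ε φ δ e s) : Rel ε φ δ e.tick s := h.congr rfl rfl rfl h.le_space

theorem Rel.quiet (h : Rel ε φ δ e s) (hq : Quiet c s t) (ht : Within π t)
    (hs : s.space ≤ t.space) : Rel ε φ (δ + c) e t where
  toCore := h.toCore.quiet hq ht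
  reg := fun r => by
    rw [hq.reg _ fun j _ _ => cell_ne_volatile ε.k_pos ε.k_lt_eight j, h.reg]
  mem := fun a => by rw [hq.mem, h.mem]
  le_space := h.le_space.trans hs
  frame_reg := fun k hk hk' r => by
    rw [hq.reg _ fun j _ _ => cell_ne_volatile (Nat.pos_of_ne_zero fun h => hk' (by simp [h])) hk j,
      h.frame_reg k hk hk']
  frame_mem := fun k hk hk' a => by rw [hq.mem, h.frame_mem k hk hk']

theorem Rel.mono (h : Rel ε φ δ e s) {δ' : ℕ} (hδ : δ ≤ δ') : Rel ε φ δ' e s :=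
  { h with toCore := h.toCore.mono hδ }

theorem Rel.tick (h : Rel ε φ δ e s) : Rel ε φ (δ + 1) e s.tick :=
  h.quiet (.of_tick s) h.toWithin.tick le_rfl

variable {n : ℕ} {I : Input n}

theorem Rel.tickCode (h : Rel ε φ δ e s) (hφ : φ + 1 < (ε.Q.length + 1) * ε.q) (hδ : δ ≤ 200) :
    Wp I tickCode (Rel ε (φ + 1) 100 e) s := by
  refine (h.toCore.tickCode (lt_of_lt_of_le hφ (Nat.mul_le_mul_right _ ?_)) hδ ε.q_le).mono ?_
  · simp
  rintro t hle ⟨hc, hm, hr⟩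
  exact
    { toCore := hc
      reg := fun r => by
        rw [hr _ fun j _ => cell_ne_volatile ε.k_pos ε.k_lt_eight j, h.reg]
      mem := fun a => by rw [hm, h.mem]
      le_space := h.le_space.trans hle.space
      frame_reg := fun k hk hk' r => by
        rw [hr _ fun j _ => cell_ne_volatile (Nat.pos_of_ne_zero fun h => hk' (by simp [h])) hk j,
          h.frame_reg k hk hk']
      frame_mem := fun k hk hk' a => by rw [hm, h.frame_mem k hk hk'] }

/-- An instruction that writes `x` into register `d` of the emulated program. -/
theorem Rel.set (h : Rel ε φ δ e s) {d x : ℕ} (hx : x ≤ π.X) {i : Instr}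
    (hi : i.apply I s.tick = s.tick.set (cell ε.k d) x) :
    Wp I (code [i]) (Rel ε φ (δ + 2) (e.set d x)) s := by
  refine wp_code ?_
  have hk := ε.k_lt_eight
  have hk0 := ε.k_pos
  have hk0' : ¬ ε.k = 0 := hk0.ne'
  have hk0'' : ¬ 0 = ε.k := hk0.ne
  rw [runList_cons, runList_nil, hi]
  have hB := π.le_B' hx
  have hp := h.peak
  refine
    { toCore := h.toCore.congr ⟨by simp; omega, h.space, h.lazyRead⟩ ?_ (fun _ _ => ⟨rfl, rfl⟩) rfl
        (by simp; omega) (by simp)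
      reg := ?_
      mem := h.mem
      le_space := h.le_space
      frame_reg := ?_
      frame_mem := h.frame_mem }
  · simp [Function.update_apply, hk, hk0'']
  · intro r
    simp [Function.update_apply, hk, hk0', h.reg]
  · intro k hk₁ hk₂ r
    simp only [List.mem_cons, List.not_mem_nil, or_false, not_or] at hk₂
    simp [hk, hk₁, hk₂, h.frame_reg]

theorem Good.cell_lt (h : Good ε e) {a : ℕ} (ha : a + 1 ≤ e.space) : cell ε.k a + 1 ≤ π.Sp := by
  have := h.space
  have := ε.k_lt
  unfold cell
  omega

theorem Rel.emul_load (h : Rel ε φ δ e s) (he : e.Bounded) {J : Input n} (d a : ℕ)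
    (hg : Good ε ((Instr.load d a).apply J e.tick)) :
    Wp I (emulInstr ε.k ε.tie (.load d a))
      (Rel ε φ (δ + 9) ((Instr.load d a).apply J e.tick)) s := by
  have hk := ε.k_lt_eight
  have hB := π.le_B
  have hXX := Nat.zero_le (π.X * π.X)
  have hpk := hg.peak
  have hsp := hg.cell_lt (a := e.reg a) (by simp)
  have hlz := hg.lazyRead
  simp only [Instr.apply, Config.set, Config.tick, max_le_iff] at hpk
  have hreg := he.1 a
  have hcell := π.cell_le' hk (hreg.trans hpk.1)
  have hp := h.peak
  have hs := h.space
  have hl := h.lazyRead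
  have hmem := h.mem (e.reg a)
  have hr := h.reg a
  refine Wp.seq (wp_code ?_)
  set s₁ := (runList I (.move a0 (cell ε.k a) :: ld ε.k x1 a0) s).tick.set junk 0 with hs₁
  have hq : Quiet 7 s s₁ := by
    refine ⟨?_, ?_, fun r hr => ?_, ?_, ?_⟩ <;> simp [hs₁, runList_ld]
    · simp [hr]
    · omega
  have hw : Within π s₁ := by
    refine ⟨?_, ?_, ?_⟩ <;> simp [hs₁, runList_ld, hr, hmem]
    · omega
    · omega
    · simp at hlz
      tauto
  have hsp₁ : s₁.space = max s.space (cell ε.k (e.reg a) + 1) := by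
    simp [hs₁, runList_ld, hr]
  have hx₁ : s₁.reg x1 = (e.mem (e.reg a)).getD 0 := by
    simp [hs₁, runList_ld, hr, hmem]
  have h₁ : Rel ε φ (δ + 7) { e.tick with
      space := max e.space (e.reg a + 1)
      lazyRead := e.lazyRead || (e.mem (e.reg a)).isNone } s₁ := by
    refine (h.quiet hq hw (by omega)).congr rfl rfl rfl ?_
    have := h.le_space
    have : e.reg a ≤ cell ε.k (e.reg a) := by unfold cell; omega
    simp only
    omega
  exact h₁.set hpk.2 (by simp [hx₁])

theorem Rel.emul_store (h : Rel ε φ δ e s) (he : e.Bounded) {J : Input n} (a b : ℕ)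
    (hg : Good ε ((Instr.store a b).apply J e.tick)) :
    Wp I (emulInstr ε.k ε.tie (.store a b))
      (Rel ε φ (δ + 8) ((Instr.store a b).apply J e.tick)) s := by
  have hk := ε.k_lt_eight
  have hk4 := ε.k_lt
  have hB := π.le_B
  have hXX := Nat.zero_le (π.X * π.X)
  have hpk : e.peak ≤ π.X := hg.peak
  have hsp := hg.cell_lt (a := e.reg a) (by simp)
  have hreg := he.1 a
  have hregb := he.1 b
  have hcell := π.cell_le' hk (hreg.trans hpk)
  have hp := h.peak
  have hs := h.space
  have hl := h.lazyRead
  have hr := h.reg a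
  have hrb := h.reg b
  have hk0 : ¬ 0 = ε.k := ε.k_pos.ne
  have hk0' : ¬ ε.k = 0 := ε.k_pos.ne'
  have hk5 : ¬ 5 = ε.k := by omega
  have hk6 : ¬ 6 = ε.k := by omega
  refine wp_code ?_
  set s₁ := (runList I (.move a0 (cell ε.k a) :: .move a1 (cell ε.k b) :: st ε.k a0 a1) s).tick.set
    junk 0 with hs₁
  have hsreg : ∀ r, (∀ j < 22, j ∉ [6, 7, 8, 9] → r ≠ cell 0 j) → s₁.reg r = s.reg r := by
    intro r hr
    simp [hs₁, runList_st, hr]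
  have hsmem : s₁.mem = Function.update s.mem (cell ε.k (e.reg a)) (some (e.reg b)) := by
    simp [hs₁, runList_st, hr, hrb, hk, hk0']
  have hssp : s₁.space = max s.space (cell ε.k (e.reg a) + 1) := by
    simp [hs₁, runList_st, hr]
  have hle : e.reg a ≤ cell ε.k (e.reg a) := by unfold cell; omega
  refine
    { toCore := h.toCore.congr ⟨?_, ?_, ?_⟩ (fun j hj => hsreg _ ?_) (fun i _ => ?_) ?_ ?_ ?_
      reg := fun r => ?_
      mem := fun c => ?_
      le_space := ?_
      frame_reg := fun k hk₁ hk₂ r => ?_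
      frame_mem := fun k hk₁ hk₂ c => ?_ }
  · simp [hs₁, runList_st, hr, hrb, hk, hk0']
    omega
  · omega
  · simpa [hs₁, runList_st] using hl
  · intro j' hj' hn he
    rw [cell_inj (by norm_num) (by norm_num)] at he
    exact hn (he.2 ▸ hj)
  · simp [hsmem, hk, hk5, hk6]
  · simp [hs₁, runList_st]
  · simp [hs₁, runList_st]
    omega
  · simp [hs₁, runList_st]
  · rw [hsreg _ fun j _ _ => cell_ne_volatile ε.k_pos hk j, h.reg]
    rfl
  · rw [hsmem]
    simp [Function.update_apply, hk, h.mem]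
  · have := h.le_space
    simp
    omega
  · rw [hsreg _ fun j _ _ =>
      cell_ne_volatile (Nat.pos_of_ne_zero fun h => hk₂ (by simp [h])) hk₁ j, h.frame_reg k hk₁ hk₂]
  · simp only [List.mem_cons, List.not_mem_nil, or_false, not_or] at hk₂
    rw [hsmem]
    simp [hk, hk₁, hk₂, h.frame_mem]

theorem Rel.emul_compare (h : Rel ε φ δ e s) (he : e.Bounded) (d u i v j : ℕ) (hn : π.n = n)
    {w : Sym2 (Fin n) → ℝ} (hw : ε.tie = true → ∀ e f, w e ≤ w f ↔ TieLe I.weight e f)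
    (hw' : ε.tie = false → w = I.weight)
    (hg : Good ε ((Instr.compare d u i v j).apply ⟨I.lists, w⟩ e.tick)) :
    Wp I (emulInstr ε.k ε.tie (.compare d u i v j))
      (Rel ε φ (δ + 40) ((Instr.compare d u i v j).apply ⟨I.lists, w⟩ e.tick)) s := by
  have hk := ε.k_lt_eight
  have hk0 : ¬ 0 = ε.k := ε.k_pos.ne
  have hk0' : ¬ ε.k = 0 := ε.k_pos.ne'
  have hpk := hg.peak
  simp only [Instr.apply, Config.set, Config.tick, max_le_iff] at hpk
  cases ht : ε.tie with
  | false =>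
    obtain rfl := hw' ht
    simp only [emulInstr, Bool.false_eq_true, if_false]
    exact Wp.mono (Rel.set (h.tick_left) hpk.2 (by simp [h.reg])) fun t _ ht => ht.mono (by omega)
  | true =>
    simp only [emulInstr, if_true]
    have hu := (he.1 u).trans hpk.1
    have hi := (he.1 i).trans hpk.1
    have hv := (he.1 v).trans hpk.1
    have hj := (he.1 j).trans hpk.1
    have hp := h.peak
    have hX := fun x (hx : x ≤ π.X) => π.le_B' hx
    have hu' := hX _ hu
    have hi' := hX _ hi
    have hv' := hX _ hv
    have hj' := hX _ hj
    refine Wp.seq (wp_code ?_)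
    set s₁ := (runList I [.move a0 (cell ε.k u), .move a1 (cell ε.k i), .move a2 (cell ε.k v),
        .move a3 (cell ε.k j)] s).tick.set junk 0 with hs₁
    have hq : Quiet 5 s s₁ := by
      refine ⟨rfl, rfl, fun r hr => ?_, ?_, ?_⟩ <;> simp [hs₁]
      · simp [hr]
      · omega
    have hr0 : s₁.reg a0 = e.reg u := by simp [hs₁, h.reg]
    have hr1 : s₁.reg a1 = e.reg i := by simp [hs₁, h.reg, hk, hk0']
    have hr2 : s₁.reg a2 = e.reg v := by simp [hs₁, h.reg, hk, hk0']
    have hr3 : s₁.reg a3 = e.reg j := by simp [hs₁, h.reg, hk, hk0']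
    have hw₁ : Within π s₁ := by
      refine ⟨?_, h.space, h.lazyRead⟩
      simp [hs₁, h.reg, hk, hk0']
      omega
    refine Wp.seq ((wp_tieCompare (hw ht) hn hw₁ ?_).mono ?_)
    · intro j hj
      simp only [List.mem_cons, List.not_mem_nil, or_false] at hj
      rcases hj with rfl | rfl | rfl | rfl
      · exact hr0 ▸ hu
      · exact hr1 ▸ hi
      · exact hr2 ▸ hv
      · exact hr3 ▸ hj
    · rintro s₂ hle ⟨hq₂, hw₂, hres⟩
      rw [hr0, hr1, hr2, hr3] at hres
      have h₂ := ((h.quiet hq hw₁ le_rfl).quiet hq₂ hw₂ hle.space).tick_left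
      exact Wp.mono (h₂.set hpk.2 (by simp [hres])) fun t _ ht => ht.mono (by omega)

theorem pending_concat (m : ℕ → ℕ) (out : List Emission) (x : Emission) :
    pending true m (out ++ [x]) = pending true m out ++
      if m x.fst ≠ x.snd ∧ m x.snd ≠ x.fst then [(x.fst, x.snd)] else [] := by
  simp only [pending, if_true, List.map_append, List.filter_append, List.map_cons, List.map_nil]
  congr 1
  split_ifs with h <;> simp [h]

theorem length_pending_le (tie : Bool) (m : ℕ → ℕ) (out : List Emission) :
    (pending tie m out).length ≤ out.length := by
  unfold pending
  split_ifs
  · exact (List.length_filter_le _ _).trans (by simp)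
  · simp

theorem Rel.enqueueNew (h : Rel ε φ δ e s) {u v x : ℕ} (ht : ε.tie = true)
    (hu : u < π.n) (hv : v < π.n) (h0 : s.reg a0 = u) (h1 : s.reg a1 = v)
    (hlen : e.out.length + 1 ≤ π.n) :
    Wp I enqueueNew (Rel ε φ (δ + 30) { e with out := e.out ++ [⟨u, v, x⟩] }) s := by
  have hk := ε.k_lt_eight
  have hB := π.le_B
  have hX := π.le_X
  have hXX := Nat.zero_le (π.X * π.X)
  have hmem : ∀ a < π.n, s.mem (cell 0 a) = some (ε.m a) := fun a ha => by
    rw [h.frame_mem 0 (by norm_num) (by simp [ε.k_pos.ne]), ε.chosen a ha]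
  have hmu := hmem u hu
  have hmv := hmem v hv
  have hleu := ε.m_le u hu
  have hlev := ε.m_le v hv
  have hskip : ∀ {s' : Config} {δ' : ℕ}, Rel ε φ δ' e s' → δ' ≤ δ + 29 →
      (ε.m u = v ∨ ε.m v = u) →
      Wp I (code []) (Rel ε φ (δ + 30) { e with out := e.out ++ [⟨u, v, x⟩] }) s' := by
    intro s' δ' h hδ hm
    refine wp_code ?_
    have hpend : pending ε.tie ε.m (e.out ++ [⟨u, v, x⟩]) = pending ε.tie ε.m e.out := by
      rw [ht, pending_concat, if_neg, List.append_nil]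
      rintro ⟨hn₁, hn₂⟩
      exact hm.elim hn₁ hn₂
    have h₂ := h.quiet (t := ((runList I [] s').tick.set junk 0)) (c := 1)
      (by refine ⟨rfl, rfl, fun r hr => by simp [hr], ?_, ?_⟩ <;> simp)
      ⟨by simpa using h.peak, h.space, h.lazyRead⟩ le_rfl
    exact
      { toCore := by rw [hpend]; exact h₂.toCore.mono (by omega)
        reg := h₂.reg, mem := h₂.mem, le_space := h₂.le_space
        frame_reg := h₂.frame_reg, frame_mem := h₂.frame_mem }
  refine Wp.seq ((wp_checkChosen (I := I) (Or.inl ⟨rfl, rfl⟩) (h0 ▸ hu) (h0 ▸ hmu) hleu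
    h.toWithin).mono ?_)
  rintro s₁ hle₁ ⟨hq₁, hw₁, hf₁, h0₁, h1₁⟩
  rw [h1] at hf₁
  have h₁ := (h.quiet hq₁ hw₁ hle₁.space).tick
  rw [h0] at h0₁
  rw [h1] at h1₁
  refine Wp.branch (fun hne => ?_) (fun heq => ?_)
  · refine hskip h₁ (by omega) (Or.inl ?_)
    by_contra hn
    exact hne (by rw [hf₁, if_neg hn])
  have hn₁ : ε.m u ≠ v := fun h => by simp [hf₁, h] at heq
  have hmv' : s₁.tick.mem (cell 0 v) = some (ε.m v) := by
    rw [← hmv, ← hq₁.mem]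
    rfl
  refine Wp.seq ((wp_checkChosen (I := I) (s := s₁.tick) (Or.inr ⟨rfl, rfl⟩) (h1₁.trans_lt hv)
    (by rw [show s₁.tick.reg a1 = v from h1₁]; exact hmv') hlev h₁.toWithin).mono ?_)
  rintro s₂ hle₂ ⟨hq₂, hw₂, hf₂, h0₂, h1₂⟩
  rw [show s₁.tick.reg a0 = u from h0₁] at hf₂ h0₂
  rw [show s₁.tick.reg a1 = v from h1₁] at h1₂
  have h₂ := (h₁.quiet hq₂ hw₂ hle₂.space).tick
  refine Wp.branch (fun hne => ?_) (fun heq => ?_)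
  · refine hskip h₂ (by omega) (Or.inr ?_)
    by_contra hn
    exact hne (by rw [hf₂, if_neg hn])
  have hn₂ : ε.m v ≠ u := fun h => by simp [hf₂, h] at heq
  have hpend : ε.Q ++ pending ε.tie ε.m (e.out ++ [⟨u, v, x⟩])
      = (ε.Q ++ pending ε.tie ε.m e.out) ++ [(u, v)] := by
    rw [ht, pending_concat, if_pos ⟨hn₁, hn₂⟩, List.append_assoc]
  have hle := length_pending_le ε.tie ε.m e.out
  have hQ := ε.length_le
  have h0'' : s₂.tick.reg a0 = u := h0₂
  have h1'' : s₂.tick.reg a1 = v := h1₂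
  refine (h₂.toCore.enqueue (I := I) (h0''.trans_lt hu) (h1''.trans_lt hv) ?_).mono ?_
  · rw [List.length_append]
    omega
  · rintro t hlt ⟨hc, hm, hr⟩
    rw [h0'', h1'', ← hpend] at hc
    have hk5 : ¬ ε.k = 5 := by have := ε.k_lt; omega
    have hk6 : ¬ ε.k = 6 := by have := ε.k_lt; omega
    exact
      { toCore := hc.mono (by omega)
        reg := fun r => by
          rw [hr _ fun j _ => cell_ne_volatile ε.k_pos hk j, h₂.reg]
        mem := fun a => by
          rw [hm _ fun i => by simp [hk, hk5, hk6], h₂.mem]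
        le_space := h₂.le_space.trans hlt.space
        frame_reg := fun k hk₁ hk₂ r => by
          rw [hr _ fun j _ => cell_ne_volatile
            (Nat.pos_of_ne_zero fun h => hk₂ (by simp [h])) hk₁ j, h₂.frame_reg k hk₁ hk₂]
        frame_mem := fun k hk₁ hk₂ a => by
          rw [hm, h₂.frame_mem k hk₁ hk₂]
          simp only [List.mem_cons, List.not_mem_nil, or_false, not_or] at hk₂
          intro i
          simp [hk₁, hk₂] }

theorem Rel.emul_emit (h : Rel ε φ δ e s) {J : Input n} (u v : ℕ)
    (hg : Good ε ((Instr.emit u v).apply J e.tick)) :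
    Wp I (emulInstr ε.k ε.tie (.emit u v))
      (Rel ε φ (δ + 40) ((Instr.emit u v).apply J e.tick)) s := by
  have hk := ε.k_lt_eight
  have hk0 : ¬ 0 = ε.k := ε.k_pos.ne
  have hk0' : ¬ ε.k = 0 := ε.k_pos.ne'
  cases ht : ε.tie with
  | false =>
    simp only [emulInstr, Bool.false_eq_true, if_false]
    refine wp_code ?_
    have h₂ := h.quiet (t := ((runList I [] s).tick.set junk 0)) (c := 1)
      (by refine ⟨rfl, rfl, fun r hr => by simp [hr], ?_, ?_⟩ <;> simp)
      ⟨by simpa using h.peak, h.space, h.lazyRead⟩ le_rfl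
    refine
      { toCore := ?_
        reg := h₂.reg, mem := h₂.mem, le_space := h₂.le_space
        frame_reg := h₂.frame_reg, frame_mem := h₂.frame_mem }
    have := h₂.toCore.mono (δ' := δ + 40) (by omega)
    simpa [pending, ht] using this
  | true =>
    simp only [emulInstr, if_true]
    have hout := hg.out ht ⟨e.reg u, e.reg v, e.tick.time⟩ (by simp)
    simp only at hout
    have hlen := hg.length_le ht
    simp at hlen
    have hX := π.le_X
    have hB₁ := π.le_B' (hout.1.le.trans hX)
    have hB₂ := π.le_B' (hout.2.le.trans hX)
    have hp := h.peak
    refine Wp.seq (wp_code ?_)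
    set s₁ := (runList I [.move a0 (cell ε.k u), .move a1 (cell ε.k v)] s).tick.set junk 0 with hs₁
    have hq : Quiet 3 s s₁ := by
      refine ⟨rfl, rfl, fun r hr => ?_, ?_, ?_⟩ <;> simp [hs₁]
      · simp [hr]
      · omega
    have hr0 : s₁.reg a0 = e.reg u := by simp [hs₁, h.reg]
    have hr1 : s₁.reg a1 = e.reg v := by simp [hs₁, h.reg, hk, hk0']
    have hw₁ : Within π s₁ := by
      refine ⟨?_, h.space, h.lazyRead⟩
      simp [hs₁, h.reg, hk, hk0']
      omega
    have h₁ := (h.quiet hq hw₁ le_rfl).tick_left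
    exact Wp.mono (h₁.enqueueNew ht hout.1 hout.2 hr0 hr1 hlen) fun t _ ht => ht.mono (by omega)

/-- Every instruction is emulated in a bounded number of steps. -/
theorem Rel.emulInstr (h : Rel ε φ δ e s) (he : e.Bounded) (i : Instr) (hn : π.n = n)
    {w : Sym2 (Fin n) → ℝ} (hw : ε.tie = true → ∀ e f, w e ≤ w f ↔ TieLe I.weight e f)
    (hw' : ε.tie = false → w = I.weight) (hg : Good ε (i.apply ⟨I.lists, w⟩ e.tick)) :
    Wp I (emulInstr ε.k ε.tie i) (Rel ε φ (δ + 40) (i.apply ⟨I.lists, w⟩ e.tick)) s := by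
  have hset : ∀ (i' : Instr) (d x : ℕ), x ≤ π.X → i'.apply I s.tick = s.tick.set (cell ε.k d) x →
      Wp I (code [i']) (Rel ε φ (δ + 40) (e.tick.set d x)) s := fun i' d x hx hi =>
    Wp.mono (h.tick_left.set hx hi) fun t _ ht => ht.mono (by omega)
  have hpk := hg.peak
  cases i with
  | load d a => exact (h.emul_load he d a hg).mono fun t _ ht => ht.mono (δ' := δ + 40) (by omega)
  | store a b => exact (h.emul_store he a b hg).mono fun t _ ht => ht.mono (δ' := δ + 40) (by omega)
  | compare d u i v j => exact h.emul_compare he d u i v j hn hw hw' hg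
  | emit u v => exact h.emul_emit u v hg
  | _ =>
    simp only [Instr.apply, Config.set, Config.tick, max_le_iff] at hpk
    exact hset _ _ _ hpk.2 (by simp [h.reg])

/-- The emulation of a program follows its run step by step. -/
theorem exec_emul (hn : π.n = n) {w : Sym2 (Fin n) → ℝ}
    (hw : ε.tie = true → ∀ e f, w e ≤ w f ↔ TieLe I.weight e f)
    (hw' : ε.tie = false → w = I.weight) {P : Prog} (hP : Exec ⟨I.lists, w⟩ P e e')
    (he : e.Bounded) (hg : Good ε e') (h : Rel ε (ε.φ + e.time) 130 e s) :
    Wp I (emul ε.k ε.tie P) (Rel ε (ε.φ + e'.time) 100 e') s := by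
  have hstep : ∀ {e e' : Config} {s : Config} {δ : ℕ}, Good ε e' → δ ≤ 200 →
      e'.time = e.time + 1 → Rel ε (ε.φ + e.time) δ e' s →
      Wp I tickCode (Rel ε (ε.φ + e'.time) 100 e') s := by
    intro e e' s δ hg hδ ht h
    have := hg.time
    have := Rel.tickCode (I := I) h (by omega) hδ
    rwa [add_assoc, ← ht] at this
  induction hP generalizing s with
  | instr i e =>
    have ht : (i.apply ⟨I.lists, w⟩ e.tick).time = e.time + 1 := by cases i <;> rfl
    exact Wp.seq ((h.emulInstr he i hn hw hw' hg).mono fun t _ hr => hstep hg (by norm_num) ht hr)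
  | seq h₁ h₂ ih₁ ih₂ =>
    exact Wp.seq ((ih₁ he (hg.of_le h₂.le) h).mono fun t _ hr =>
      ih₂ (h₁.bounded he) hg (hr.mono (by norm_num)))
  | branchTrue ha h₁ ih =>
    refine Wp.branch (fun _ => Wp.seq ?_) (fun h0 => absurd (h.reg _ ▸ h0) ha)
    exact (hstep (hg.of_le h₁.le) (by norm_num) rfl h.tick.tick_left).mono fun t _ hr =>
      ih he hg (hr.mono (by norm_num))
  | branchFalse ha h₁ ih =>
    refine Wp.branch (fun h0 => absurd ha (h.reg _ ▸ h0)) (fun _ => Wp.seq ?_)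
    exact (hstep (hg.of_le h₁.le) (by norm_num) rfl h.tick.tick_left).mono fun t _ hr =>
      ih he hg (hr.mono (by norm_num))
  | loopTrue ha h₁ h₂ ih₁ ih₂ =>
    have hg₁ := hg.of_le h₂.le
    obtain ⟨s₁, hs₁, hr₁⟩ := hstep (hg₁.of_le h₁.le) (by norm_num) rfl h.tick.tick_left
    obtain ⟨s₂, hs₂, hr₂⟩ := ih₁ he hg₁ (hr₁.mono (by norm_num))
    obtain ⟨s₃, hs₃, hr₃⟩ := ih₂ (h₁.bounded he) hg (hr₂.mono (by norm_num))
    cases hs₃ with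
    | seq hl ht =>
      exact ⟨s₃, .seq (.loopTrue (by rw [h.reg]; exact ha) (.seq hs₁ hs₂) hl) ht, hr₃⟩
  | loopFalse ha =>
    refine Wp.seq ⟨s.tick, .loopFalse (by rw [h.reg]; exact ha), ?_⟩
    exact hstep hg (by norm_num) rfl h.tick.tick_left

end

/-! ### Preprocessing -/

/-- One step of the first loop of the preprocessing: add a degree, and note that the vertex has not
chosen a neighbor, for which the number `n` stands. -/
def sumBody : Prog :=
  code ([.const t0 1, .op .sub v v t0, .degree x1 v, .op .add sum sum x1, .order num] ++
    st 0 v num)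

/-- Go to the next vertex, and test whether its degree is large. -/
def collectTest : Prog :=
  code [.const t0 1, .op .sub v v t0, .degree x1 v, .op .lt flag best x1]

/-- Append the current vertex to the list of vertices of small degree. -/
def collectPush : Prog := code (st 4 len v ++ [.const t0 1, .op .add len len t0])

/-- One step of the second loop of the preprocessing: collect the vertices of small degree. -/
def collectBody : Prog := .seq collectTest (.branch flag (code []) collectPush)

/-- The quota in the first part is `K` times `avg`, which is the average degree rounded down,
plus `1`. -/
def quotaCode (K : ℕ) : Prog :=
  code [.order num, .op .div avg sum num, .const t0 1, .op .add avg avg t0, .const t0 K,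
    .op .mul quota t0 avg, .op .add best avg avg, .order v]

/-- The preprocessing. A vertex has small degree if its degree is at most `2 * avg`, the value of
`best` in the second loop. -/
def prep (K : ℕ) : Prog :=
  .seq (code [.order v]) (.seq (.loop v sumBody) (.seq (quotaCode K) (.loop v collectBody)))

/-- Properties that hold throughout the preprocessing. -/
structure Fresh (B Sp : ℕ) (s : Config) : Prop where
  out : s.out = []
  lazyRead : s.lazyRead = false
  peak : s.peak ≤ B
  space : s.space ≤ Sp
  head : s.reg head = 0
  cnt : s.reg cnt = 0
  tail : s.reg tail = 0
  reg : ∀ r, (∀ j, r ≠ cell 0 j) → s.reg r = 0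
  mem : ∀ a, (∀ i, a ≠ cell 0 i ∧ a ≠ cell 4 i) → s.mem a = none

section

variable {n : ℕ} {I : Input n} {X B Sp : ℕ}

/-- The sum of the degrees of the vertices `j, …, n - 1`. -/
def AdjLists.degSum (A : AdjLists n) (j : ℕ) : ℕ := ∑ u ∈ Finset.Ico j n, A.degree u

theorem AdjLists.degSum_zero (A : AdjLists n) : A.degSum 0 = ∑ u : Fin n, A.degree u := by
  rw [AdjLists.degSum, ← Finset.range_eq_Ico, Finset.sum_range]

theorem AdjLists.degSum_le (A : AdjLists n) (j : ℕ) : A.degSum j ≤ A.degSum 0 :=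
  Finset.sum_le_sum_of_subset (Finset.Ico_subset_Ico_left (Nat.zero_le j))

theorem AdjLists.degree_le_degSum (A : AdjLists n) {u : ℕ} (hu : u < n) :
    A.degree u ≤ A.degSum 0 :=
  Finset.single_le_sum (f := A.degree) (fun _ _ => Nat.zero_le _) (by simpa using hu)

/-- The invariant of the first loop of the preprocessing: the vertices `j, …, n - 1` have been
inspected. An iteration takes at most `20` steps. -/
structure Summing (A : AdjLists n) (B Sp j : ℕ) (s : Config) : Prop extends Fresh B Sp s where
  v : s.reg v = j
  le : j ≤ n
  len : s.reg len = 0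
  sum : s.reg sum = A.degSum j
  mem0 : ∀ u, j ≤ u → u < n → s.mem (cell 0 u) = some n
  le_space : j < n → n ≤ s.space
  time_le : s.time + 20 * j ≤ 20 * n + 2
  le_time : n ≤ s.time + j

theorem Summing.step (hX : n ≤ X) (hM : I.lists.degSum 0 ≤ X) (hB : 64 * (X * X + X + 1) ≤ B)
    (hSp : 16 * n + 8 ≤ Sp) (j : ℕ) (s : Config) (h : Summing I.lists B Sp (j + 1) s) :
    Wp I sumBody (Summing I.lists B Sp j) s.tick := by
  have hv := h.v
  have hj := h.le
  have hsum := h.sum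
  have hd := I.lists.degree_le_degSum (u := j) (by omega)
  have hds := I.lists.degSum_le j
  have hsucc : I.lists.degSum (j + 1) + I.lists.degree j = I.lists.degSum j := by
    simp only [AdjLists.degSum]
    rw [Finset.sum_eq_sum_Ico_succ_bot (show j < n by omega), add_comm]
  have hXX := Nat.zero_le (X * X)
  have hp := h.peak
  have hs := h.space
  have hcell : cell 0 j = 8 * j := rfl
  refine wp_code ?_
  rw [runList_append, runList_st (by simp) (by simp) (by simp)]
  simp [hv, hsum, hsucc]
  exact
    { out := h.out
      lazyRead := h.lazyRead
      peak := by simp only [max_le_iff]; omega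
      space := by simp only [max_le_iff]; omega
      head := by simpa using h.head
      cnt := by simpa using h.cnt
      tail := by simpa using h.tail
      reg := fun r hr => by simpa [hr] using h.reg r hr
      mem := fun a ha => by simpa [ha] using h.mem a ha
      v := by simp
      le := by omega
      len := by simpa using h.len
      sum := by simp
      mem0 := fun u hu hun => by
        by_cases huj : u = j
        · simp [huj]
        · simpa [Function.update_apply, huj] using h.mem0 u (by omega) hun
      le_space := fun _ => by
        simp only [le_max_iff]
        by_cases hjn : j + 1 < n
        · exact Or.inl (h.le_space hjn)
        · right; omega
      time_le := by have := h.time_le; simp only; omega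
      le_time := by have := h.le_time; simp only; omega }

/-- The invariant of the second loop of the preprocessing: the vertices `j, …, n - 1` have been
inspected, the loop counter is `c`, and `τ` accounts for the steps in the current iteration. -/
structure Collecting (A : AdjLists n) (B Sp K j c τ : ℕ) (s : Config) : Prop
    extends Fresh B Sp s where
  v : s.reg v = c
  le : j ≤ n
  best : s.reg best = 2 * (A.degSum 0 / n + 1)
  sum : s.reg sum = A.degSum 0
  quota : s.reg quota = K * (A.degSum 0 / n + 1)
  mem0 : ∀ u < n, s.mem (cell 0 u) = some n
  light : ∃ L : List ℕ, L.Nodup ∧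
    (∀ u, u ∈ L ↔ j ≤ u ∧ u < n ∧ A.degree u ≤ 2 * (A.degSum 0 / n + 1)) ∧
    s.reg len = L.length ∧ ∀ i u, L[i]? = some u → s.mem (cell 4 i) = some u
  le_space : n ≤ s.space
  time_le : s.time + 20 * j ≤ 40 * n + 30 + τ
  le_time : n ≤ s.time

theorem length_le_of_forall_lt {L : List ℕ} (hL : L.Nodup) (h : ∀ u ∈ L, u < n) : L.length ≤ n := by
  rw [← List.toFinset_card_of_nodup hL]
  exact (Finset.card_le_card (t := Finset.range n) fun u hu => by
    simpa using h u (by simpa using hu)).trans (by simp)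

theorem Collecting.test {K j : ℕ} {s : Config} (hX : n ≤ X) (hM : I.lists.degSum 0 ≤ X)
    (hB : 64 * (X * X + X + 1) ≤ B) (h : Collecting I.lists B Sp K (j + 1) (j + 1) 0 s) :
    Wp I collectTest (fun t => Collecting I.lists B Sp K (j + 1) j 6 t ∧ t.reg flag =
        if 2 * (I.lists.degSum 0 / n + 1) < I.lists.degree j then 1 else 0) s.tick := by
  have hv := h.v
  have hj := h.le
  have hbest := h.best
  have hd := I.lists.degree_le_degSum (u := j) (by omega)
  have hXX := Nat.zero_le (X * X)
  have hif : ∀ (P : Prop) [Decidable P], (if P then 1 else 0) ≤ B := fun P _ => by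
    split_ifs <;> omega
  have htl := h.time_le
  have hlt := h.le_time
  refine wp_code ?_
  simp [hv, hbest]
  exact
    { out := h.out
      lazyRead := h.lazyRead
      peak := max_le h.peak (max_le (by omega) (max_le (by omega) (max_le (by omega) (hif _))))
      space := h.space
      head := by simpa using h.head
      cnt := by simpa using h.cnt
      tail := by simpa using h.tail
      reg := fun r hr => by simpa [hr] using h.reg r hr
      mem := h.mem
      v := by simp
      le := hj
      best := by simpa using hbest
      sum := by simpa using h.sum
      quota := by simpa using h.quota
      mem0 := h.mem0
      light := by simpa using h.light
      le_space := h.le_space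
      time_le := by simp only; omega
      le_time := by simp only; omega }

theorem Collecting.heavy {K j : ℕ} {s : Config}
    (h : Collecting I.lists B Sp K (j + 1) j 6 s)
    (hj : 2 * (I.lists.degSum 0 / n + 1) < I.lists.degree j) :
    Wp I (code []) (Collecting I.lists B Sp K j j 0) s.tick := by
  have htl := h.time_le
  have hlt := h.le_time
  refine wp_code ?_
  exact
    { out := h.out
      lazyRead := h.lazyRead
      peak := by simpa using h.peak
      space := h.space
      head := by simpa using h.head
      cnt := by simpa using h.cnt
      tail := by simpa using h.tail
      reg := fun r hr => by simpa [hr] using h.reg r hr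
      mem := h.mem
      v := by simpa using h.v
      le := (Nat.le_succ j).trans h.le
      best := by simpa using h.best
      sum := by simpa using h.sum
      quota := by simpa using h.quota
      mem0 := h.mem0
      light := by
        obtain ⟨L, hL, hmem, hlen, hlist⟩ := h.light
        refine ⟨L, hL, fun u => ?_, by simpa using hlen, hlist⟩
        rw [hmem]
        constructor
        · rintro ⟨h₁, h₂, h₃⟩
          exact ⟨by omega, h₂, h₃⟩
        · rintro ⟨h₁, h₂, h₃⟩
          rcases h₁.lt_or_eq with h₁ | rfl
          · exact ⟨h₁, h₂, h₃⟩
          · omega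
      le_space := h.le_space
      time_le := by simp; omega
      le_time := by simp; omega }

theorem Collecting.light_step {K j : ℕ} {s : Config} (hX : n ≤ X)
    (hB : 64 * (X * X + X + 1) ≤ B) (hSp : 16 * n + 8 ≤ Sp)
    (h : Collecting I.lists B Sp K (j + 1) j 6 s)
    (hj : I.lists.degree j ≤ 2 * (I.lists.degSum 0 / n + 1)) :
    Wp I collectPush (Collecting I.lists B Sp K j j 0) s.tick := by
  have htl := h.time_le
  have hlt := h.le_time
  have hv := h.v
  have hle := h.le
  have hp := h.peak
  have hs := h.space
  have hls := h.le_space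
  obtain ⟨L, hL, hmem, hlen, hlist⟩ := h.light
  have hLn : (L ++ [j]).length ≤ n := by
    refine length_le_of_forall_lt ?_ fun u hu => ?_
    · rw [List.nodup_append_comm]
      simpa [hL] using fun hj => by have := (hmem j).1 hj; omega
    · rcases List.mem_append.1 hu with hu | hu
      · exact ((hmem u).1 hu).2.1
      · rw [List.mem_singleton.1 hu]
        omega
  rw [List.length_append, List.length_singleton] at hLn
  have hcell : cell 4 L.length = 8 * L.length + 4 := rfl
  have hXX := Nat.zero_le (X * X)
  refine wp_code ?_
  rw [runList_append, runList_st (by simp) (by simp) (by simp)]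
  simp [hlen, hv]
  exact
    { out := h.out
      lazyRead := h.lazyRead
      peak := by simp only [max_le_iff]; omega
      space := by simp only [max_le_iff]; omega
      head := by simpa using h.head
      cnt := by simpa using h.cnt
      tail := by simpa using h.tail
      reg := fun r hr => by simpa [hr] using h.reg r hr
      mem := fun a ha => by simpa [ha] using h.mem a ha
      v := by simpa using hv
      le := by omega
      best := by simpa using h.best
      sum := by simpa using h.sum
      quota := by simpa using h.quota
      mem0 := fun u hu => by simpa using h.mem0 u hu
      light := by
        refine ⟨L ++ [j], ?_, fun u => ?_, by simp, fun i u hi => ?_⟩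
        · rw [List.nodup_append_comm]
          simpa [hL] using fun hj => by have := (hmem j).1 hj; omega
        · rw [List.mem_append, hmem, List.mem_singleton]
          constructor
          · rintro (⟨h₁, h₂, h₃⟩ | rfl)
            · exact ⟨by omega, h₂, h₃⟩
            · exact ⟨le_rfl, by omega, hj⟩
          · rintro ⟨h₁, h₂, h₃⟩
            rcases h₁.lt_or_eq with h₁ | rfl
            · exact Or.inl ⟨h₁, h₂, h₃⟩
            · exact Or.inr rfl
        · rcases lt_trichotomy i L.length with hlt | rfl | hgt
          · rw [List.getElem?_append_left hlt] at hi
            simpa [Function.update_apply, hlt.ne] using hlist i u hi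
          · simp at hi
            simp [← hi]
          · rw [List.getElem?_eq_none (by simp; omega)] at hi
            cases hi
      le_space := by simp only [le_max_iff]; exact Or.inl hls
      time_le := by simp; omega
      le_time := by simp; omega }

theorem Collecting.step {K : ℕ} (hX : n ≤ X) (hM : I.lists.degSum 0 ≤ X)
    (hB : 64 * (X * X + X + 1) ≤ B) (hSp : 16 * n + 8 ≤ Sp) (j : ℕ) (s : Config)
    (h : Collecting I.lists B Sp K (j + 1) (j + 1) 0 s) :
    Wp I collectBody (Collecting I.lists B Sp K j j 0) s.tick := by
  refine Wp.seq ((h.test hX hM hB).mono ?_)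
  rintro t - ⟨ht, hf⟩
  refine Wp.branch (fun hne => ht.heavy ?_) (fun heq => ht.light_step hX hB hSp ?_)
  · by_contra hn
    exact hne (by rw [hf, if_neg hn])
  · by_contra hn
    simp [hf, not_le.1 hn] at heq

theorem wp_prep {K : ℕ} (hn : 1 ≤ n) (hX : n ≤ X) (hM : I.lists.degSum 0 ≤ X)
    (hB : (64 + 4 * K) * (X * X + X + 1) ≤ B) (hSp : 16 * n + 8 ≤ Sp) :
    Wp I (prep K) (fun t => ∃ s, Collecting I.lists B Sp K 0 0 0 s ∧ t = s.tick) Config.start := by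
  have hB' : 64 * (X * X + X + 1) ≤ B := le_trans (Nat.mul_le_mul_right _ (by omega)) hB
  have hXX := Nat.zero_le (X * X)
  refine Wp.seq (wp_code ?_)
  refine Wp.seq (Wp.loop_down (J := Summing I.lists B Sp) (fun _ _ h => h.v)
    (Summing.step hX hM hB' hSp) _ ?_ n ?_)
  · intro s h
    have hv := h.v
    have hsum := h.sum
    have hp := h.peak
    have hdiv : I.lists.degSum 0 / n ≤ I.lists.degSum 0 := Nat.div_le_self _ _
    have hK : K * (I.lists.degSum 0 / n + 1) ≤ K * (X * X + X + 1) :=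
      Nat.mul_le_mul_left _ (by omega)
    have hK' : K ≤ K * (X * X + X + 1) := Nat.le_mul_of_pos_right _ (by omega)
    refine Wp.seq (wp_code ?_)
    refine Wp.loop_down (J := fun j => Collecting I.lists B Sp K j j 0) (fun _ _ h => h.v)
      (Collecting.step hX hM hB' hSp) _ (fun s hs => ⟨s, hs, rfl⟩) n ?_
    have htl := h.time_le
    have hlt := h.le_time
    have hls := h.le_space (by omega)
    simp [hsum]
    exact
      { out := h.out
        lazyRead := h.lazyRead
        peak := by simp only [max_le_iff]; rw [add_mul, mul_assoc] at hB; omega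
        space := h.space
        head := by simpa using h.head
        cnt := by simpa using h.cnt
        tail := by simpa using h.tail
        reg := fun r hr => by simpa [hr] using h.reg r hr
        mem := h.mem
        v := by simp
        le := le_rfl
        best := by simp; ring
        sum := by simpa using hsum
        quota := by simp
        mem0 := fun u hu => h.mem0 u (Nat.zero_le u) hu
        light := ⟨[], by simp, fun u => by simp; omega, by simpa using h.len, by simp⟩
        le_space := hls
        time_le := by simp only; omega
        le_time := by simp only; omega }
  · exact
      { out := rfl
        lazyRead := rfl
        peak := by simp [Config.start]; omega
        space := by simp [Config.start]
        head := by simp [Config.start]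
        cnt := by simp [Config.start]
        tail := by simp [Config.start]
        reg := fun r hr => by simp [Config.start, hr]
        mem := fun a ha => rfl
        v := by simp
        le := le_rfl
        len := by simp [Config.start]
        sum := by simp [Config.start, AdjLists.degSum]
        mem0 := fun u h₁ h₂ => by omega
        le_space := fun h => by omega
        time_le := by simp [Config.start]; omega
        le_time := by simp [Config.start] }

end

/-! ### Vertices choose their lightest edges -/

section

variable {n : ℕ} {A : AdjLists n} {w : Sym2 (Fin n) → ℝ}

theorem AdjLists.exists_entry {u i : ℕ} (h : i < A.degree u) :
    ∃ (hu : u < n) (x : Fin n), A.entry u i = some x ∧ A.edge u i = some s(⟨u, hu⟩, x) ∧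
      A.nbr u i = x ∧ A.graph.Adj ⟨u, hu⟩ x := by
  unfold AdjLists.degree at h
  split_ifs at h with hu
  · refine ⟨hu, (A.nbrs ⟨u, hu⟩)[i], ?_, ?_, ?_, List.getElem_mem h⟩
    · simp [AdjLists.entry, hu, h]
    · simp [AdjLists.edge, hu, h]
    · simp [AdjLists.nbr, AdjLists.entry, hu, h]
  · omega

theorem AdjLists.exists_index {u y : Fin n} (h : A.graph.Adj u y) :
    ∃ i < A.degree u, A.edge u i = some s(u, y) := by
  obtain ⟨i, hi, rfl⟩ := List.getElem_of_mem (show y ∈ A.nbrs u from h)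
  exact ⟨i, by simpa [AdjLists.degree] using hi, by simp [AdjLists.edge, hi]⟩

/-- The weight of the edge in position `i` of the list of `u`. -/
noncomputable def AdjLists.key (A : AdjLists n) (w : Sym2 (Fin n) → ℝ) (u i : ℕ) : ℝ :=
  match A.edge u i with
  | some e => w e
  | none => 0

theorem compare_ne_zero_iff {u i v j : ℕ} (hi : i < A.degree u) (hj : j < A.degree v) :
    Input.compare ⟨A, w⟩ u i v j ≠ 0 ↔ A.key w u i ≤ A.key w v j := by
  obtain ⟨_, x, -, hx, -, -⟩ := A.exists_entry hi
  obtain ⟨_, y, -, hy, -, -⟩ := A.exists_entry hj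
  simp [Input.compare, AdjLists.key, hx, hy]

/-- The vertex `x` is the neighbor of `v` that `v` chooses. A vertex without neighbors chooses
the vertex `0`. -/
def Choice (A : AdjLists n) (w : Sym2 (Fin n) → ℝ) (v x : ℕ) : Prop :=
  A.degree v = 0 ∧ x = 0 ∨ ∃ (hv : v < n) (hx : x < n), A.graph.Adj ⟨v, hv⟩ ⟨x, hx⟩ ∧
    ∀ y, A.graph.Adj ⟨v, hv⟩ y → w s(⟨v, hv⟩, ⟨x, hx⟩) ≤ w s(⟨v, hv⟩, y)

theorem choice_nbr {v i : ℕ} (hv : v < n) (hi : 0 < A.degree v → i < A.degree v)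
    (hmin : ∀ j < A.degree v, A.key w v i ≤ A.key w v j) : Choice A w v (A.nbr v i) := by
  rcases Nat.eq_zero_or_pos (A.degree v) with h0 | hpos
  · refine Or.inl ⟨h0, ?_⟩
    have : A.nbrs ⟨v, hv⟩ = [] := by simpa [AdjLists.degree, hv] using h0
    simp [AdjLists.nbr, AdjLists.entry, hv, this]
  · obtain ⟨_, x, -, hx, hnbr, hadj⟩ := A.exists_entry (hi hpos)
    refine Or.inr ⟨hv, hnbr ▸ x.2, by simpa [hnbr] using hadj, fun y hy => ?_⟩
    obtain ⟨j, hj, hjy⟩ := A.exists_index hy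
    have := hmin j hj
    simp only [AdjLists.key, hx, hjy] at this
    simpa [hnbr] using this

/-- The vertices in `S` have chosen the neighbors that are given by `m`, and `Q` lists the edges
chosen, each of them once. -/
structure Chosen (A : AdjLists n) (w : Sym2 (Fin n) → ℝ) (S : List ℕ) (m : ℕ → ℕ)
    (Q : List (ℕ × ℕ)) : Prop where
  unset : ∀ u < n, u ∉ S → m u = n
  choice : ∀ u ∈ S, u < n ∧ m u < n ∧ Choice A w u (m u)
  queue : ∀ e ∈ Q, e.1 ∈ S ∧ m e.1 = e.2 ∧ e.1 ≠ e.2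
  covered : ∀ u ∈ S, m u ≠ u → (u, m u) ∈ Q ∨ (m u, u) ∈ Q
  nodup : (Q.map fun e => s(e.1, e.2)).Nodup
  length_le : Q.length ≤ S.length

variable {S : List ℕ} {m : ℕ → ℕ} {Q : List (ℕ × ℕ)} {v x : ℕ}

theorem Chosen.le (h : Chosen A w S m Q) {u : ℕ} (hu : u < n) : m u ≤ n := by
  by_cases hS : u ∈ S
  · exact (h.choice u hS).2.1.le
  · exact (h.unset u hu hS).le

/-- The edge that `v` chooses has already been chosen by its other endpoint. -/
theorem Chosen.cons_old (h : Chosen A w S m Q) (hvS : v ∉ S) (hv : v < n) (hx : x < n)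
    (hc : Choice A w v x) (hxv : Function.update m v x x = v) :
    Chosen A w (v :: S) (Function.update m v x) Q := by
  have hne : ∀ u ∈ S, u ≠ v := fun u hu huv => hvS (huv ▸ hu)
  refine ⟨fun u hu huS => ?_, fun u hu => ?_, fun e he => ?_, fun u hu hmu => ?_, h.nodup,
    h.length_le.trans (by simp)⟩
  · rw [List.mem_cons, not_or] at huS
    rw [Function.update_of_ne huS.1, h.unset u hu huS.2]
  · rcases List.mem_cons.1 hu with rfl | hu
    · simpa using ⟨hv, hx, hc⟩
    · rw [Function.update_of_ne (hne u hu)]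
      exact h.choice u hu
  · obtain ⟨h₁, h₂, h₃⟩ := h.queue e he
    exact ⟨List.mem_cons_of_mem _ h₁, by rwa [Function.update_of_ne (hne _ h₁)], h₃⟩
  · rcases List.mem_cons.1 hu with rfl | hu
    · rw [Function.update_self] at hmu ⊢
      rw [Function.update_of_ne hmu] at hxv
      have hxS : x ∈ S := by
        by_contra hxS
        have := h.unset x hx hxS
        omega
      have := h.covered x hxS (by rw [hxv]; exact hmu.symm)
      rw [hxv] at this
      exact this.symm
    · rw [Function.update_of_ne (hne u hu)] at hmu ⊢
      exact h.covered u hu hmu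

/-- The edge that `v` chooses has not been chosen before. -/
theorem Chosen.cons_new (h : Chosen A w S m Q) (hvS : v ∉ S) (hv : v < n) (hx : x < n)
    (hc : Choice A w v x) (hxv : Function.update m v x x ≠ v) :
    Chosen A w (v :: S) (Function.update m v x) (Q ++ [(v, x)]) := by
  have hne : ∀ u ∈ S, u ≠ v := fun u hu huv => hvS (huv ▸ hu)
  have hxne : x ≠ v := by
    rintro rfl
    exact hxv (by simp)
  rw [Function.update_of_ne hxne] at hxv
  refine ⟨fun u hu huS => ?_, fun u hu => ?_, fun e he => ?_, fun u hu hmu => ?_, ?_, ?_⟩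
  · rw [List.mem_cons, not_or] at huS
    rw [Function.update_of_ne huS.1, h.unset u hu huS.2]
  · rcases List.mem_cons.1 hu with rfl | hu
    · simpa using ⟨hv, hx, hc⟩
    · rw [Function.update_of_ne (hne u hu)]
      exact h.choice u hu
  · rcases List.mem_append.1 he with he | he
    · obtain ⟨h₁, h₂, h₃⟩ := h.queue e he
      exact ⟨List.mem_cons_of_mem _ h₁, by rwa [Function.update_of_ne (hne _ h₁)], h₃⟩
    · rw [List.mem_singleton.1 he]
      exact ⟨List.mem_cons_self, by simp, hxne.symm⟩
  · rcases List.mem_cons.1 hu with rfl | hu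
    · simp
    · rw [Function.update_of_ne (hne u hu)] at hmu ⊢
      simp only [List.mem_append]
      exact (h.covered u hu hmu).imp Or.inl Or.inl
  · rw [List.map_append, List.nodup_append_comm]
    simp only [List.map_cons, List.map_nil, List.singleton_append, List.nodup_cons]
    refine ⟨fun hmem => ?_, h.nodup⟩
    obtain ⟨e, he, hes⟩ := List.mem_map.1 hmem
    obtain ⟨h₁, h₂, -⟩ := h.queue e he
    rcases Sym2.eq_iff.1 hes with ⟨h₃, -⟩ | ⟨h₃, h₄⟩
    · exact hvS (h₃ ▸ h₁)
    · rw [h₃, h₄] at h₂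
      exact hxv h₂
  · simpa using h.length_le

/-- Every edge is chosen by at most two vertices. -/
theorem Chosen.length_le_two_mul (h : Chosen A w S m Q) (hS : S.Nodup) (hA : A.graph.Connected) :
    S.length ≤ 2 * Q.length + 1 := by
  rcases Nat.lt_or_ge n 2 with hn | hn
  · have := length_le_of_forall_lt hS fun u hu => (h.choice u hu).1
    omega
  · have hsub : S ⊆ Q.map Prod.fst ++ Q.map Prod.snd := by
      intro u hu
      obtain ⟨hun, -, hc⟩ := h.choice u hu
      have hmu : m u ≠ u := by
        rcases hc with ⟨h0, -⟩ | ⟨hv, hx, hadj, -⟩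
        · have : Nontrivial (Fin n) := Fin.nontrivial_iff_two_le.2 hn
          obtain ⟨y, hy⟩ := hA.preconnected.exists_adj_of_nontrivial ⟨u, hun⟩
          obtain ⟨i, hi, -⟩ := A.exists_index hy
          simp only at hi
          omega
        · intro hmu
          exact hadj.ne (Fin.ext hmu.symm)
      rw [List.mem_append, List.mem_map, List.mem_map]
      rcases h.covered u hu hmu with hQ | hQ
      · exact Or.inl ⟨_, hQ, rfl⟩
      · exact Or.inr ⟨_, hQ, rfl⟩
    have := (hS.subperm hsub).length_le
    simp only [List.length_append, List.length_map] at this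
    omega

theorem chosen_nil (A : AdjLists n) (w : Sym2 (Fin n) → ℝ) : Chosen A w [] (fun _ => n) [] :=
  ⟨fun _ _ _ => rfl, by simp, by simp, by simp, by simp, by simp⟩

end

/-! ### The first part of the enumeration -/

/-- Go to the next edge in the list of the vertex `v`, and prepare to compare it with the lightest
one so far. -/
def scanNext : Prog :=
  code [.const t0 1, .op .sub j j t0, .move a0 v, .move a1 j, .move a2 v, .move a3 best]

/-- Inspect the next edge in the list of the vertex `v`. -/
def scanBody : Prog :=
  .seq scanNext (.seq tieCompare (.seq (.branch res (code [.move best j]) (code [])) tickCode))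

/-- Record that the vertex `v` chooses the edge in position `best` of its list. -/
def record : Prog :=
  code ([.neighbor a1 v best, .move a0 v] ++ st 0 a0 a1)

/-- Let the vertex `v` choose the edge in position `best` of its list. -/
def choose : Prog :=
  .seq record (.seq (checkChosen a1 a0) (.branch flag (code []) enqueue))

/-- Go to the next vertex in the list of vertices of small degree. -/
def nextVertex : Prog :=
  code ([.const t0 1, .op .sub i i t0] ++ ld 4 v i ++ [.const best 0, .degree j v])

/-- Let the next vertex in the list find its lightest edge and choose it. -/
def chooseNext : Prog :=
  .seq nextVertex (.seq (.loop j scanBody) (.seq choose tickCode))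

/-- All vertices of small degree choose their lightest edges. -/
def chooseAll : Prog :=
  .seq (code [.move i len]) (.loop i chooseNext)

section

variable {n : ℕ} {I : Input n} {π : Params} {w : Sym2 (Fin n) → ℝ} {q φ : ℕ}
  {Q : List (ℕ × ℕ)}

/-- The invariant of the search for the lightest edge of `x`, of degree `d`, where `d - k`
edges have been inspected. -/
structure Scan (A : AdjLists n) (π : Params) (w : Sym2 (Fin n) → ℝ) (q : ℕ) (Q : List (ℕ × ℕ))
    (φ δ x k c : ℕ) (s₀ s : Config) : Prop where
  core : Core π q Q (φ + (A.degree x - k)) δ s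
  le : k ≤ A.degree x
  vertex : s.reg v = x
  counter : s.reg j = c
  best_lt : 0 < A.degree x → s.reg best < A.degree x
  min : ∀ i, k ≤ i → i < A.degree x → A.key w x (s.reg best) ≤ A.key w x i
  mem : s.mem = s₀.mem
  frame : ∀ r, (∀ j < 22, r ≠ cell 0 j) → r ≠ Reg.j → r ≠ Reg.best → s.reg r = s₀.reg r

variable {x k c δ : ℕ} {s₀ s t : Config}

theorem Scan.quiet (h : Scan I.lists π w q Q φ δ x k c s₀ s) {c' : ℕ} (hq : Quiet c' s t)
    (ht : Within π t) : Scan I.lists π w q Q φ (δ + c') x k c s₀ t := by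
  have hb : t.reg best = s.reg best := hq.reg _ fun j _ _ => by simp; omega
  exact
    { core := h.core.quiet hq ht
      le := h.le
      vertex := (hq.reg _ fun j _ _ => by simp; omega).trans h.vertex
      counter := (hq.reg _ fun j _ _ => by simp; omega).trans h.counter
      best_lt := by rw [hb]; exact h.best_lt
      min := by rw [hb]; exact h.min
      mem := hq.mem.trans h.mem
      frame := fun r hr h₁ h₂ => (hq.reg r fun j hj _ => hr j hj).trans (h.frame r hr h₁ h₂) }

theorem Scan.next (hd : I.lists.degree x ≤ π.X) (hxX : x ≤ π.X)
    (h : Scan I.lists π w q Q φ δ x (k + 1) (k + 1) s₀ s) :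
    Wp I scanNext (fun t => Scan I.lists π w q Q φ (δ + 7) x (k + 1) k s₀ t ∧
      t.reg a0 = x ∧ t.reg a1 = k ∧ t.reg a2 = x ∧ t.reg a3 = t.reg best) s := by
  have hv := h.vertex
  have hc := h.counter
  have hk := h.le
  have hb := h.best_lt (by omega)
  have hp := h.core.peak
  have hB := fun y (hy : y ≤ π.X) => π.le_B' hy
  have hB₁ := hB x hxX
  have hB₂ := hB k (by omega)
  have hB₃ := hB (s.reg best) (by omega)
  have hB₄ := hB 1 (by have := π.n_pos; have := π.le_X; omega)
  refine wp_code ?_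
  simp [hv, hc]
  exact
    { core := h.core.congr ⟨by simp only [max_le_iff]; omega, h.core.space, h.core.lazyRead⟩
        (fun j hj => by
          simp only [List.mem_cons, List.not_mem_nil, or_false] at hj
          rcases hj with rfl | rfl | rfl | rfl <;> simp)
        (fun _ _ => ⟨rfl, rfl⟩) rfl (by simp only; omega) le_rfl
      le := hk
      vertex := by simpa using hv
      counter := by simp
      best_lt := fun _ => by simpa using hb
      min := by simpa using h.min
      mem := h.mem
      frame := fun r hr hr₁ hr₂ => by simpa [hr, hr₁, hr₂] using h.frame r hr hr₁ hr₂ }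

theorem Scan.step (hw : ∀ e f, w e ≤ w f ↔ TieLe I.weight e f) (hn : π.n = n)
    (hx : x < n) (hd : I.lists.degree x ≤ π.X) (hD : 200 * q + 300 ≤ π.D)
    (hφ : φ + I.lists.degree x < (Q.length + 1) * q) (k : ℕ) (s : Config)
    (h : Scan I.lists π w q Q φ 120 x (k + 1) (k + 1) s₀ s) :
    Wp I scanBody (Scan I.lists π w q Q φ 120 x k k s₀) s.tick := by
  have h' : Scan I.lists π w q Q φ 121 x (k + 1) (k + 1) s₀ s.tick :=
    h.quiet (.of_tick s) h.core.toWithin.tick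
  have hX := π.le_X
  refine Wp.seq ((h'.next hd (by omega)).mono ?_)
  rintro s₀' - ⟨h₀, hr0, hr1, hr2, hr3⟩
  have hk := h₀.le
  have hb := h₀.best_lt (by omega)
  refine Wp.seq ((wp_tieCompare hw hn h₀.core.toWithin ?_).mono ?_)
  · intro j hj
    simp only [List.mem_cons, List.not_mem_nil, or_false] at hj
    rcases hj with rfl | rfl | rfl | rfl
    · exact hr0.le.trans (by omega)
    · exact hr1.le.trans (by omega)
    · exact hr2.le.trans (by omega)
    · exact hr3.le.trans (by omega)
  rintro s₁ - ⟨hq, ht, hres⟩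
  have h₁ := h₀.quiet hq ht
  rw [hr0, hr1, hr2, hr3, ← hq.reg best fun j _ _ => by simp; omega] at hres
  replace hres : s₁.reg res ≠ 0 ↔ I.lists.key w x k ≤ I.lists.key w x (s₁.reg best) := by
    rw [hres, compare_ne_zero_iff (by omega) (h₁.best_lt (by omega))]
  have hkey : ∀ s₂ : Config, Core π q Q (φ + (I.lists.degree x - (k + 1))) 200 s₂ → s₂.reg v = x →
      s₂.reg j = k → (0 < I.lists.degree x → s₂.reg best < I.lists.degree x) →
      (∀ i, k ≤ i → i < I.lists.degree x →
        I.lists.key w x (s₂.reg best) ≤ I.lists.key w x i) →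
      s₂.mem = s₀.mem →
      (∀ r, (∀ j < 22, r ≠ cell 0 j) → r ≠ Reg.j → r ≠ Reg.best → s₂.reg r = s₀.reg r) →
      Wp I tickCode (Scan I.lists π w q Q φ 120 x k k s₀) s₂ := by
    intro s₂ hc hv hj hb hm hmem hf
    refine (hc.tickCode (by omega) le_rfl hD).mono ?_
    rintro t - ⟨ht, hmt, hrt⟩
    replace ht := ht.mono (δ' := 120) (by norm_num)
    have hbt : t.reg best = s₂.reg best := hrt _ fun j _ => by simp; omega
    exact
      { core := by
          have : φ + (I.lists.degree x - (k + 1)) + 1 = φ + (I.lists.degree x - k) := by omega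
          exact this ▸ ht
        le := by omega
        vertex := (hrt _ fun j _ => by simp; omega).trans hv
        counter := (hrt _ fun j _ => by simp; omega).trans hj
        best_lt := by rw [hbt]; exact hb
        min := by rw [hbt]; exact hm
        mem := hmt.trans hmem
        frame := fun r hr h₁ h₂ => (hrt r fun j hj => hr j (by omega)).trans (hf r hr h₁ h₂) }
  refine Wp.seq (Wp.branch (fun hne => wp_code ?_) (fun heq => wp_code ?_))
  · have hle := hres.1 hne
    have hB := π.le_B' (x := k) (by omega)
    have hp := h₁.core.peak
    have hj := h₁.counter
    refine hkey _ ?_ ?_ ?_ ?_ ?_ h₁.mem ?_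
    · refine (h₁.core.congr (t := (runList I [.move best j] s₁.tick).tick.set junk 0) (c := 3)
        ⟨by simp [hj]; omega, h₁.core.space, h₁.core.lazyRead⟩
        (fun j hj => ?_) (fun _ _ => ⟨rfl, rfl⟩) rfl (by simp; omega) (by simp)).mono
        (δ' := 200) (by norm_num)
      simp only [List.mem_cons, List.not_mem_nil, or_false] at hj
      rcases hj with rfl | rfl | rfl | rfl <;> simp
    · simpa using h₁.vertex
    · simpa using hj
    · intro _
      simp [hj]
      omega
    · intro i hi hid
      simp only [runList_cons, runList_nil, Instr.apply, Config.set, Config.tick]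
      simp [hj]
      rcases hi.lt_or_eq with hlt | rfl
      · exact hle.trans (h₁.min i hlt hid)
      · exact le_rfl
    · intro r hr hr₁ hr₂
      simpa [hr, hr₁, hr₂] using h₁.frame r hr hr₁ hr₂
  · have hlt : I.lists.key w x (s₁.reg best) ≤ I.lists.key w x k := by
      by_contra hn
      exact hres.2 (not_le.1 hn).le heq
    refine hkey _ ?_ ?_ ?_ ?_ ?_ h₁.mem ?_
    · refine (h₁.core.congr (t := (runList I [] s₁.tick).tick.set junk 0) (c := 2)
        ⟨by simpa using h₁.core.peak, h₁.core.space, h₁.core.lazyRead⟩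
        (fun j hj => ?_) (fun _ _ => ⟨rfl, rfl⟩) rfl (by simp; omega) (by simp)).mono
        (δ' := 200) (by norm_num)
      simp only [List.mem_cons, List.not_mem_nil, or_false] at hj
      rcases hj with rfl | rfl | rfl | rfl <;> simp
    · simpa using h₁.vertex
    · simpa using h₁.counter
    · simpa using h₁.best_lt
    · intro i hi hid
      simp
      rcases hi.lt_or_eq with h' | rfl
      · exact h₁.min i h' hid
      · exact hlt
    · intro r hr hr₁ hr₂
      simpa [hr, hr₁, hr₂] using h₁.frame r hr hr₁ hr₂

/-- The invariant of the first part of the enumeration: the vertices in `S` have chosen their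
neighbors, as given by `m`, and `c` entries of the list `L` of vertices of small degree are left. -/
structure Choosing (A : AdjLists n) (π : Params) (w : Sym2 (Fin n) → ℝ) (q : ℕ) (L : List ℕ)
    (S : List ℕ) (m : ℕ → ℕ) (Q : List (ℕ × ℕ)) (φ δ c : ℕ) (s : Config) : Prop where
  core : Core π q Q φ δ s
  counter : s.reg i = c
  mem0 : ∀ u < n, s.mem (cell 0 u) = some (m u)
  light : ∀ i u, L[i]? = some u → s.mem (cell 4 i) = some u
  chosen : Chosen A w S m Q
  clean : ∀ k, 0 < k → k < 4 → ∀ a, s.reg (cell k a) = 0 ∧ s.mem (cell k a) = none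

variable {L S : List ℕ} {m : ℕ → ℕ}

theorem Choosing.quiet (h : Choosing I.lists π w q L S m Q φ δ c s) {c' : ℕ} (hq : Quiet c' s t)
    (ht : Within π t) : Choosing I.lists π w q L S m Q φ (δ + c') c t :=
  { core := h.core.quiet hq ht
    counter := (hq.reg _ fun j _ _ => by simp; omega).trans h.counter
    mem0 := by rw [hq.mem]; exact h.mem0
    light := by rw [hq.mem]; exact h.light
    chosen := h.chosen
    clean := fun k h₁ h₂ a => by
      rw [hq.mem, hq.reg _ fun j _ _ => cell_ne_volatile h₁ (h₂.trans (by norm_num)) j]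
      exact h.clean k h₁ h₂ a }

theorem Choosing.next (hn : π.n = n) (hx : L[c]? = some x) (hxn : x < n)
    (hd : I.lists.degree x ≤ π.X) (hc : c < n)
    (h : Choosing I.lists π w q L S m Q φ δ (c + 1) s) :
    Wp I nextVertex (fun t => Choosing I.lists π w q L S m Q φ (δ + 10) c t ∧ t.reg v = x ∧
      t.reg best = 0 ∧ t.reg j = I.lists.degree x) s := by
  have hcnt := h.counter
  have hmem := h.light _ _ hx
  have hp := h.core.peak
  have hs := h.core.space
  have hX := π.le_X
  have hB₁ := π.le_B' (x := c) (by omega)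
  have hB₂ := π.le_B' hd
  have hB₃ := π.le_B' (x := x) (by omega)
  have hB₅ := π.cell_le' (k := 4) (a := c) (by norm_num) (by omega)
  have hS₁ := π.cell_lt (k := 4) (i := c) (by norm_num) (by omega)
  have hB := π.le_B
  have hXX := Nat.zero_le (π.X * π.X)
  refine wp_code ?_
  simp only [runList_append, runList_cons, runList_nil]
  rw [runList_ld (by simp)]
  simp [hcnt, hmem]
  exact
    { core := (h.core.congr (c := 10) ⟨by simp only [max_le_iff]; omega,
          by simp only [max_le_iff]; omega, h.core.lazyRead⟩
        (fun j hj => by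
          simp only [List.mem_cons, List.not_mem_nil, or_false] at hj
          rcases hj with rfl | rfl | rfl | rfl <;> simp)
        (fun _ _ => ⟨rfl, rfl⟩) rfl (by simp only; omega) le_rfl)
      counter := by simp
      mem0 := h.mem0
      light := h.light
      chosen := h.chosen
      clean := fun k h₁ h₂ a => by
        have h0 : ¬ k = 0 := h₁.ne'
        have h8 : k < 8 := h₂.trans (by norm_num)
        simpa [Function.update_apply, h0, h8] using h.clean k h₁ h₂ a }

end

section

variable {n : ℕ} {I : Input n} {π : Params} {w : Sym2 (Fin n) → ℝ} {q φ : ℕ}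
  {Q : List (ℕ × ℕ)} {x y k c δ : ℕ} {s₀ s t : Config} {L S : List ℕ} {m : ℕ → ℕ}

theorem Choosing.record (hxn : x < n) (hn : π.n = n) (hv : s.reg v = x)
    (hy : I.lists.nbr x (s.reg best) = y)
    (h : Choosing I.lists π w q L S m Q φ δ c s) :
    Wp I record (fun t => Core π q Q φ (δ + 8) t ∧ t.reg a0 = x ∧ t.reg a1 = y ∧ t.reg i = c ∧
      t.mem = Function.update s.mem (cell 0 x) (some y) ∧
      ∀ k, 0 < k → k < 4 → ∀ a, t.reg (cell k a) = s.reg (cell k a)) s := by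
  have hyn : y < n := hy ▸ I.lists.nbr_lt (hn ▸ π.n_pos) _ _
  have hp := h.core.peak
  have hs := h.core.space
  have hX := π.le_X
  have hB₁ := π.le_B' (x := y) (by omega)
  have hB₃ := π.le_B' (x := x) (by omega)
  have hB₅ := π.cell_le' (k := 0) (a := x) (by norm_num) (by omega)
  have hS₁ := π.cell_lt (k := 0) (i := x) (by norm_num) (by omega)
  have hB := π.le_B
  have hXX := Nat.zero_le (π.X * π.X)
  have hi := h.counter
  have hz := h.core.lazyRead
  refine wp_code ?_
  simp only [runList_append, runList_cons, runList_nil]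
  rw [runList_st (by simp) (by simp) (by simp)]
  simp [hv, hy]
  refine ⟨?_, hi, fun k h₁ h₂ a => ?_⟩
  · refine h.core.congr ⟨?_, ?_, hz⟩ (fun j hj => ?_) (fun i _ => ?_) rfl ?_ ?_
    · simp only [max_le_iff]; omega
    · simp only [max_le_iff]; omega
    · simp only [List.mem_cons, List.not_mem_nil, or_false] at hj
      rcases hj with rfl | rfl | rfl | rfl <;> simp
    · simp
    · simp only; omega
    · simp only; omega
  · have h0 : ¬ k = 0 := h₁.ne'
    have h8 : k < 8 := h₂.trans (by norm_num)
    simp [h0, h8]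

theorem Choosing.choose (hn : π.n = n) (hxn : x < n) (hxS : x ∉ S) (hS : S.length < n)
    (hv : s.reg v = x) (hch : Choice I.lists w x (I.lists.nbr x (s.reg best)))
    (h : Choosing I.lists π w q L S m Q φ δ c s) :
    Wp I EnumMST.choose (fun t => ∃ m' Q', Q.length ≤ Q'.length ∧
      Choosing I.lists π w q L (x :: S) m' Q' φ (δ + 40) c t) s := by
  obtain ⟨y, hy⟩ : ∃ y, I.lists.nbr x (s.reg best) = y := ⟨_, rfl⟩
  have hyn : y < n := hy ▸ I.lists.nbr_lt (hn ▸ π.n_pos) _ _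
  rw [hy] at hch
  have hlen := h.chosen.length_le
  set m' := Function.update m x y with hm'
  refine Wp.seq ((h.record hxn hn hv hy).mono ?_)
  rintro s₁ - ⟨hc₁, hr0, hr1, hi₁, hm₁, hreg₁⟩
  have hmem0 : ∀ u < n, s₁.mem (cell 0 u) = some (m' u) := by
    intro u hu
    by_cases hux : u = x
    · simp [hm₁, hm', hux]
    · simp [hm₁, hm', hux, h.mem0 u hu]
  have hlight : ∀ i u, L[i]? = some u → s₁.mem (cell 4 i) = some u := by
    intro i u hu
    simpa [hm₁, Function.update_apply] using h.light i u hu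
  have hclean : ∀ k, 0 < k → k < 4 → ∀ a, s₁.reg (cell k a) = 0 ∧ s₁.mem (cell k a) = none := by
    intro k h₁ h₂ a
    have h0 : ¬ k = 0 := h₁.ne'
    have h8 : k < 8 := h₂.trans (by norm_num)
    rw [hreg₁ k h₁ h₂]
    simpa [hm₁, Function.update_apply, h0, h8] using h.clean k h₁ h₂ a
  have hm'y : m' y ≤ n := by
    by_cases hyx : y = x
    · simp [hm', hyx, hxn.le]
    · simpa [hm', Function.update_apply, hyx] using h.chosen.le hyn
  refine Wp.seq ((wp_checkChosen (I := I) (Or.inr ⟨rfl, rfl⟩) (hr1 ▸ hn ▸ hyn)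
    (hr1 ▸ hmem0 y hyn) (by rw [hr1, hn]; exact hm'y) hc₁.toWithin).mono ?_)
  rintro s₂ - ⟨hq, hw₂, hf, h0, h1⟩
  rw [hr0] at hf h0
  rw [hr1] at hf h1
  have hc₂ := (hc₁.quiet hq hw₂).tick
  have hreg₂ : ∀ k, 0 < k → k < 4 → ∀ a, s₂.reg (cell k a) = s₁.reg (cell k a) :=
    fun k h₁ h₂ a => hq.reg _ fun j _ _ => cell_ne_volatile h₁ (h₂.trans (by norm_num)) j
  have hi₂ : s₂.reg i = c := (hq.reg _ fun j _ _ => by simp; omega).trans hi₁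
  have hold : m' y = x → Choosing I.lists π w q L (x :: S) m' Q φ (δ + 16) c s₂.tick := fun hmy =>
    { core := hc₂
      counter := hi₂
      mem0 := hq.mem.symm ▸ hmem0
      light := hq.mem.symm ▸ hlight
      chosen := h.chosen.cons_old hxS hxn hyn hch hmy
      clean := fun k h₁ h₂ a =>
        ⟨(hreg₂ k h₁ h₂ a).trans (hclean k h₁ h₂ a).1, hq.mem.symm ▸ (hclean k h₁ h₂ a).2⟩ }
  refine Wp.branch (fun hne => ?_) (fun heq => ?_)
  · have hmy : m' y = x := by
      by_contra hn
      exact hne (by rw [hf, if_neg hn])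
    refine wp_code ⟨m', Q, le_rfl, ?_⟩
    have h₃ := (hold hmy).quiet (t := (runList I [] s₂.tick).tick.set junk 0) (c' := 1)
      (by refine ⟨rfl, rfl, fun r hr => by simp [hr], ?_, ?_⟩ <;> simp)
      ⟨by simpa using hw₂.peak, hw₂.space, hw₂.lazyRead⟩
    exact { h₃ with core := h₃.core.mono (by omega) }
  · have hmy : m' y ≠ x := fun h => by simp [hf, h] at heq
    have h0' : s₂.tick.reg a0 = x := h0
    have h1' : s₂.tick.reg a1 = y := h1
    refine (hc₂.enqueue (I := I) (by omega) (by omega) (by omega)).mono ?_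
    rintro t - ⟨hct, hmt, hrt⟩
    rw [h0', h1'] at hct
    refine ⟨m', Q ++ [(x, y)], by simp, ?_⟩
    have hmt' : ∀ k < 5, ∀ a, t.mem (cell k a) = s₁.mem (cell k a) := by
      intro k hk a
      rw [← hq.mem]
      refine hmt _ fun i => ?_
      have h5 : ¬ k = 5 := by omega
      have h6 : ¬ k = 6 := by omega
      have h8 : k < 8 := by omega
      simp [h5, h6, h8]
    exact
      { core := hct.mono (by omega)
        counter := (hrt _ fun j _ => by simp; omega).trans hi₂
        mem0 := fun u hu => (hmt' 0 (by norm_num) u).trans (hmem0 u hu)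
        light := fun i u hu => (hmt' 4 (by norm_num) i).trans (hlight i u hu)
        chosen := h.chosen.cons_new hxS hxn hyn hch hmy
        clean := fun k h₁ h₂ a =>
          ⟨((hrt _ fun j _ => cell_ne_volatile h₁ (h₂.trans (by norm_num)) j).trans
            (hreg₂ k h₁ h₂ a)).trans (hclean k h₁ h₂ a).1,
            (hmt' k (by omega) a).trans (hclean k h₁ h₂ a).2⟩ }

/-- One vertex chooses its neighbor. -/
theorem Choosing.step {b K : ℕ} (hw : ∀ e f, w e ≤ w f ↔ TieLe I.weight e f) (hn : π.n = n)
    (hA : I.lists.graph.Connected) (hL : L.Nodup) (hLn : ∀ u ∈ L, u < n)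
    (hLd : ∀ u ∈ L, I.lists.degree u ≤ 2 * b) (hX : I.lists.degSum 0 ≤ π.X) (hb : 0 < b)
    (hq : q = K * b) (hK : 7 ≤ K) (hD : 200 * q + 300 ≤ π.D) (c : ℕ) (hc : c + 1 ≤ L.length)
    (hφ : φ ≤ (L.length - (c + 1)) * (3 * b))
    (h : Choosing I.lists π w q L (L.drop (c + 1)) m Q φ 100 (c + 1) s) :
    Wp I chooseNext
      (fun t => ∃ m' Q' φ', φ' ≤ (L.length - c) * (3 * b) ∧
        Choosing I.lists π w q L (L.drop c) m' Q' φ' 100 c t) s.tick := by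
  have hclt : c < L.length := hc
  have hxL : L[c]? = some L[c] := List.getElem?_eq_getElem hclt
  set x := L[c] with hx
  have hxmem : x ∈ L := List.getElem_mem hclt
  have hxn := hLn x hxmem
  have hxd := hLd x hxmem
  have hdX : I.lists.degree x ≤ π.X := (I.lists.degree_le_degSum hxn).trans hX
  have hLlen := length_le_of_forall_lt hL hLn
  have hdrop : L.drop c = x :: L.drop (c + 1) := List.drop_eq_getElem_cons hclt
  have hnd : (x :: L.drop (c + 1)).Nodup := hdrop ▸ hL.sublist (List.drop_sublist c L)
  have hSlen : (L.drop (c + 1)).length = L.length - (c + 1) := List.length_drop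
  have hcount := h.chosen.length_le_two_mul (List.nodup_cons.1 hnd).2 hA
  -- the queue is long enough for the ticks up to the end of this iteration
  have htick : φ + I.lists.degree x + 1 < (Q.length + 1) * q := by
    have h₁ : (L.length - (c + 1)) * (3 * b) ≤ (2 * Q.length + 1) * (3 * b) :=
      Nat.mul_le_mul_right _ (hSlen ▸ hcount)
    have h₂ : (Q.length + 1) * (7 * b) ≤ (Q.length + 1) * q :=
      Nat.mul_le_mul_left _ (hq ▸ Nat.mul_le_mul_right _ hK)
    have h₃ : 0 ≤ Q.length * b := Nat.zero_le _
    nlinarith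
  have htick' : φ + I.lists.degree x + 1 ≤ (L.length - c) * (3 * b) := by
    have h₁ : (L.length - c) * (3 * b) = (L.length - (c + 1)) * (3 * b) + 3 * b := by
      rw [show L.length - c = L.length - (c + 1) + 1 by omega, add_mul, one_mul]
    omega
  have h₀ := h.quiet (.of_tick s) h.core.toWithin.tick
  refine Wp.seq ((h₀.next hn hxL hxn hdX (by omega)).mono ?_)
  rintro s₁ - ⟨h₁, hv, hbest, hj⟩
  refine Wp.seq ?_
  have hscan : Scan I.lists π w q Q φ 120 x (I.lists.degree x) (I.lists.degree x) s₁ s₁ :=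
    { core := by
        rw [Nat.sub_self, add_zero]
        exact h₁.core.mono (by norm_num)
      le := le_rfl
      vertex := hv
      counter := hj
      best_lt := fun h => hbest ▸ h
      min := fun i h₁ h₂ => by omega
      mem := rfl
      frame := fun _ _ _ _ => rfl }
  refine Wp.loop_down (J := fun k s => Scan I.lists π w q Q φ 120 x k k s₁ s)
    (fun k s h => h.counter) (fun k s h => h.step hw hn hxn hdX hD (Nat.lt_of_succ_lt htick)) _
    (fun s₂ h₂ => ?_) _ hscan
  have hframe : ∀ k, 0 < k → k < 4 → ∀ a, s₂.reg (cell k a) = s₁.reg (cell k a) := by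
    intro k h₁ h₃ a
    have h0 : ¬ k = 0 := h₁.ne'
    have h8 : k < 8 := h₃.trans (by norm_num)
    exact h₂.frame _ (fun j _ => cell_ne_volatile h₁ (h₃.trans (by norm_num)) j)
      (by simp [h0, h8]) (by simp [h0, h8])
  have h₃ : Choosing I.lists π w q L (L.drop (c + 1)) m Q (φ + I.lists.degree x) 120 c s₂ :=
    { core := h₂.core
      counter := (h₂.frame _ (fun j _ => by simp; omega) (by simp) (by simp)).trans h₁.counter
      mem0 := h₂.mem ▸ h₁.mem0
      light := h₂.mem ▸ h₁.light
      chosen := h₁.chosen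
      clean := fun k h₄ h₅ a => by
        rw [hframe k h₄ h₅, h₂.mem]
        exact h₁.clean k h₄ h₅ a }
  have h₄ := h₃.quiet (.of_tick s₂) h₃.core.toWithin.tick
  have hchoice : Choice I.lists w x (I.lists.nbr x (s₂.tick.reg best)) :=
    choice_nbr hxn h₂.best_lt fun i hi => h₂.min i (Nat.zero_le _) hi
  refine Wp.seq ((Choosing.choose (s := s₂.tick) hn hxn (List.nodup_cons.1 hnd).1 (by omega)
    h₂.vertex hchoice h₄).mono ?_)
  rintro s₃ - ⟨m', Q', hQ', h₅⟩
  have htick₃ : φ + I.lists.degree x + 1 < (Q'.length + 1) * q :=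
    htick.trans_le (Nat.mul_le_mul_right _ (by omega))
  refine (h₅.core.tickCode htick₃ (by norm_num) hD).mono ?_
  rintro t - ⟨ht, hmt, hrt⟩
  refine ⟨m', Q', _, htick', ?_⟩
  rw [hdrop]
  exact
    { core := ht
      counter := (hrt _ fun j _ => by simp; omega).trans h₅.counter
      mem0 := hmt ▸ h₅.mem0
      light := hmt ▸ h₅.light
      chosen := h₅.chosen
      clean := fun k h₆ h₇ a => by
        rw [hmt, hrt _ fun j _ => cell_ne_volatile h₆ (h₇.trans (by norm_num)) j]
        exact h₅.clean k h₆ h₇ a }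

/-- In the first part, the queue never runs empty: among the vertices that have chosen, at most two
have chosen the same edge, so that the queue grows by one edge for at most `6 * b` ticks. -/
theorem wp_chooseAll {b K : ℕ} (hw : ∀ e f, w e ≤ w f ↔ TieLe I.weight e f) (hn : π.n = n)
    (hA : I.lists.graph.Connected) (hL : L.Nodup) (hLn : ∀ u ∈ L, u < n)
    (hLd : ∀ u ∈ L, I.lists.degree u ≤ 2 * b) (hX : I.lists.degSum 0 ≤ π.X) (hb : 0 < b)
    (hq : q = K * b) (hK : 7 ≤ K) (hD : 200 * q + 300 ≤ π.D)
    (hlen : s.reg len = L.length)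
    (h : Choosing I.lists π w q L [] (fun _ => n) [] 0 10 c s) :
    Wp I chooseAll (fun t => ∃ m Q φ, φ ≤ L.length * (3 * b) ∧
      Choosing I.lists π w q L L m Q φ 101 0 t) s := by
  have hLlen := length_le_of_forall_lt hL hLn
  have hX' := π.le_X
  have hB := π.le_B' (x := L.length) (by omega)
  have hp := h.core.peak
  refine Wp.seq (wp_code ?_)
  simp [hlen]
  refine Wp.loop_down (J := fun c s => c ≤ L.length ∧ ∃ m Q φ, φ ≤ (L.length - c) * (3 * b) ∧
      Choosing I.lists π w q L (L.drop c) m Q φ 100 c s)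
    (fun c s h => h.2.choose_spec.choose_spec.choose_spec.2.counter) ?_ _ ?_ L.length ?_
  · rintro c s ⟨hc, m, Q, φ, hφ, h⟩
    refine (Choosing.step hw hn hA hL hLn hLd hX hb hq hK hD c hc hφ h).mono ?_
    rintro t - ht
    exact ⟨by omega, ht⟩
  · rintro s ⟨-, m, Q, φ, hφ, h⟩
    exact ⟨m, Q, φ, hφ, h.quiet (.of_tick s) h.core.toWithin.tick⟩
  · refine ⟨le_rfl, fun _ => n, [], 0, by simp, ?_⟩
    rw [List.drop_length]
    exact
      { core := by
          refine Core.mono (δ := 10 + 2) ?_ (by norm_num)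
          exact h.core.congr ⟨by simp only [max_le_iff]; omega, h.core.space, h.core.lazyRead⟩
            (fun j hj => by
              simp only [List.mem_cons, List.not_mem_nil, or_false] at hj
              rcases hj with rfl | rfl | rfl | rfl <;> simp)
            (fun _ _ => ⟨rfl, rfl⟩) rfl (by simp only; omega) le_rfl
        counter := by simp
        mem0 := h.mem0
        light := h.light
        chosen := h.chosen
        clean := fun k h₁ h₂ a => by
          have h0 : ¬ k = 0 := h₁.ne'
          have h8 : k < 8 := h₂.trans (by norm_num)
          simpa [Function.update_apply, h0, h8] using h.clean k h₁ h₂ a }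

end

/-! ### The second part of the enumeration -/

/-- Increase the quota by `16 * (T / n + 1)`, where `T` has been computed by the emulated program
of class `3`. -/
def raiseQuota : Prog :=
  code [.order num, .op .div x1 (cell 3 0) num, .const t0 1, .op .add x1 x1 t0, .const t0 16,
    .op .mul x1 x1 t0, .op .add quota quota x1]

/-- Emit the edges that are left in the queue. -/
def flush : Prog :=
  .seq (code [.op .sub i tail head])
    (.loop i (.seq emitNext (code [.op .sub i tail head])))

section

variable {n : ℕ} {I : Input n} {π : Params} {q φ δ : ℕ} {Q : List (ℕ × ℕ)} {s : Config}

/-- When the quota changes, the number `φ` of ticks is adjusted as if the new quota had been in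
force from the start. -/
theorem Core.raiseQuota {T : ℕ} (hn : π.n = n) (hT : s.reg (cell 3 0) = T)
    (hq : q + 16 * (T / n + 1) ≤ π.B) (h : Core π q Q φ δ s) :
    Wp I raiseQuota (fun t => Core π (q + 16 * (T / n + 1)) Q
      (s.reg Reg.head * (q + 16 * (T / n + 1)) + s.reg Reg.cnt) (δ + 8) t ∧ t.mem = s.mem ∧
      ∀ k, 0 < k → k < 8 → ∀ r, t.reg (cell k r) = s.reg (cell k r)) s := by
  have hp := h.peak
  have hX := π.le_X
  have hB := π.le_B
  have hXX := Nat.zero_le (π.X * π.X)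
  have hdiv : T / n ≤ T := Nat.div_le_self _ _
  have hquota := h.quota
  refine wp_code ?_
  simp [hT, hquota, mul_comm _ 16]
  refine ⟨?_, fun k hk hk' r => ?_⟩
  · exact
      { peak := by simp only [max_le_iff]; omega
        space := h.space
        lazyRead := h.lazyRead
        tail := by simpa [Function.update_apply] using h.tail
        quota := by simp
        quota_le := hq
        clock := by simp
        cnt_lt := by
          have := h.cnt_lt
          simp
          omega
        head_le := by simpa [Function.update_apply] using h.head_le
        length_le := h.length_le
        entries := h.entries
        queue := h.queue
        out := by simpa [Function.update_apply] using h.out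
        chain := h.chain
        last_le := h.last_le.trans (by simp only; omega)
        recent := by
          have := h.recent
          simp [lastTime] at this ⊢
          omega }
  · have h0 : ¬ k = 0 := hk.ne'
    simp [h0, hk']

theorem Core.flush (hq : 200 * q + 300 ≤ π.D) (hδ : δ ≤ 100) (h : Core π q Q φ δ s) :
    Wp I flush (fun t => ∃ φ', Core π q Q φ' 200 t ∧ t.reg Reg.head = Q.length) s := by
  have hX := π.le_X
  have hB := π.le_B
  have hXX := Nat.zero_le (π.X * π.X)
  -- the loop counter is the number of edges that are left
  have hsub : ∀ {φ δ : ℕ} {s : Config}, Core π q Q φ δ s → δ ≤ 100 →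
      Wp I (code [.op .sub Reg.i Reg.tail Reg.head]) (fun t => (∃ φ', Core π q Q φ' 110 t) ∧
        t.reg Reg.head + t.reg i = Q.length ∧ t.reg Reg.head = s.reg Reg.head) s := by
    intro φ δ s h hδ
    have htail := h.tail
    have hhead := h.head_le
    have hl := h.length_le
    have hp := h.peak
    refine wp_code ?_
    simp [htail]
    refine ⟨⟨φ, ?_⟩, by omega⟩
    refine Core.mono (δ := δ + 2) ?_ (by omega)
    refine h.congr ⟨by simp only [max_le_iff]; omega, h.space, h.lazyRead⟩
      (fun j hj => ?_) (fun _ _ => ⟨rfl, rfl⟩) rfl (by simp only; omega) le_rfl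
    simp only [List.mem_cons, List.not_mem_nil, or_false] at hj
    rcases hj with rfl | rfl | rfl | rfl <;> simp
  refine Wp.seq ((hsub h hδ).mono fun t _ ht => ?_)
  refine Wp.loop_down (J := fun k s => s.reg i = k ∧ (∃ φ', Core π q Q φ' 110 s) ∧
      s.reg Reg.head + k = Q.length) (fun _ _ h => h.1) ?_ _ ?_ (t.reg i) ⟨rfl, ht.1, ht.2.1⟩
  · rintro k s ⟨-, ⟨φ', h⟩, hk⟩
    have hcnt := h.cnt_lt
    refine Wp.seq ((h.tick.emitNext (by simp; omega) (by omega) (by simp; omega)).mono ?_)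
    rintro t - ⟨h', -, hh, -⟩
    refine (hsub h' (by norm_num)).mono ?_
    rintro r - ⟨hr, hlen, hhr⟩
    simp at hh
    exact ⟨by omega, hr, by omega⟩
  · rintro s ⟨-, ⟨φ', h⟩, hk⟩
    exact ⟨φ', h.tick.mono (by norm_num), hk⟩

/-- The enumeration is ready to emulate programs on the registers and memory cells of the classes
`1, …, k`. -/
structure Ready (π : Params) (k : ℕ) (m : ℕ → ℕ) (q : ℕ) (Q : List (ℕ × ℕ)) (φ δ : ℕ)
    (s : Config) : Prop where
  core : Core π q Q φ δ s
  mem0 : ∀ u < π.n, s.mem (cell 0 u) = some (m u)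
  clean : ∀ l, 0 < l → l ≤ k → ∀ a, s.reg (cell l a) = 0 ∧ s.mem (cell l a) = none

/-- Emulate a program on the registers and memory cells of class `k + 1`. -/
theorem Ready.emul {k : ℕ} {tie : Bool} {m : ℕ → ℕ} {w : Sym2 (Fin n) → ℝ} {P : Prog} {e : Config}
    (hk : k < 3) (hm : ∀ u < π.n, m u ≤ π.n) (hQ : Q.length ≤ π.n) (hD : 200 * q + 300 ≤ π.D)
    (hn : π.n = n) (hw : tie = true → ∀ e f, w e ≤ w f ↔ TieLe I.weight e f)
    (hw' : tie = false → w = I.weight) (hP : Run P ⟨I.lists, w⟩ e) (hpeak : e.peak ≤ π.X)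
    (hspace : 8 * e.space ≤ π.Sp) (hlazy : e.lazyRead = true → π.Z)
    (hout : tie = true → ∀ x ∈ e.out, x.fst < π.n ∧ x.snd < π.n)
    (hlen : tie = true → e.out.length ≤ π.n)
    (htime : φ + e.time < (Q.length + 1) * q) (h : Ready π (k + 1) m q Q φ 130 s) :
    Wp I (emul (k + 1) tie P) (fun t =>
      Ready π k m q (Q ++ pending tie m e.out) (φ + e.time) 100 t ∧
      (∀ r, t.reg (cell (k + 1) r) = e.reg r) ∧ e.space ≤ t.space) s := by
  let ε : Emu π := ⟨k + 1, tie, m, Q, q, φ, s, by omega, by omega, h.mem0, hm, hQ, hD⟩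
  have hstart : Rel ε (ε.φ + Config.start.time) 130 Config.start s :=
    { toCore := by
        show Core π q (Q ++ pending tie m []) φ 130 s
        have : pending tie m [] = [] := by unfold pending; split_ifs <;> rfl
        rw [this, List.append_nil]
        exact h.core
      reg := fun r => (h.clean _ (Nat.succ_pos k) le_rfl r).1
      mem := fun a => (h.clean _ (Nat.succ_pos k) le_rfl a).2
      le_space := Nat.zero_le _
      frame_reg := fun _ _ _ _ => rfl
      frame_mem := fun _ _ _ _ => rfl }
  have hgood : Good ε e := ⟨hpeak, hspace, hlazy, hout, hlen, htime⟩
  refine (exec_emul hn hw hw' hP Config.bounded_start hgood hstart).mono ?_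
  intro t _ ht
  refine ⟨⟨ht.toCore, fun u hu => ?_, fun l hl hlk a => ?_⟩, ht.reg, ht.le_space⟩
  · exact (ht.frame_mem 0 (by norm_num) (by simp [ε]) u).trans (h.mem0 u hu)
  · have h₁ : l ≠ k + 1 := by omega
    rw [ht.frame_reg l (by omega) (by simp [ε, h₁]; omega),
      ht.frame_mem l (by omega) (by simp [ε, h₁]; omega)]
    exact h.clean l hl (by omega) a

end

/-! ### The enumerated edges form a minimum spanning tree -/

section

variable {n : ℕ} {A : AdjLists n} {w w' : Sym2 (Fin n) → ℝ}

/-- A minimum spanning tree for the perturbed weights is one for the original weights. -/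
theorem IsMST.of_perturbation {E : Finset (Sym2 (Fin n))} (hE : IsMST ⟨A, w'⟩ E)
    (hw : ∀ E F : Finset (Sym2 (Fin n)), ∑ e ∈ E, w e < ∑ e ∈ F, w e →
      ∑ e ∈ E, w' e < ∑ e ∈ F, w' e) : IsMST ⟨A, w⟩ E :=
  ⟨hE.1, fun E' hE' => not_lt.1 fun h => (hw E' E h).not_ge (hE.2 E' hE')⟩

/-- A vertex chooses an edge of the minimum spanning tree. -/
theorem Choice.mem {E : Finset (Sym2 (Fin n))} (hE : IsMST ⟨A, w'⟩ E) (hA : A.graph.Connected)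
    (hw : ∀ e f, w' e ≤ w' f ↔ TieLe w e f) {u x : ℕ} (hu : u < n) (hx : x < n) (hux : u ≠ x)
    (h : Choice A w' u x) : s(⟨u, hu⟩, ⟨x, hx⟩) ∈ E := by
  rcases h with ⟨h0, -⟩ | ⟨_, _, hadj, hmin⟩
  · have : Nontrivial (Fin n) := ⟨⟨u, hu⟩, ⟨x, hx⟩, by simpa using hux⟩
    obtain ⟨y, hy⟩ := hA.preconnected.exists_adj_of_nontrivial ⟨u, hu⟩
    obtain ⟨i, hi, -⟩ := A.exists_index hy
    simp only at hi
    omega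
  · refine hE.mem_of_minimal hadj fun y hy hle => ?_
    have := tieLe_antisymm ((hw _ _).1 hle) ((hw _ _).1 (hmin y hy))
    exact Sym2.congr_right.1 this

/-- The queue contains the edges that have been chosen and the other edges of the minimum spanning
tree that the emulated program has emitted. -/
theorem Chosen.exists_list {L : List ℕ} {m : ℕ → ℕ} {Q : List (ℕ × ℕ)} {e : Config}
    (h : Chosen A w' L m Q) (hA : A.graph.Connected) (hw : ∀ e f, w' e ≤ w' f ↔ TieLe w e f)
    {F : List (Sym2 (Fin n))} (hF : F.Nodup) (hmst : IsMST ⟨A, w'⟩ F.toFinset)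
    (hout : e.out.map (fun e => s(e.fst, e.snd)) = F.map (Sym2.map (fun v : Fin n => (v : ℕ)))) :
    ∃ F' : List (Sym2 (Fin n)), F'.Nodup ∧ F'.toFinset = F.toFinset ∧
      (Q ++ pending true m e.out).map (fun e => s(e.1, e.2)) =
        F'.map (Sym2.map (fun v : Fin n => (v : ℕ))) := by
  have hinj : Function.Injective (Sym2.map (fun v : Fin n => (v : ℕ))) :=
    Sym2.map.injective Fin.val_injective
  have hmem : ∀ {u x : ℕ}, (⟨u, x⟩ : ℕ × ℕ) ∈ e.out.map (fun e => (e.fst, e.snd)) →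
      s(u, x) ∈ F.map (Sym2.map (fun v : Fin n => (v : ℕ))) := by
    intro u x hux
    rw [← hout]
    obtain ⟨y, hy, hyx⟩ := List.mem_map.1 hux
    simp only [Prod.mk.injEq] at hyx
    exact List.mem_map.2 ⟨y, hy, by rw [hyx.1, hyx.2]⟩
  have hpend : ∀ {u x : ℕ}, (u, x) ∈ pending true m e.out ↔
      (u, x) ∈ e.out.map (fun e => (e.fst, e.snd)) ∧ m u ≠ x ∧ m x ≠ u := by
    intro u x
    simp only [pending, if_true, List.mem_filter, decide_eq_true_eq]
  have hnodup : ((Q ++ pending true m e.out).map fun e => s(e.1, e.2)).Nodup := by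
    rw [List.map_append]
    refine List.Nodup.append h.nodup ?_ ?_
    · have : ((pending true m e.out).map fun e => s(e.1, e.2)).Sublist
          (F.map (Sym2.map (fun v : Fin n => (v : ℕ)))) := by
        rw [← hout]
        simp only [pending, if_true]
        refine (List.filter_sublist.map _).trans ?_
        rw [List.map_map]
        exact List.Sublist.refl _
      exact (hF.map hinj).sublist this
    · intro x hx hx'
      obtain ⟨⟨u, y⟩, hQ, rfl⟩ := List.mem_map.1 hx
      obtain ⟨⟨u', y'⟩, hP, hs⟩ := List.mem_map.1 hx'
      obtain ⟨-, hmu, -⟩ := h.queue _ hQ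
      obtain ⟨-, h₁, h₂⟩ := hpend.1 hP
      simp only at hmu hs
      rcases Sym2.eq_iff.1 hs with ⟨rfl, rfl⟩ | ⟨rfl, rfl⟩
      · exact h₁ hmu
      · exact h₂ hmu
  have hiff : ∀ x, x ∈ (Q ++ pending true m e.out).map (fun e => s(e.1, e.2)) ↔
      x ∈ F.map (Sym2.map (fun v : Fin n => (v : ℕ))) := by
    intro x
    constructor
    · intro hx
      obtain ⟨⟨u, y⟩, hQ, rfl⟩ := List.mem_map.1 hx
      rcases List.mem_append.1 hQ with hQ | hP
      · obtain ⟨hu, hmu, hne⟩ := h.queue _ hQ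
        simp only at hu hmu hne
        obtain ⟨hun, hmn, hc⟩ := h.choice u hu
        rw [hmu] at hmn hc
        have := Choice.mem hmst hA hw hun hmn hne hc
        exact List.mem_map.2 ⟨_, by simpa using this, rfl⟩
      · exact hmem (hpend.1 hP).1
    · intro hx
      obtain ⟨f, hf, hfx⟩ := List.mem_map.1 hx
      rw [← hout] at hx
      obtain ⟨z, hz, rfl⟩ := List.mem_map.1 hx
      have hadj := hmst.1.1 (by simpa using hf : f ∈ (F.toFinset : Set _))
      -- the endpoints of the edge that has been emitted are vertices, and they are distinct
      have hlt : z.fst < n ∧ z.snd < n ∧ z.fst ≠ z.snd := by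
        induction f with
        | h a b =>
          have hne : (a : ℕ) ≠ b := fun hab =>
            (SimpleGraph.mem_edgeSet _ |>.1 hadj).ne (Fin.ext hab)
          rw [Sym2.map_mk] at hfx
          rcases Sym2.eq_iff.1 hfx with ⟨h₁, h₂⟩ | ⟨h₁, h₂⟩
          · rw [← h₁, ← h₂]
            exact ⟨a.2, b.2, hne⟩
          · rw [← h₁, ← h₂]
            exact ⟨b.2, a.2, hne.symm⟩
      obtain ⟨hu, hx, hne⟩ := hlt
      have hold : ∀ u x, u < n → x < n → u ≠ x → m u = x → (u, x) ∈ Q ∨ (x, u) ∈ Q := by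
        intro u x hu hx hne hmu
        have huL : u ∈ L := by
          by_contra huL
          have := h.unset u hu huL
          omega
        have := h.covered u huL (by rw [hmu]; exact hne.symm)
        rwa [hmu] at this
      simp only [List.mem_map, List.mem_append]
      by_cases h₁ : m z.fst = z.snd
      · rcases hold _ _ hu hx hne h₁ with hQ | hQ
        · exact ⟨_, Or.inl hQ, rfl⟩
        · exact ⟨_, Or.inl hQ, Sym2.eq_swap⟩
      by_cases h₂ : m z.snd = z.fst
      · rcases hold _ _ hx hu hne.symm h₂ with hQ | hQ
        · exact ⟨_, Or.inl hQ, Sym2.eq_swap⟩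
        · exact ⟨_, Or.inl hQ, rfl⟩
      exact ⟨(z.fst, z.snd), Or.inr (hpend.2 ⟨List.mem_map.2 ⟨z, hz, rfl⟩, h₁, h₂⟩), rfl⟩
  obtain ⟨F', hF'⟩ : (Q ++ pending true m e.out).map (fun e => s(e.1, e.2)) ∈
      Set.range (List.map (Sym2.map (fun v : Fin n => (v : ℕ)))) := by
    rw [Set.range_list_map]
    intro x hx
    obtain ⟨f, -, hf⟩ := List.mem_map.1 ((hiff x).1 hx)
    exact ⟨f, hf⟩
  rw [← hF'] at hnodup hiff
  refine ⟨F', hnodup.of_map _, ?_, hF'.symm⟩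
  ext f
  simpa [hinj.eq_iff] using hiff (Sym2.map (fun v : Fin n => (v : ℕ)) f)

end

/-! ### The whole enumeration -/

/-- The enumeration after the preprocessing. After the vertices of small degree have chosen their
lightest edges, it evaluates the time bound and adjusts the quota. Then it runs the given algorithm
twice: first with the original weights, which only serves to use as much memory as this algorithm
does, then with ties broken, to obtain the edges that have not been chosen. -/
def afterPrep (box boundAlg : Prog) : Prog :=
  .seq chooseAll (.seq (emul 3 false boundAlg) (.seq raiseQuota
    (.seq (emul 2 false box) (.seq (emul 1 true box) flush))))

/-- The enumeration. The quota starts with `K` times the average degree, rounded up. -/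
def enumeration (K : ℕ) (box boundAlg : Prog) : Prog :=
  .seq (prep K) (afterPrep box boundAlg)

/-- After the quota has been raised, the queue lasts for another `2 * T` ticks. Here `Q` is the
length of the queue, `h` the number of emitted edges, `k` the number of ticks since the last
emission, and `φ` the number of all ticks so far. Since they are at most `(3 + c) * n * b`, the
first quota `8 * (3 + c) * b` has caused at most `n / 8` emissions, while `Q + 1` exceeds
`n / 4`. -/
theorem lt_mul_raised_quota {n b c Q h k T φ : ℕ} (hn₀ : 0 < n) (hb : 0 < b) (hn : n ≤ 4 * Q + 2)
    (hφ : φ ≤ (3 + c) * (n * b)) (hclock : h * (8 * (3 + c) * b) + k = φ)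
    (hk : k < 8 * (3 + c) * b) :
    h * (8 * (3 + c) * b + 16 * (T / n + 1)) + k + 2 * T <
      (Q + 1) * (8 * (3 + c) * b + 16 * (T / n + 1)) := by
  have hg : 0 < (3 + c) * b := Nat.mul_pos (by omega) hb
  generalize hgd : (3 + c) * b = g at hg
  have hT : T < n * (T / n + 1) := Nat.lt_mul_div_succ T hn₀
  generalize T / n + 1 = y at hT ⊢
  rw [show 8 * (3 + c) * b = 8 * g by rw [← hgd]; ring] at *
  rw [show (3 + c) * (n * b) = n * g by rw [← hgd]; ring] at hφ
  have h8 : 8 * h ≤ n := by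
    by_contra hlt
    have : (n + 1) * g ≤ 8 * h * g := Nat.mul_le_mul_right _ (by omega)
    nlinarith
  obtain ⟨a, ha⟩ : ∃ a, Q + 1 = h + a := ⟨Q + 1 - h, by omega⟩
  have ha₁ : 1 ≤ a := by omega
  have ha₂ : n ≤ 8 * a := by omega
  rw [ha, add_mul]
  have h₁ : n * y ≤ 8 * a * y := Nat.mul_le_mul_right _ ha₂
  have h₂ : 1 * (8 * g) ≤ a * (8 * g) := Nat.mul_le_mul_right _ ha₁
  nlinarith

section

variable {n : ℕ} {I : Input n} {π : Params} {w : Sym2 (Fin n) → ℝ} {s : Config}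

theorem AdjLists.degSum_lt (A : AdjLists n) (hn : 0 < n) :
    A.degSum 0 < n * (A.degSum 0 / n + 1) :=
  Nat.lt_mul_div_succ _ hn

/-- At the end of the preprocessing, more than half of the vertices have been collected. -/
theorem Collecting.exists_choosing {K : ℕ} (hn : π.n = n) (hp : π.p = s.tick.time) (hK : 0 < K)
    (hqB : K * (I.lists.degSum 0 / n + 1) ≤ π.B)
    (h : Collecting I.lists π.B π.Sp K 0 0 0 s) :
    ∃ (L : List ℕ) (c : ℕ), L.Nodup ∧ (∀ u ∈ L, u < n) ∧
      (∀ u ∈ L, I.lists.degree u ≤ 2 * (I.lists.degSum 0 / n + 1)) ∧ n ≤ 2 * L.length ∧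
      s.tick.reg len = L.length ∧
      Choosing I.lists π w (K * (I.lists.degSum 0 / n + 1)) L [] (fun _ => n) [] 0 10 c s.tick := by
  obtain ⟨L, hL, hmem, hlen, hlight⟩ := h.light
  have hn₀ : 0 < n := hn ▸ π.n_pos
  refine ⟨L, s.reg i, hL, fun u hu => ((hmem u).1 hu).2.1, fun u hu => ((hmem u).1 hu).2.2, ?_,
    hlen, ?_⟩
  · set b := I.lists.degSum 0 / n + 1 with hb
    have hLF : L.toFinset = (Finset.range n).filter fun u => I.lists.degree u ≤ 2 * b := by
      ext u
      simp [hmem]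
    have hcard := Finset.card_filter_add_card_filter_not (s := Finset.range n)
      (fun u => I.lists.degree u ≤ 2 * b)
    rw [← hLF, List.toFinset_card_of_nodup hL, Finset.card_range] at hcard
    set H := (Finset.range n).filter fun u => ¬ I.lists.degree u ≤ 2 * b with hH
    -- the other vertices have large degrees
    have hsum : H.card * (2 * b) ≤ I.lists.degSum 0 := by
      rw [← smul_eq_mul]
      refine (Finset.card_nsmul_le_sum H I.lists.degree _ fun u hu => ?_).trans ?_
      · have := (Finset.mem_filter.1 hu).2
        omega
      · rw [AdjLists.degSum, ← Finset.range_eq_Ico]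
        exact Finset.sum_le_sum_of_subset (Finset.filter_subset _ _)
    have hlt := I.lists.degSum_lt hn₀
    have : 2 * H.card < n := by
      refine lt_of_mul_lt_mul_right (a := b) ?_ (Nat.zero_le b)
      calc 2 * H.card * b = H.card * (2 * b) := by ring
        _ < n * b := hsum.trans_lt hlt
    omega
  · have hlast : lastTime π.p s.tick = s.tick.time := by
      have : s.tick.out = [] := h.out
      rw [lastTime, this, hp, List.map_nil, List.getLastD_nil]
    exact
      { core :=
          { peak := h.peak
            space := h.space
            lazyRead := fun hz => by
              have : s.lazyRead = true := hz
              simp [h.lazyRead] at this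
            tail := h.tail
            quota := h.quota
            quota_le := hqB
            clock := by simp [h.head, h.cnt]
            cnt_lt := by
              have := Nat.mul_pos hK (Nat.succ_pos (I.lists.degSum 0 / n))
              simpa [h.cnt] using this
            head_le := by simp [h.head]
            length_le := by simp
            entries := by simp
            queue := by simp
            out := by simp [h.out]
            chain := by simp [h.out]
            last_le := hlast.le
            recent := by rw [hlast]; omega }
        counter := rfl
        mem0 := h.mem0
        light := hlight
        chosen := chosen_nil _ _
        clean := fun k hk hk' a =>
          ⟨h.reg _ fun j => cell_ne_volatile hk (by omega) j, h.mem _ fun i => by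
            have h₀ : ¬ k = 0 := hk.ne'
            have h₄ : ¬ k = 4 := hk'.ne
            have h₈ : k < 8 := by omega
            simp [h₀, h₄, h₈]⟩ }

/-- The enumeration can afford to emulate a run that ends in `e`. -/
structure Affordable (π : Params) (e : Config) : Prop where
  peak : e.peak ≤ π.X
  space : 8 * e.space ≤ π.Sp
  lazyRead : e.lazyRead = true → π.Z

/-- The phases after the preprocessing. The hypotheses `hw`, `hmst` and `hout` say that `w` are
the perturbed weights and that the run that ends in `e₂` has found the edges `F` of the minimum
spanning tree for them. -/
theorem wp_afterPrep {box boundAlg : Prog} {b c c' : ℕ} {L : List ℕ} {e₁ e₂ e₃ : Config}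
    {F : List (Sym2 (Fin n))} (hw : ∀ e f, w e ≤ w f ↔ TieLe I.weight e f) (hn : π.n = n)
    (hA : I.lists.graph.Connected) (hL : L.Nodup) (hLn : ∀ u ∈ L, u < n)
    (hLd : ∀ u ∈ L, I.lists.degree u ≤ 2 * b) (hLlen : n ≤ 2 * L.length) (hb : 0 < b)
    (hX : I.lists.degSum 0 ≤ π.X) (hlen : s.reg len = L.length)
    (hrun₁ : Run box I e₁) (hrun₂ : Run box ⟨I.lists, w⟩ e₂) (hrun₃ : Run boundAlg I e₃)
    (hs₁ : Affordable π e₁) (hs₂ : Affordable π e₂) (hs₃ : Affordable π e₃)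
    (htime₁ : e₁.time ≤ e₃.reg 0) (htime₂ : e₂.time ≤ e₃.reg 0) (htime₃ : e₃.time ≤ c * (n * b))
    (hqB : 8 * (3 + c) * b + 16 * (e₃.reg 0 / n + 1) ≤ π.B)
    (hD : 200 * (8 * (3 + c) * b + 16 * (e₃.reg 0 / n + 1)) + 300 ≤ π.D)
    (hF : F.Nodup) (hmst : IsMST ⟨I.lists, w⟩ F.toFinset)
    (hout : e₂.out.map (fun e => s(e.fst, e.snd)) = F.map (Sym2.map (fun v : Fin n => (v : ℕ))))
    (h : Choosing I.lists π w (8 * (3 + c) * b) L [] (fun _ => n) [] 0 10 c' s) :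
    Wp I (afterPrep box boundAlg) (fun t => ∃ Q φ,
      Core π (8 * (3 + c) * b + 16 * (e₃.reg 0 / n + 1)) Q φ 200 t ∧ t.reg head = Q.length ∧
      (∃ F' : List (Sym2 (Fin n)), F'.Nodup ∧ F'.toFinset = F.toFinset ∧
        Q.map (fun e => s(e.1, e.2)) = F'.map (Sym2.map (fun v : Fin n => (v : ℕ)))) ∧
      e₁.space ≤ t.space) s := by
  have hn₀ : 0 < n := hn ▸ π.n_pos
  have hLn' := length_le_of_forall_lt hL hLn
  have hpend : ∀ m out, pending false m out = [] := fun m out => rfl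
  refine Wp.seq ((wp_chooseAll hw hn hA hL hLn hLd hX hb rfl (by omega) (by omega) hlen h).mono ?_)
  rintro s₀ - ⟨m, Q, φ, hφ, h₀⟩
  have hm : ∀ u < π.n, m u ≤ π.n := fun u hu => hn ▸ h₀.chosen.le (hn ▸ hu)
  have hQ : Q.length ≤ π.n := hn ▸ h₀.chosen.length_le.trans hLn'
  have hQL := h₀.chosen.length_le_two_mul hL hA
  have hφ' : φ + e₃.time ≤ (3 + c) * (n * b) := by
    have : L.length * (3 * b) ≤ n * (3 * b) := Nat.mul_le_mul_right _ hLn'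
    nlinarith
  have hready : Ready π 3 m (8 * (3 + c) * b) Q φ 130 s₀ :=
    ⟨h₀.core.mono (by norm_num), fun u hu => h₀.mem0 u (hn ▸ hu), fun l hl hl' =>
      h₀.clean l hl (by omega)⟩
  have htick : φ + e₃.time < (Q.length + 1) * (8 * (3 + c) * b) := by
    have h₁ : 0 < (3 + c) * b := Nat.mul_pos (by omega) hb
    have h₂ : n * ((3 + c) * b) ≤ (4 * Q.length + 2) * ((3 + c) * b) :=
      Nat.mul_le_mul_right _ (by omega)
    nlinarith
  refine Wp.seq ((hready.emul (tie := false) (by norm_num) hm hQ (by omega) hn (by simp)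
    (fun _ => rfl) hrun₃ hs₃.peak hs₃.space hs₃.lazyRead (by simp) (by simp) htick).mono ?_)
  rintro s₁ - ⟨h₁, hreg₁, -⟩
  rw [hpend, List.append_nil] at h₁
  have hclock := h₁.core.clock
  have hcnt := h₁.core.cnt_lt
  have hlast := lt_mul_raised_quota (T := e₃.reg 0) hn₀ hb (Q := Q.length) (by omega) hφ' hclock
    hcnt
  refine Wp.seq ((h₁.core.raiseQuota hn (hreg₁ 0) hqB).mono ?_)
  rintro s₂ - ⟨h₂, hmem₂, hreg₂⟩
  have hready₂ : Ready π 2 m (8 * (3 + c) * b + 16 * (e₃.reg 0 / n + 1)) Q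
      (s₁.reg head * (8 * (3 + c) * b + 16 * (e₃.reg 0 / n + 1)) + s₁.reg cnt) 130 s₂ :=
    ⟨h₂.mono (by norm_num), hmem₂ ▸ h₁.mem0, fun l hl hl' a => by
      rw [hmem₂, hreg₂ l hl (by omega)]
      exact h₁.clean l hl hl' a⟩
  refine Wp.seq ((hready₂.emul (tie := false) (by norm_num) hm hQ hD hn (by simp)
    (fun _ => rfl) hrun₁ hs₁.peak hs₁.space hs₁.lazyRead (by simp) (by simp) (by omega)).mono ?_)
  rintro s₃ - ⟨h₃, -, hspace₃⟩
  rw [hpend, List.append_nil] at h₃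
  have hout₂ : ∀ x ∈ e₂.out, x.fst < π.n ∧ x.snd < π.n := by
    intro x hx
    have : s(x.fst, x.snd) ∈ e₂.out.map (fun e => s(e.fst, e.snd)) := List.mem_map.2 ⟨x, hx, rfl⟩
    rw [hout] at this
    obtain ⟨f, -, hf⟩ := List.mem_map.1 this
    rw [hn]
    induction f with
    | h a b =>
      rw [Sym2.map_mk] at hf
      rcases Sym2.eq_iff.1 hf with ⟨h₁, h₂⟩ | ⟨h₁, h₂⟩
      · exact ⟨h₁ ▸ a.2, h₂ ▸ b.2⟩
      · exact ⟨h₂ ▸ b.2, h₁ ▸ a.2⟩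
  have hlen₂ : e₂.out.length ≤ π.n := by
    have h₁ := congrArg List.length hout
    rw [List.length_map, List.length_map, ← List.toFinset_card_of_nodup hF] at h₁
    have := hmst.1.card_add_one
    omega
  have h₃' : Ready π 1 m (8 * (3 + c) * b + 16 * (e₃.reg 0 / n + 1)) Q _ 130 s₃ :=
    ⟨h₃.core.mono (by norm_num), h₃.mem0, h₃.clean⟩
  refine Wp.seq ((h₃'.emul (tie := true) (by norm_num) hm hQ hD hn (fun _ => hw) (by simp) hrun₂
    hs₂.peak hs₂.space hs₂.lazyRead (fun _ => hout₂) (fun _ => hlen₂) (by omega)).mono ?_)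
  rintro s₄ hle₄ ⟨h₄, -, -⟩
  refine (h₄.core.flush hD le_rfl).mono ?_
  rintro s₅ hle₅ ⟨φ', h₅, hhead⟩
  exact ⟨_, φ', h₅, hhead, h₀.chosen.exists_list hA hw hF hmst hout,
    hspace₃.trans (hle₄.space.trans hle₅.space)⟩

end

/-! ### Resources of the enumeration -/

theorem AdjLists.avgDegree_mul {n : ℕ} (A : AdjLists n) (hn : 0 < n) :
    A.avgDegree * n = A.degSum 0 := by
  have : (n : ℚ) ≠ 0 := by positivity
  rw [AdjLists.avgDegree, div_mul_cancel₀ _ this, AdjLists.degSum_zero]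
  push_cast
  rfl

/-- The delay is in `O(T / n)`, since an algorithm that solves the problem needs at least linear
time. -/
theorem delay_le {n M T K : ℕ} (hn₀ : 0 < n) (hM : M ≤ 4 * T) (hn : n ≤ T + 1) (hT : 1 ≤ T) :
    ((200 * (K * (M / n + 1) + 16 * (T / n + 1)) + 300 : ℕ) : ℚ) ≤
      (1200 * K + 10200 : ℕ) * ((T : ℚ) / n) := by
  have hn' : (0 : ℚ) < n := by exact_mod_cast hn₀
  rw [← mul_div_assoc, le_div_iff₀ hn']
  have h₁ := Nat.div_mul_le_self M n
  have h₂ := Nat.div_mul_le_self T n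
  have h : (200 * (K * (M / n + 1) + 16 * (T / n + 1)) + 300) * n ≤ (1200 * K + 10200) * T := by
    have h₃ : K * ((M / n) * n + n) ≤ K * (6 * T) := Nat.mul_le_mul_left _ (by omega)
    nlinarith
  exact_mod_cast h

/-- On every input, the enumeration emulates three runs and respects all bounds. -/
theorem exists_run_enumeration {box boundAlg : Prog} {T S ST : ∀ n : ℕ, AdjLists n → ℕ}
    (hbox : SolvesMST box) (hT : RunsInTime box T) (hS : HasSpaceComplexity box S)
    (hboundAlg : Computes boundAlg T) (hST : HasSpaceComplexity boundAlg ST) {c : ℕ}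
    (hc : ∀ (n : ℕ) (I : Input n), I.lists.graph.Connected → ∀ s, Run boundAlg I s →
      s.time ≤ c * (I.lists.degSum 0 + 1)) {X : ℕ → ℕ} (hXn : ∀ n, n ≤ X n)
    (hX₁ : ∀ (n : ℕ) (I : Input n), I.lists.graph.Connected → ∀ s, Run box I s → s.peak ≤ X n)
    (hX₂ : ∀ (n : ℕ) (I : Input n), I.lists.graph.Connected → ∀ s, Run boundAlg I s →
      4 * s.peak ≤ X n) (n : ℕ) (I : Input n) (hI : I.lists.graph.Connected) :
    ∃ (s : Config) (p : ℕ), Run (enumeration (8 * (3 + c)) box boundAlg) I s ∧ EmitsMST I s ∧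
      n ≤ p ∧ p ≤ 71 * n ∧
      HasDelay s p ((1200 * (8 * (3 + c)) + 10200 : ℕ) * ((T n I.lists : ℚ) / n)) ∧
      s.peak ≤ (64 + 4 * (8 * (3 + c))) * (X n * X n + X n + 1) ∧ n ≤ s.space ∧
      s.space ≤ 24 * (n + S n I.lists + ST n I.lists) ∧
      (∀ e, Run box I e → e.space ≤ s.space) ∧
      (NoLazyMemory box → NoLazyMemory boundAlg → s.lazyRead = false) := by
  obtain ⟨w, hw, hw'⟩ := exists_perturbation I.weight
  obtain ⟨hM, hnT, hT₁⟩ := sum_degree_le_of_solvesMST hbox hT hI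
  rw [← AdjLists.degSum_zero] at hM
  have hn : 0 < n := Fin.pos_iff_nonempty.2 hI.nonempty
  obtain ⟨e₁, h₁, -⟩ := hbox n I hI
  obtain ⟨e₂, h₂, F, hF, hmst, hout⟩ := hbox n ⟨I.lists, w⟩ hI
  obtain ⟨e₃, h₃, hres⟩ := hboundAlg n I hI
  have hpeak₃ := hX₂ n I hI e₃ h₃
  have hTe : T n I.lists ≤ e₃.peak := hres ▸ (h₃.bounded Config.bounded_start).1 0
  have hS₁ : e₁.space ≤ S n I.lists := (hS n I.lists hI).2 ⟨_, _, h₁, rfl⟩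
  have hS₂ : e₂.space ≤ S n I.lists := (hS n I.lists hI).2 ⟨_, _, h₂, rfl⟩
  have hS₃ : e₃.space ≤ ST n I.lists := (hST n I.lists hI).2 ⟨_, _, h₃, rfl⟩
  have hXn' := hXn n
  have hMX : I.lists.degSum 0 ≤ X n := by omega
  have hTX : T n I.lists ≤ X n := by omega
  have hXX := Nat.zero_le (X n * X n)
  set K := 8 * (3 + c) with hK
  set b := I.lists.degSum 0 / n + 1 with hb
  have hbX : b ≤ X n + 1 := Nat.succ_le_succ ((Nat.div_le_self _ _).trans hMX)
  have hKb : K * b ≤ K * (X n + 1) := Nat.mul_le_mul_left _ hbX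
  have hTd : T n I.lists / n ≤ T n I.lists := Nat.div_le_self _ _
  set B := (64 + 4 * K) * (X n * X n + X n + 1) with hB
  have hBK : K * (X n + 1) + 16 * (X n + 1) ≤ B := by
    rw [hB, ← add_mul]
    exact Nat.mul_le_mul (by omega) (by omega)
  set q := K * b + 16 * (T n I.lists / n + 1) with hq
  have hqB : q ≤ B := by omega
  set Sp := 24 * (n + S n I.lists + ST n I.lists) with hSp
  obtain ⟨t, ht, s, hs, rfl⟩ := wp_prep (I := I) (K := K) (B := B) (Sp := Sp) hn hXn' hMX le_rfl
    (by omega)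
  let π : Params :=
    { n := n
      p := s.tick.time
      D := 200 * q + 300
      X := X n
      B := B
      Sp := Sp
      Z := ¬ (NoLazyMemory box ∧ NoLazyMemory boundAlg)
      n_pos := hn
      le_X := hXn'
      le_B := Nat.mul_le_mul_right _ (by omega)
      le_Sp := by omega }
  obtain ⟨L, i, hL, hLn, hLd, hLlen, hlen, hstart⟩ :=
    Collecting.exists_choosing (π := π) (w := w) rfl rfl (by omega) (by show K * b ≤ B; omega) hs
  obtain ⟨t, ht', Q, φ, hcore, hhead, ⟨F', hF', hFF', hQ⟩, hspace⟩ :=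
    wp_afterPrep (π := π) (box := box) (boundAlg := boundAlg) (b := b) (c := c) (e₁ := e₁)
      (e₂ := e₂) (e₃ := e₃) hw rfl hI hL hLn hLd hLlen (Nat.succ_pos _) hMX hlen h₁ h₂ h₃
      ⟨hX₁ n I hI _ h₁, by show 8 * e₁.space ≤ Sp; omega, fun hz hZ => by
        simp [hZ.1 n I hI _ h₁] at hz⟩
      ⟨hX₁ n ⟨I.lists, w⟩ hI _ h₂, by show 8 * e₂.space ≤ Sp; omega, fun hz hZ => by
        simp [hZ.1 n ⟨I.lists, w⟩ hI _ h₂] at hz⟩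
      ⟨by show e₃.peak ≤ X n; omega, by show 8 * e₃.space ≤ Sp; omega, fun hz hZ => by
        simp [hZ.2 n I hI _ h₃] at hz⟩
      (hres ▸ hT n I hI _ h₁) (hres ▸ hT n ⟨I.lists, w⟩ hI _ h₂)
      ((hc n I hI _ h₃).trans (Nat.mul_le_mul_left _ (I.lists.degSum_lt hn)))
      (by rw [hres]; exact hqB) (by rw [hres]) hF hmst hout hstart
  rw [hres] at hcore
  refine ⟨t, s.tick.time, .seq ht ht', ?_, ?_, ?_, ?_, hcore.peak, ?_, hcore.space, ?_, ?_⟩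
  · refine ⟨F', hF', hFF' ▸ hmst.of_perturbation hw', ?_⟩
    have := hcore.out
    rw [hhead, List.take_length] at this
    rw [← hQ, ← this, List.map_map]
    rfl
  · exact hs.le_time.trans (Nat.le_succ _)
  · have := hs.time_le
    simp only [Config.tick]
    omega
  · have hchain : List.IsChain (fun a b => a ≤ b ∧ b ≤ a + π.D)
        (s.tick.time :: (t.out.map Emission.time ++ [t.time])) := by
      refine isChain_concat hcore.chain ⟨hcore.last_le, hcore.recent.trans ?_⟩
      have hcnt : t.reg cnt < q := hcore.cnt_lt
      show _ ≤ lastTime π.p t + (200 * q + 300)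
      omega
    refine hchain.imp fun a b hab => ⟨hab.1, ?_⟩
    have hD := delay_le (K := K) hn hM hnT hT₁
    have h : (b : ℚ) ≤ a + π.D := by exact_mod_cast hab.2
    have hπ : (π.D : ℚ) = ((200 * q + 300 : ℕ) : ℚ) := rfl
    rw [hπ] at h
    linarith
  · exact hs.le_space.trans ht'.le.space
  · exact fun e he => he.unique h₁ ▸ hspace
  · intro hz₁ hz₂
    by_contra hz
    exact hcore.lazyRead (by simpa using hz) ⟨hz₁, hz₂⟩

end EnumMST

theorem mainTheorem3
    -- the word size, in `Ω(log n)`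
    (β : ℕ → ℕ) (hβ : ∃ c : ℕ, ∀ n : ℕ, Nat.size n ≤ c * β n)
    -- an algorithm for minimum spanning trees, with running time at most `T` and space `S`
    (box : EnumMST.Prog) (T S : ∀ n : ℕ, EnumMST.AdjLists n → ℕ)
    (hbox : EnumMST.SolvesMST box) (hboxWords : EnumMST.FitsWords β box)
    (hT : EnumMST.RunsInTime box T) (hS : EnumMST.HasSpaceComplexity box S)
    -- an algorithm that computes `T` in `O(average degree * n)` steps, with space `ST`
    (boundAlg : EnumMST.Prog) (ST : ∀ n : ℕ, EnumMST.AdjLists n → ℕ)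
    (hboundAlg : EnumMST.Computes boundAlg T) (hboundWords : EnumMST.FitsWords β boundAlg)
    (hboundTime : EnumMST.RunsInDegreeTime boundAlg)
    (hST : EnumMST.HasSpaceComplexity boundAlg ST) :
    ∃ (enum : EnumMST.Prog) (C : ℕ) (S' : ∀ n : ℕ, EnumMST.AdjLists n → ℕ),
      EnumMST.FitsWords β enum ∧
      -- an MST is enumerated with preprocessing in `Θ(n)` and delay in `O(T / n)`
      (∀ (n : ℕ) (I : EnumMST.Input n), I.lists.graph.Connected →
        ∃ s, EnumMST.Run enum I s ∧ EnumMST.EmitsMST I s ∧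
          ∃ p : ℕ, n ≤ C * p ∧ p ≤ C * n ∧
            EnumMST.HasDelay s p (C * ((T n I.lists : ℚ) / n))) ∧
      -- the space is in `Ω(n + S)` and in `O(n + S + ST)`
      EnumMST.HasSpaceComplexity enum S' ∧
      (∀ (n : ℕ) (A : EnumMST.AdjLists n), A.graph.Connected →
        n + S n A ≤ C * S' n A ∧ S' n A ≤ C * (n + S n A + ST n A)) ∧
      -- no initialized memory is needed beyond what the two given algorithms need
      (EnumMST.NoLazyMemory box → EnumMST.NoLazyMemory boundAlg →
        EnumMST.NoLazyMemory enum) := by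
  obtain ⟨k, hk⟩ := hβ
  obtain ⟨K₁, hK₁⟩ := hboxWords
  obtain ⟨K₂, hK₂⟩ := hboundWords
  obtain ⟨c, hc⟩ := hboundTime
  -- the numbers that the emulated programs compute are at most `X n`
  let X : ℕ → ℕ := fun n => 4 * 2 ^ ((k + K₁ + K₂) * β n)
  have hpow : ∀ {l : ℕ}, l ≤ k + K₁ + K₂ → ∀ n, 4 * 2 ^ (l * β n) ≤ X n := fun hl n =>
    Nat.mul_le_mul_left _ (Nat.pow_le_pow_right (by norm_num) (Nat.mul_le_mul_right _ hl))
  have hXn : ∀ n, n ≤ X n := by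
    intro n
    have h₁ : n < 2 ^ (k * β n) :=
      (Nat.lt_size_self n).trans_le (Nat.pow_le_pow_right (by norm_num) (hk n))
    have := hpow (l := k) (by omega) n
    omega
  have hspec := EnumMST.exists_run_enumeration hbox hT hS hboundAlg hST (c := c) (X := X)
    (fun n I hI s hs => by
      have hn : 0 < n := Fin.pos_iff_nonempty.2 hI.nonempty
      have := hc n I hI s hs
      rw [EnumMST.AdjLists.avgDegree_mul _ hn] at this
      exact_mod_cast this)
    hXn
    (fun n I hI s hs => by
      have h₁ := hK₁ n I hI s hs
      have := hpow (l := K₁) (by omega) n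
      omega)
    (fun n I hI s hs => by
      have h₁ := hK₂ n I hI s hs
      have := hpow (l := K₂) (by omega) n
      omega)
  set enum := EnumMST.enumeration (8 * (3 + c)) box boundAlg
  set C := 1200 * (8 * (3 + c)) + 10200 with hC
  set G := (64 + 4 * (8 * (3 + c))) * 48 with hG
  -- the space complexity exists, since the space is bounded on every graph
  have hmax : ∀ (n : ℕ) (A : EnumMST.AdjLists n), A.graph.Connected → ∃ k, IsGreatest
      {k : ℕ | ∃ (w : Sym2 (Fin n) → ℝ) (s : EnumMST.Config),
        EnumMST.Run enum ⟨A, w⟩ s ∧ s.space = k} k := by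
    intro n A hA
    have hbdd : BddAbove {k : ℕ | ∃ (w : Sym2 (Fin n) → ℝ) (s : EnumMST.Config),
        EnumMST.Run enum ⟨A, w⟩ s ∧ s.space = k} := by
      refine ⟨24 * (n + S n A + ST n A), ?_⟩
      rintro _ ⟨w, s, hs, rfl⟩
      obtain ⟨t, -, ht, -, -, -, -, -, -, hspace, -⟩ := hspec n ⟨A, w⟩ hA
      exact hs.unique ht ▸ hspace
    have hne : {k : ℕ | ∃ (w : Sym2 (Fin n) → ℝ) (s : EnumMST.Config),
        EnumMST.Run enum ⟨A, w⟩ s ∧ s.space = k}.Nonempty := by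
      obtain ⟨t, -, ht, -⟩ := hspec n ⟨A, fun _ => 0⟩ hA
      exact ⟨_, _, t, ht, rfl⟩
    exact ⟨_, Nat.sSup_mem hne hbdd, fun _ h => le_csSup hbdd h⟩
  choose! S' hS' using hmax
  refine ⟨enum, C, S', ⟨G + 2 * (k + K₁ + K₂), fun n I hI s hs => ?_⟩, fun n I hI => ?_, hS',
    fun n A hA => ⟨?_, ?_⟩, fun hz₁ hz₂ n I hI s hs => ?_⟩
  · obtain ⟨t, -, ht, -, -, -, -, hpeak, -⟩ := hspec n I hI
    rw [hs.unique ht]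
    have hβ₁ : 1 ≤ β n := by
      have hn : 0 < n := Fin.pos_iff_nonempty.2 hI.nonempty
      have := (Nat.size_pos.2 hn).trans_le (hk n)
      exact Nat.pos_of_mul_pos_left this
    set a := 2 ^ ((k + K₁ + K₂) * β n) with ha
    have ha₁ : 1 ≤ a := Nat.one_le_two_pow
    calc t.peak ≤ (64 + 4 * (8 * (3 + c))) * (4 * a * (4 * a) + 4 * a + 1) := hpeak
      _ ≤ (64 + 4 * (8 * (3 + c))) * (48 * (a * a)) := Nat.mul_le_mul_left _ (by nlinarith)
      _ = G * (a * a) := by rw [hG]; ring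
      _ < 2 ^ G * (a * a) := Nat.mul_lt_mul_of_pos_right Nat.lt_two_pow_self (by positivity)
      _ ≤ 2 ^ (G * β n) * (a * a) :=
        Nat.mul_le_mul_right _ (Nat.pow_le_pow_right (by norm_num) (Nat.le_mul_of_pos_right _ hβ₁))
      _ = 2 ^ ((G + 2 * (k + K₁ + K₂)) * β n) := by
        rw [ha, ← pow_add, ← pow_add]
        congr 1
        ring
  · obtain ⟨t, p, ht, hmst, hp₁, hp₂, hdelay, -⟩ := hspec n I hI
    exact ⟨t, ht, hmst, p, hp₁.trans (Nat.le_mul_of_pos_left _ (by omega)),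
      hp₂.trans (Nat.mul_le_mul_right _ (by omega)), hdelay⟩
  · obtain ⟨w, e, he, hSe⟩ := (hS n A hA).1
    obtain ⟨t, -, ht, -, -, -, -, -, hn, -, hle, -⟩ := hspec n ⟨A, w⟩ hA
    have h₁ : t.space ≤ S' n A := (hS' n A hA).2 ⟨w, t, ht, rfl⟩
    have h₂ := hle e he
    calc n + S n A ≤ 2 * S' n A := by omega
      _ ≤ C * S' n A := Nat.mul_le_mul_right _ (by omega)
  · obtain ⟨w, e, he, hSe⟩ := (hS' n A hA).1
    obtain ⟨t, -, ht, -, -, -, -, -, -, hle, -⟩ := hspec n ⟨A, w⟩ hA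
    rw [← hSe, he.unique ht]
    exact hle.trans (Nat.mul_le_mul_right _ (by omega))
  · obtain ⟨t, -, ht, -, -, -, -, -, -, -, -, hz⟩ := hspec n I hI
    exact hs.unique ht ▸ hz hz₁ hz₂
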